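/- **Proposition 2.2 (Equivariant trace formula).** Let $G$ be a connected semisimple real Lie group with Haar measure $dx$, let $\Gamma\subset G$ be a discrete subgroup with $\Gamma\backslash G$ compact, let $(\varphi,V)$ be a finite dimensional unitary representation of $\Gamma$ with dual representation $\breve\varphi$ on $V^*$, and let $g\in G$ satisfy $g\Gamma g^{-1}=\Gamma$ and $\varphi(g\gamma g^{-1})=\varphi(\gamma)$ for all $\gamma\in\Gamma$. Let $L^2(\Gamma\backslash G,\breve\varphi)$ be the Hilbert space of (classes of) measurable $s:G\to V^*$ with $s(\gamma x)=\breve\varphi(\gamma)s(x)$ and $\int_{\Gamma\backslash G}\|s(x)\|^2dx<\infty$. The group $G$ acts on it by right translation, and $g^*s(x):=s(gx)$ defines a bounded operator $g^*$ commuting with $G$. Let $f$ be a smooth complex valued function on $G$ such that $f$ and all its left invariant derivatives $X_1\cdots X_kf$ ($X_i\in\mathrm{Lie}\,G$) are integrable; this includes every smooth function of rapid decay. Then $s*f(x)=\int_G s(y)f(y^{-1}x)\,dy$ converges for every $x\in G$ and defines a bounded operator $s\mapsto s*f$ of trace class on $L^2(\Gamma\backslash G,\breve\varphi)$. For every $\pi$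 in the unitary dual $\hat G$ the space $\mathrm{Hom}_G(\pi,L^2(\Gamma\backslash G,\breve\varphi))$ is finite dimensional, and if it is nonzero, then the operator $\pi(f):=\int_G f(x)\,\pi(x^{-1})\,dx$, through which $s\mapsto s*f$ acts on $\pi$, is of trace class. Write $g^\Gamma_\pi$ for the operator $T\mapsto g^*\circ T$ on this Hom space. For $\gamma\in\Gamma$ let $\Gamma_{\gamma g}$ and $G_{\gamma g}$ be the centralizers of $\gamma g$ in $\Gamma$ and in $G$, fix any Haar measure on $G_{\gamma g}$, and let $G_{\gamma g}\backslash G$ carry the quotient measure. Then $\mathrm{vol}(\Gamma_{\gamma g}\backslash G_{\gamma g})<\infty$, the orbital integral $$\mathcal O_{\gamma g}(f)=\int_{G_{\gamma g}\backslash G}f(x^{-1}\gamma g x)\,dx$$ converges absolutely, and $$\mathrm{tr}\bigl(g^*(\,\cdot*f)\bigr)=\sum_{\pi\in\hat G}\mathrm{tr}\,g^\Gamma_\pi\;\mathrm{tr}\,\pi(f)=\sum_{[\gamma g]_\Gamma}\mathrm{vol}(\Gamma_{\gamma g}\backslash G_{\gamma g})\;\mathrm{tr}\,\varphi(\gamma)\;\mathcal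 O_{\gamma g}(f),$$ where the last sum runs over the $\Gamma$-conjugacy classes in the coset $\Gamma g$ and both sums converge absolutely (terms with $\mathrm{Hom}_G(\pi,L^2(\Gamma\backslash G,\breve\varphi))=0$ are zero). -/

import Mathlib

open MeasureTheory Set Filter Topology
open scoped Manifold ContDiff ENNReal

universe u

noncomputable section

namespace EquivTrace

/-! ### Trace class operators -/

section TraceClass

variable {H : Type u} [NormedAddCommGroup H] [InnerProductSpace ℂ H]

/-- A bounded operator `T` on a Hilbert space is of trace class if
`∑ |⟨e n, T (f n)⟩| < ∞` for all orthonormal sequences `e`, `f` (on a finite dimensional space,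
where there are no such sequences, every operator is of trace class). -/
def IsTraceClass (T : H →L[ℂ] H) : Prop :=
  ∀ e f : ℕ → H, Orthonormal ℂ e → Orthonormal ℂ f →
    Summable fun n => ‖inner ℂ (e n) (T (f n))‖

/-- `T` is of trace class and `tr T = t`, the trace being computed in any orthonormal basis. -/
def HasTrace (T : H →L[ℂ] H) (t : ℂ) : Prop :=
  IsTraceClass T ∧
    ∀ (ι : Type u) (b : HilbertBasis ι ℂ H), HasSum (fun i => inner ℂ (b i) (T (b i))) t

open Classical in
/-- The trace `tr T` of a trace class operator (and `0` if there is none). -/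
def opTrace (T : H →L[ℂ] H) : ℂ :=
  if h : ∃ t, HasTrace T t then h.choose else 0

end TraceClass

/-! ### The unitary dual and the operators `π(f)` -/

section UnitaryDual

/-- An irreducible unitary representation of a topological group on a Hilbert space. -/
structure IrrUnitaryRep (G : Type u) [Group G] [TopologicalSpace G] : Type (u + 1) where
  space : Type u
  [instNormed : NormedAddCommGroup space]
  [instInner : InnerProductSpace ℂ space]
  [instComplete : CompleteSpace space]
  rep : G →* (space ≃ₗᵢ[ℂ] space)
  continuous_orbit : ∀ v, Continuous fun x => rep x v
  nontrivial : Nontrivial space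
  irreducible : ∀ W : Submodule ℂ space, IsClosed (W : Set space) →
    (∀ x, ∀ v ∈ W, rep x v ∈ W) → W = ⊥ ∨ W = ⊤

attribute [instance] IrrUnitaryRep.instNormed IrrUnitaryRep.instInner
  IrrUnitaryRep.instComplete

variable {G : Type u} [Group G] [TopologicalSpace G]

/-- Unitary equivalence. -/
instance IrrUnitaryRep.setoid : Setoid (IrrUnitaryRep G) where
  r π σ := ∃ U : π.space ≃ₗᵢ[ℂ] σ.space, ∀ x v, U (π.rep x v) = σ.rep x (U v)
  iseqv :=
    { refl := fun π => ⟨LinearIsometryEquiv.refl ℂ π.space, fun _ _ => rfl⟩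
      symm := by
        rintro π σ ⟨U, hU⟩
        refine ⟨U.symm, fun x v => ?_⟩
        apply U.injective
        rw [hU]
        simp
      trans := by
        rintro π σ τ ⟨U, hU⟩ ⟨W, hW⟩
        refine ⟨U.trans W, fun x v => ?_⟩
        simp [hU, hW] }

variable (G) in
/-- The unitary dual `Ĝ`. -/
def UnitaryDual : Type (u + 1) := Quotient (IrrUnitaryRep.setoid (G := G))

/-- A representative of a class in the unitary dual. -/
def UnitaryDual.out (π : UnitaryDual G) : IrrUnitaryRep G := Quotient.out π

variable [IsTopologicalGroup G] [SecondCountableTopology G] [MeasurableSpace G] [BorelSpace G]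

theorem IrrUnitaryRep.integrable_smul (π : IrrUnitaryRep G) {μ : Measure G} {f : G → ℂ}
    (hf : Integrable f μ) (v : π.space) : Integrable (fun x => f x • π.rep x⁻¹ v) μ := by
  refine (hf.norm.mul_const ‖v‖).mono' ?_ ?_
  · exact hf.aestronglyMeasurable.smul
      ((π.continuous_orbit v).comp continuous_inv).aestronglyMeasurable
  · exact Eventually.of_forall fun x => by simp [norm_smul]

open Classical in
/-- The bounded operator `π(f) v = ∫ f(x) π(x⁻¹) v dx` for integrable `f`: the operator which the
right convolution `s ↦ s * f` induces on the space of `π`. -/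
def IrrUnitaryRep.op (π : IrrUnitaryRep G) (μ : Measure G) (f : G → ℂ) :
    π.space →L[ℂ] π.space :=
  if hf : Integrable f μ then
    LinearMap.mkContinuous
      { toFun := fun v => ∫ x, f x • π.rep x⁻¹ v ∂μ
        map_add' := fun v w => by
          rw [← integral_add (π.integrable_smul hf v) (π.integrable_smul hf w)]
          simp
        map_smul' := fun c v => by
          rw [RingHom.id_apply, ← integral_smul]
          simp [smul_comm c] }
      (∫ x, ‖f x‖ ∂μ) (fun v => by
        refine (norm_integral_le_integral_norm _).trans ?_
        rw [← integral_mul_const]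
        exact le_of_eq (integral_congr_ae (Eventually.of_forall fun x => by simp [norm_smul])))
  else 0

end UnitaryDual

/-! ### Fundamental domains -/

section FundamentalDomain

variable {G : Type u} [Group G] [TopologicalSpace G] [IsTopologicalGroup G]
  [SecondCountableTopology G] [MeasurableSpace G] [BorelSpace G]

/-- A discrete subgroup of a second countable group has a measurable fundamental domain for its
action by left translations. -/
theorem hasFundamentalDomain (Γ : Subgroup G) [DiscreteTopology Γ] (μ : Measure G) :
    HasFundamentalDomain Γ G μ := by
  obtain ⟨O, hO, hO1⟩ : ∃ O : Set G, IsOpen O ∧ ((↑) : Γ → G) ⁻¹' O = {1} :=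
    isOpen_induced_iff.1 (isOpen_discrete ({1} : Set Γ))
  have h1O : (1 : G) ∈ O := by
    have : (1 : Γ) ∈ ((↑) : Γ → G) ⁻¹' O := by rw [hO1]; rfl
    simpa using this
  have hc : Continuous fun p : G × G => p.1 * p.2⁻¹ := by fun_prop
  have hn : (fun p : G × G => p.1 * p.2⁻¹) ⁻¹' O ∈ 𝓝 ((1 : G), (1 : G)) :=
    hc.continuousAt.preimage_mem_nhds (by simpa using hO.mem_nhds h1O)
  rw [nhds_prod_eq, mem_prod_same_iff] at hn
  obtain ⟨U', hU', hU'O⟩ := hn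
  obtain ⟨U, hUU', hUo, h1U⟩ := mem_nhds_iff.1 hU'
  have key : ∀ γ : Γ, ∀ y : G, ∀ x : G, y * x⁻¹ ∈ U → (γ : G) * y * x⁻¹ ∈ U → γ = 1 := by
    intro γ y x h h'
    have h2 : ((γ : G) * y * x⁻¹, y * x⁻¹) ∈ U' ×ˢ U' := ⟨hUU' h', hUU' h⟩
    have h3 : γ ∈ ((↑) : Γ → G) ⁻¹' O := by
      have := hU'O h2
      simpa [mul_assoc] using this
    rw [hO1] at h3
    exact h3
  obtain ⟨s, hs, hcov⟩ := TopologicalSpace.countable_cover_nhds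
    (f := fun x : G => {y | y * x⁻¹ ∈ U})
    (fun x => (hUo.preimage (continuous_mul_const x⁻¹)).mem_nhds (by simpa using h1U))
  have hsne : s.Nonempty := by
    have : (1 : G) ∈ ⋃ x ∈ s, {y | y * x⁻¹ ∈ U} := by rw [hcov]; trivial
    simp only [mem_iUnion] at this
    obtain ⟨x, hx, -⟩ := this
    exact ⟨x, hx⟩
  obtain ⟨x, rfl⟩ := hs.exists_eq_range hsne
  let A : ℕ → Set G := fun n => {y | y * (x n)⁻¹ ∈ U}
  have hA : ∀ n, IsOpen (A n) := fun n => hUo.preimage (continuous_mul_const _)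
  let S : ℕ → Set G := fun n => ⋃ γ : Γ, {y | (γ : G) * y ∈ A n}
  have hS : ∀ n, IsOpen (S n) := fun n =>
    isOpen_iUnion fun γ => (hA n).preimage (continuous_const_mul _)
  have hSinv : ∀ n (γ : Γ) y, (γ : G) * y ∈ S n ↔ y ∈ S n := by
    intro n γ y
    simp only [S, mem_iUnion, mem_ofPred_eq]
    constructor
    · rintro ⟨η, h⟩
      exact ⟨η * γ, by simpa [mul_assoc] using h⟩
    · rintro ⟨η, h⟩
      exact ⟨η * γ⁻¹, by simpa [mul_assoc] using h⟩
  have hSA : ∀ n, A n ⊆ S n := fun n y hy => mem_iUnion.2 ⟨1, by simpa using hy⟩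
  have hScov : ∀ y, ∃ n, y ∈ S n := by
    intro y
    have : y ∈ ⋃ z ∈ range x, {y | y * z⁻¹ ∈ U} := by rw [hcov]; trivial
    simp only [mem_iUnion, mem_range] at this
    obtain ⟨-, ⟨n, rfl⟩, h⟩ := this
    exact ⟨n, hSA n h⟩
  refine ⟨⟨⋃ n, A n ∩ ⋂ m ∈ {m | m < n}, (S m)ᶜ, IsFundamentalDomain.mk' ?_ ?_⟩⟩
  · refine MeasurableSet.nullMeasurableSet (MeasurableSet.iUnion fun n => ?_)
    exact (hA n).measurableSet.inter
      (MeasurableSet.biInter (Set.to_countable _) fun m _ => (hS m).measurableSet.compl)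
  · intro y
    classical
    obtain ⟨γ, hγ⟩ := mem_iUnion.1 (Nat.find_spec (hScov y))
    have hmem : ∀ η : Γ, η • y ∈ (⋃ n, A n ∩ ⋂ m ∈ {m | m < n}, (S m)ᶜ) →
        (η : G) * y ∈ A (Nat.find (hScov y)) := by
      intro η hη
      obtain ⟨n, h1, h2⟩ := mem_iUnion.1 hη
      have h1' : (η : G) * y ∈ A n := h1
      have : Nat.find (hScov y) = n := by
        rw [Nat.find_eq_iff]
        refine ⟨(hSinv n η y).1 (hSA n h1'), fun m hm hy => ?_⟩
        have := mem_iInter₂.1 h2 m hm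
        exact this ((hSinv m η y).2 hy)
      rwa [this]
    refine ⟨γ, mem_iUnion.2 ⟨Nat.find (hScov y), hγ, ?_⟩, ?_⟩
    · refine mem_iInter₂.2 fun m hm hy => ?_
      exact Nat.find_min (hScov y) hm ((hSinv m γ y).1 hy)
    · intro η hη
      have h1 := hmem η hη
      have h2 := key (η * γ⁻¹) ((γ : G) * y) (x (Nat.find (hScov y))) hγ (by
        have h3 : (η : G) * y * (x (Nat.find (hScov y)))⁻¹ ∈ U := h1
        simpa [mul_assoc] using h3)
      exact mul_inv_eq_one.1 h2

/-- A fundamental domain for the action of `Γ` on `G` by left translations. -/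
def fundDomain (Γ : Subgroup G) [DiscreteTopology Γ] (μ : Measure G) : Set G :=
  (hasFundamentalDomain Γ μ).ExistsIsFundamentalDomain.choose

theorem isFundamentalDomain (Γ : Subgroup G) [DiscreteTopology Γ] (μ : Measure G) :
    IsFundamentalDomain Γ (fundDomain Γ μ) μ :=
  (hasFundamentalDomain Γ μ).ExistsIsFundamentalDomain.choose_spec

end FundamentalDomain

/-! ### The dual representation -/

section Dual

variable {V : Type u} [NormedAddCommGroup V] [InnerProductSpace ℂ V]

/-- The inner product of the dual space `V*` for which the Riesz map `V → V*` is antiunitary; its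
norm is the operator norm. -/
instance dualInner [FiniteDimensional ℂ V] : InnerProductSpace ℂ (StrongDual ℂ V) :=
  haveI := FiniteDimensional.complete ℂ V
  { (inferInstance : NormedSpace ℂ (StrongDual ℂ V)) with
    inner := fun l m => inner ℂ ((InnerProductSpace.toDual ℂ V).symm m)
      ((InnerProductSpace.toDual ℂ V).symm l)
    norm_sq_eq_re_inner := fun l => by
      rw [← norm_sq_eq_re_inner, LinearIsometryEquiv.norm_map]
    conj_inner_symm := fun l m => inner_conj_symm _ _
    add_left := fun l m n => by rw [map_add, inner_add_right]
    smul_left := fun l m r => by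
      rw [LinearIsometryEquiv.map_smulₛₗ, inner_smul_right] }

variable {G : Type u} [Group G] {Γ : Subgroup G}

/-- The dual representation `φ̆(γ) l = l ∘ φ(γ)⁻¹` on `V*`. -/
def dualRep (φ : Γ →* (V ≃ₗᵢ[ℂ] V)) : Γ →* (StrongDual ℂ V ≃ₗᵢ[ℂ] StrongDual ℂ V) where
  toFun γ :=
    { toFun := fun l => l.comp ((φ γ⁻¹).toContinuousLinearEquiv : V →L[ℂ] V)
      invFun := fun l => l.comp ((φ γ).toContinuousLinearEquiv : V →L[ℂ] V)
      map_add' := fun _ _ => rfl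
      map_smul' := fun _ _ => rfl
      left_inv := fun l => by
        ext v
        change l (φ γ⁻¹ (φ γ v)) = l v
        have h : φ γ⁻¹ * φ γ = 1 := by rw [← map_mul, inv_mul_cancel, map_one]
        exact congrArg l (DFunLike.congr_fun h v)
      right_inv := fun l => by
        ext v
        change l (φ γ (φ γ⁻¹ v)) = l v
        have h : φ γ * φ γ⁻¹ = 1 := by rw [← map_mul, mul_inv_cancel, map_one]
        exact congrArg l (DFunLike.congr_fun h v)
      norm_map' := fun l => ContinuousLinearMap.opNorm_comp_linearIsometryEquiv l (φ γ⁻¹) }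
  map_one' := by
    ext l v
    change l (φ 1⁻¹ v) = l v
    simp
  map_mul' γ η := by
    ext l v
    change l (φ (γ * η)⁻¹ v) = l (φ η⁻¹ (φ γ⁻¹ v))
    simp

theorem dualRep_conj {φ : Γ →* (V ≃ₗᵢ[ℂ] V)} {g : G}
    (hφ : ∀ γ η : Γ, (η : G) = g * γ * g⁻¹ → φ η = φ γ) (γ η : Γ)
    (h : (η : G) = g * γ * g⁻¹) : dualRep φ η = dualRep φ γ := by
  ext l v
  change l (φ η⁻¹ v) = l (φ γ⁻¹ v)
  rw [map_inv, map_inv, hφ γ η h]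

end Dual

/-! ### The Hilbert space `L²(Γ\G, ψ)` -/

section L2

set_option linter.unusedSectionVars false

variable {G W : Type u} [Group G] [TopologicalSpace G] [IsTopologicalGroup G]
  [SecondCountableTopology G] [MeasurableSpace G] [BorelSpace G]
  [NormedAddCommGroup W] [InnerProductSpace ℂ W]
  {Γ : Subgroup G} [DiscreteTopology Γ]

theorem ae_mul_left {μ : Measure G} [μ.IsMulLeftInvariant] {p : G → Prop} (g : G)
    (h : ∀ᵐ x ∂μ, p x) : ∀ᵐ x ∂μ, p (g * x) :=
  (measurePreserving_mul_left μ g).quasiMeasurePreserving.ae h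

/-- For a unitary representation `ψ` of `Γ` on `W`, the classes modulo equality almost everywhere
of functions `s : G → W` with `s (γ x) = ψ(γ) s(x)` and `∫_{Γ\G} ‖s(x)‖² dx < ∞`, the integral
over `Γ\G` of the `Γ`-invariant function `‖s‖²` being its integral over a fundamental domain. -/
def L2Submodule (μ : Measure G) [μ.IsMulLeftInvariant] (ψ : Γ →* (W ≃ₗᵢ[ℂ] W)) :
    Submodule ℂ (G →ₘ[μ] W) where
  carrier := {s | (∀ γ : Γ, ∀ᵐ x ∂μ, s ((γ : G) * x) = ψ γ (s x)) ∧
    MemLp s 2 (μ.restrict (fundDomain Γ μ))}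
  zero_mem' := by
    have h0 : ∀ᵐ x ∂μ, (0 : G →ₘ[μ] W) x = 0 := AEEqFun.coeFn_zero
    refine ⟨fun γ => ?_, ?_⟩
    · filter_upwards [h0, ae_mul_left (γ : G) h0] with x h1 h2
      rw [h1, h2, map_zero]
    · exact (memLp_congr_ae (ae_restrict_of_ae h0)).2 MemLp.zero'
  add_mem' := by
    rintro s t ⟨hs, hs'⟩ ⟨ht, ht'⟩
    have h0 : ∀ᵐ x ∂μ, (s + t) x = s x + t x := AEEqFun.coeFn_add s t
    refine ⟨fun γ => ?_, ?_⟩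
    · filter_upwards [h0, ae_mul_left (γ : G) h0, hs γ, ht γ] with x h1 h2 h3 h4
      rw [h1, h2, h3, h4, map_add]
    · exact (memLp_congr_ae (ae_restrict_of_ae h0)).2 (hs'.add ht')
  smul_mem' := by
    rintro c s ⟨hs, hs'⟩
    have h0 : ∀ᵐ x ∂μ, (c • s) x = c • s x := AEEqFun.coeFn_smul c s
    refine ⟨fun γ => ?_, ?_⟩
    · filter_upwards [h0, ae_mul_left (γ : G) h0, hs γ] with x h1 h2 h3
      rw [h1, h2, h3, map_smul]
    · exact (memLp_congr_ae (ae_restrict_of_ae h0)).2 (hs'.const_smul c)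

/-- `L²(Γ\G, ψ)`. -/
def L2 (μ : Measure G) [μ.IsMulLeftInvariant] (ψ : Γ →* (W ≃ₗᵢ[ℂ] W)) : Type u :=
  L2Submodule μ ψ

variable (μ : Measure G) [μ.IsMulLeftInvariant] (ψ : Γ →* (W ≃ₗᵢ[ℂ] W))

instance : AddCommGroup (L2 μ ψ) := inferInstanceAs (AddCommGroup (L2Submodule μ ψ))

instance : Module ℂ (L2 μ ψ) := inferInstanceAs (Module ℂ (L2Submodule μ ψ))

instance : CoeFun (L2 μ ψ) (fun _ => G → W) := ⟨fun s => (s.1 : G → W)⟩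

variable {μ ψ}

theorem L2.ext {s t : L2 μ ψ} (h : ∀ᵐ x ∂μ, s x = t x) : s = t :=
  Subtype.ext (AEEqFun.ext h)

theorem L2.coe_add (s t : L2 μ ψ) : ∀ᵐ x ∂μ, (s + t) x = s x + t x :=
  AEEqFun.coeFn_add s.1 t.1

theorem L2.coe_smul (c : ℂ) (s : L2 μ ψ) : ∀ᵐ x ∂μ, (c • s) x = c • s x :=
  AEEqFun.coeFn_smul c s.1

theorem L2.coe_zero : ∀ᵐ x ∂μ, (0 : L2 μ ψ) x = 0 :=
  AEEqFun.coeFn_zero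

variable (μ ψ)

/-- Restriction to the fundamental domain. -/
def L2.restr : L2 μ ψ →ₗ[ℂ] Lp W 2 (μ.restrict (fundDomain Γ μ)) where
  toFun s := s.2.2.toLp s
  map_add' s t := by
    rw [← MemLp.toLp_add]
    exact (MemLp.toLp_eq_toLp_iff _ _).2 (ae_restrict_of_ae (L2.coe_add s t))
  map_smul' c s := by
    rw [RingHom.id_apply, ← MemLp.toLp_const_smul]
    exact (MemLp.toLp_eq_toLp_iff _ _).2 (ae_restrict_of_ae (L2.coe_smul c s))

theorem L2.restr_injective : Function.Injective (L2.restr μ ψ) := by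
  have : Countable Γ := TopologicalSpace.separableSpace_iff_countable.1 inferInstance
  rw [injective_iff_map_eq_zero]
  intro s hs
  have h1 : ∀ᵐ x ∂(μ.restrict (fundDomain Γ μ)), s x = 0 := by
    have h2 : s.2.2.toLp s =ᵐ[μ.restrict (fundDomain Γ μ)] s := MemLp.coeFn_toLp _
    have h3 := Lp.coeFn_zero W 2 (μ.restrict (fundDomain Γ μ))
    have h4 : s.2.2.toLp s = 0 := hs
    rw [h4] at h2
    filter_upwards [h2, h3] with x h5 h6
    rw [← h5, h6]; rfl
  rw [ae_restrict_iff'₀ (isFundamentalDomain Γ μ).nullMeasurableSet] at h1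
  have h2 : ∀ᵐ x ∂μ, ∀ γ : Γ, (γ : G) * x ∈ fundDomain Γ μ → s ((γ : G) * x) = 0 :=
    ae_all_iff.2 fun γ => ae_mul_left (γ : G) h1
  have h3 : ∀ᵐ x ∂μ, ∀ γ : Γ, s ((γ : G) * x) = ψ γ (s x) := ae_all_iff.2 s.2.1
  apply L2.ext
  filter_upwards [h2, h3, (isFundamentalDomain Γ μ).ae_covers, L2.coe_zero (μ := μ) (ψ := ψ)]
    with x h5 h6 ⟨γ, hγ⟩ h0
  have h7 := h5 γ hγ
  rw [h6 γ] at h7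
  rw [h0]
  exact (LinearIsometryEquiv.map_eq_zero_iff _).1 h7

/-- The norm `‖s‖² = ∫_{Γ\G} ‖s(x)‖² dx`. -/
instance : NormedAddCommGroup (L2 μ ψ) :=
  NormedAddCommGroup.induced (L2 μ ψ) _ (L2.restr μ ψ) (L2.restr_injective μ ψ)

/-- The inner product `⟨s, t⟩ = ∫_{Γ\G} ⟨s(x), t(x)⟩ dx`. -/
instance : InnerProductSpace ℂ (L2 μ ψ) := InnerProductSpace.induced (L2.restr μ ψ)

/-- The integral over a fundamental domain of a `Γ`-invariant function does not depend on the
fundamental domain. -/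
theorem setLIntegral_fundDomain {μ : Measure G} [μ.IsMulLeftInvariant] {A B : Set G}
    (hA : IsFundamentalDomain Γ A μ) (hB : IsFundamentalDomain Γ B μ) {h : G → ℝ≥0∞}
    (hh : ∀ γ : Γ, ∀ᵐ x ∂μ, h ((γ : G) * x) = h x) :
    ∫⁻ x in A, h x ∂μ = ∫⁻ x in B, h x ∂μ := by
  have : Countable Γ := TopologicalSpace.separableSpace_iff_countable.1 inferInstance
  rw [hB.setLIntegral_eq_tsum, hA.setLIntegral_eq_tsum']
  refine tsum_congr fun γ => ?_
  rw [inter_comm]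
  refine lintegral_congr_ae (ae_restrict_of_ae ?_)
  filter_upwards [hh γ⁻¹] with x hx
  exact hx.symm

theorem L2.norm_eq (s : L2 μ ψ) :
    ‖s‖ = (eLpNorm s 2 (μ.restrict (fundDomain Γ μ))).toReal :=
  Lp.norm_toLp _ s.2.2

variable {μ ψ} {g : G}

theorem eLpNorm_translate (s : L2 μ ψ) (hg : ∀ x, x ∈ Γ ↔ g * x * g⁻¹ ∈ Γ) :
    eLpNorm (fun x => s (g * x)) 2 (μ.restrict (fundDomain Γ μ)) =
      eLpNorm s 2 (μ.restrict (fundDomain Γ μ)) := by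
  let e : Γ ≃ Γ :=
    { toFun := fun γ => ⟨g * γ * g⁻¹, (hg _).1 γ.2⟩
      invFun := fun γ => ⟨g⁻¹ * γ * g, (hg _).2 (by simp [mul_assoc])⟩
      left_inv := fun γ => by simp [mul_assoc]
      right_inv := fun γ => by simp [mul_assoc] }
  have hF := isFundamentalDomain Γ μ
  have hF' : IsFundamentalDomain Γ ((fun x => g⁻¹ * x) ⁻¹' fundDomain Γ μ) μ :=
    hF.preimage_of_equiv (measurePreserving_mul_left μ g⁻¹).quasiMeasurePreserving
      (e := e) e.bijective fun γ x => by simp [e, Subgroup.smul_def, mul_assoc]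
  have h2 : (2 : ℝ≥0∞) ≠ 0 := two_ne_zero
  rw [eLpNorm_eq_lintegral_rpow_enorm_toReal h2 ENNReal.ofNat_ne_top,
    eLpNorm_eq_lintegral_rpow_enorm_toReal h2 ENNReal.ofNat_ne_top]
  congr 1
  have h3 := (measurePreserving_mul_left μ g).setLIntegral_comp_preimage_emb
    (measurableEmbedding_mulLeft g) (fun x => ‖s x‖ₑ ^ (2 : ℝ≥0∞).toReal)
    ((fun x => g⁻¹ * x) ⁻¹' fundDomain Γ μ)
  have h4 : (fun x => g * x) ⁻¹' ((fun x => g⁻¹ * x) ⁻¹' fundDomain Γ μ) = fundDomain Γ μ := by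
    ext x; simp
  rw [h4] at h3
  rw [h3]
  refine setLIntegral_fundDomain hF' hF fun γ => ?_
  filter_upwards [s.2.1 γ] with x hx
  have h5 : ‖s ((γ : G) * x)‖ₑ = ‖s x‖ₑ := by
    rw [hx]
    simp only [← ofReal_norm, LinearIsometryEquiv.norm_map]
  rw [h5]

variable (hg : ∀ x, x ∈ Γ ↔ g * x * g⁻¹ ∈ Γ)
  (hψ : ∀ γ η : Γ, (η : G) = g * γ * g⁻¹ → ψ η = ψ γ)

/-- The function `g^* s (x) = s (g x)` for `g` normalizing `Γ` with `ψ(g γ g⁻¹) = ψ(γ)`. -/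
def L2.pullFun (s : L2 μ ψ) : L2 μ ψ :=
  ⟨s.1.compMeasurePreserving (fun x => g * x) (measurePreserving_mul_left μ g), by
    have h0 : ∀ᵐ x ∂μ, s.1.compMeasurePreserving (fun x => g * x)
        (measurePreserving_mul_left μ g) x = s (g * x) :=
      AEEqFun.coeFn_compMeasurePreserving _ _
    refine ⟨fun γ => ?_, ?_⟩
    · filter_upwards [h0, ae_mul_left (γ : G) h0,
        ae_mul_left g (s.2.1 ⟨g * γ * g⁻¹, (hg _).1 γ.2⟩)] with x h1 h2 h3
      have h4 : g * ((γ : G) * x) = g * γ * g⁻¹ * (g * x) := by group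
      rw [h1, h2, h4, h3, hψ γ _ rfl]
    · refine ⟨AEEqFun.aestronglyMeasurable _ |>.restrict, ?_⟩
      rw [eLpNorm_congr_ae (ae_restrict_of_ae h0), eLpNorm_translate s hg]
      exact s.2.2.2⟩

theorem L2.coe_pullFun (s : L2 μ ψ) : ∀ᵐ x ∂μ, L2.pullFun hg hψ s x = s (g * x) :=
  AEEqFun.coeFn_compMeasurePreserving _ (measurePreserving_mul_left μ g)

/-- The operator `g^*` on `L²(Γ\G, ψ)`, `(g^* s)(x) = s (g x)`. -/
def L2.pull : L2 μ ψ →L[ℂ] L2 μ ψ :=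
  LinearMap.mkContinuous
    { toFun := L2.pullFun hg hψ
      map_add' := fun s t => L2.ext <| by
        filter_upwards [L2.coe_pullFun hg hψ (s + t), L2.coe_pullFun hg hψ s,
          L2.coe_pullFun hg hψ t, L2.coe_add (L2.pullFun hg hψ s) (L2.pullFun hg hψ t),
          ae_mul_left g (L2.coe_add s t)] with x h1 h2 h3 h4 h5
        rw [h1, h4, h2, h3, h5]
      map_smul' := fun c s => L2.ext <| by
        filter_upwards [L2.coe_pullFun hg hψ (c • s), L2.coe_pullFun hg hψ s,
          L2.coe_smul c (L2.pullFun hg hψ s), ae_mul_left g (L2.coe_smul c s)] with x h1 h2 h3 h4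
        rw [h1, RingHom.id_apply, h3, h2, h4] }
    1 (fun s => by
      rw [one_mul, L2.norm_eq, L2.norm_eq]
      refine le_of_eq (congrArg ENNReal.toReal ?_)
      rw [← eLpNorm_translate s hg]
      exact eLpNorm_congr_ae (ae_restrict_of_ae (L2.coe_pullFun hg hψ s)))

theorem L2.coe_pull (s : L2 μ ψ) : ∀ᵐ x ∂μ, L2.pull hg hψ s x = s (g * x) :=
  L2.coe_pullFun hg hψ s

variable [SFinite μ]

theorem ae_mul_right {p : G → Prop} (z : G) (h : ∀ᵐ x ∂μ, p x) : ∀ᵐ x ∂μ, p (x * z) :=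
  (quasiMeasurePreserving_mul_right μ z).ae h

variable (μ ψ) in
/-- `Hom_G(π, L²(Γ\G, ψ))`: the bounded operators intertwining `π` and the right translations
`s ↦ s(· z)`. -/
def homG (π : IrrUnitaryRep G) : Submodule ℂ (π.space →L[ℂ] L2 μ ψ) where
  carrier := {T | ∀ z v, ∀ᵐ x ∂μ, T (π.rep z v) x = T v (x * z)}
  zero_mem' z v := by
    filter_upwards [L2.coe_zero (μ := μ) (ψ := ψ),
      ae_mul_right z (L2.coe_zero (μ := μ) (ψ := ψ))] with x h1 h2
    exact h1.trans h2.symm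
  add_mem' {S T} hS hT z v := by
    filter_upwards [L2.coe_add (S (π.rep z v)) (T (π.rep z v)),
      ae_mul_right z (L2.coe_add (S v) (T v)), hS z v, hT z v] with x h1 h2 h3 h4
    exact h1.trans ((by rw [h3, h4] : _ = _).trans h2.symm)
  smul_mem' c T hT z v := by
    filter_upwards [L2.coe_smul c (T (π.rep z v)),
      ae_mul_right z (L2.coe_smul c (T v)), hT z v] with x h1 h2 h3
    exact h1.trans ((by rw [h3] : _ = _).trans h2.symm)

variable (μ) in
/-- The operator `g_π^Γ : T ↦ g^* ∘ T` on `Hom_G(π, L²(Γ\G, ψ))`. -/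
def homAction (π : IrrUnitaryRep G) : homG μ ψ π →ₗ[ℂ] homG μ ψ π where
  toFun T := ⟨(L2.pull hg hψ).comp T.1, fun z v => by
    filter_upwards [L2.coe_pull hg hψ (T.1 (π.rep z v)),
      ae_mul_right z (L2.coe_pull hg hψ (T.1 v)), ae_mul_left g (T.2 z v)] with x h1 h2 h3
    rw [mul_assoc] at h3
    exact h1.trans (h3.trans h2.symm)⟩
  map_add' S T := by ext1; exact ContinuousLinearMap.comp_add _ _ _
  map_smul' c T := by ext1; exact ContinuousLinearMap.comp_smul _ _ _

end L2

/-! ### The geometric side -/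

section Geometric

variable {G : Type u} [Group G]

/-- `H\G`. -/
abbrev RightQuot (H : Subgroup G) : Type u := Quotient (QuotientGroup.rightRel H)

/-- The centralizer `G_δ`. -/
abbrev cent (δ : G) : Subgroup G := Subgroup.centralizer {δ}

/-- The relation on `Γ` under which `γ`, `γ'` are equivalent if `γ g` and `γ' g` are conjugate
under `Γ`. -/
def conjSetoid (Γ : Subgroup G) (g : G) : Setoid Γ where
  r γ γ' := ∃ η : Γ, (γ' : G) * g = η * (γ * g) * (η : G)⁻¹
  iseqv :=
    { refl := fun γ => ⟨1, by simp⟩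
      symm := by
        rintro γ γ' ⟨η, h⟩
        exact ⟨η⁻¹, by rw [h]; simp [mul_assoc]⟩
      trans := by
        rintro γ γ' γ'' ⟨η, h⟩ ⟨θ, h'⟩
        exact ⟨θ * η, by rw [h', h]; simp [mul_assoc]⟩ }

/-- The set of `Γ`-conjugacy classes `[γ g]` in the coset `Γ g`, given through the bijection
`γ ↦ γ g` from `Γ` to `Γ g`. -/
def TwistedClass (Γ : Subgroup G) (g : G) : Type u := Quotient (conjSetoid Γ g)

/-- A representative `γ` of the class `[γ g]`. -/
def TwistedClass.out {Γ : Subgroup G} {g : G} (c : TwistedClass Γ g) : Γ := Quotient.out c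

variable [MeasurableSpace G]

/-- `lam` is the measure on `H\G` for which
`∫_G h(x) dx = ∫_{H\G} ∫_H h(t x) dt dx`, where `H` carries the measure `ν`. -/
def IsQuotientMeasure (μ : Measure G) {H : Subgroup G} (ν : Measure H)
    (lam : Measure (RightQuot H)) : Prop :=
  ∀ h : G → ℝ≥0∞, Measurable h →
    ∫⁻ x, h x ∂μ = ∫⁻ q, ∫⁻ t : H, h ((t : G) * q.out) ∂ν ∂lam

open Classical in
/-- The quotient measure on `H\G` (and `0` if there is none). -/
def quotientMeasure (μ : Measure G) {H : Subgroup G} (ν : Measure H) : Measure (RightQuot H) :=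
  if h : ∃ lam, IsQuotientMeasure μ ν lam then h.choose else 0

/-- The function `x ↦ f(x⁻¹ δ x)` on `G_δ\G`. -/
def orbitalFun (f : G → ℂ) (δ : G) : RightQuot (cent δ) → ℂ :=
  Quotient.lift (fun x => f (x⁻¹ * δ * x)) (by
    intro x y h
    have h1 : y * x⁻¹ ∈ cent δ := QuotientGroup.rightRel_apply.1 h
    rw [Subgroup.mem_centralizer_singleton_iff] at h1
    have h2 : y * x⁻¹ * δ * (y * x⁻¹)⁻¹ = δ := by rw [h1]; group
    have h3 : y⁻¹ * δ * y = x⁻¹ * δ * x := by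
      nth_rewrite 1 [← h2]
      group
    rw [h3])

/-- The orbital integral `O_δ(f) = ∫_{G_δ\G} f(x⁻¹ δ x) dx`. -/
def orbitalIntegral (μ : Measure G) {δ : G} (ν : Measure (cent δ)) (f : G → ℂ) : ℂ :=
  ∫ q, orbitalFun f δ q ∂(quotientMeasure μ ν)

/-- The volume of `Γ_δ\G_δ`, where `Γ_δ = Γ ∩ G_δ` is the stabilizer of `δ` in `Γ`: the measure
of a fundamental domain for the action of `Γ_δ` on `G_δ` by left translations. -/
def vol (Γ : Subgroup G) {δ : G} (ν : Measure (cent δ)) : ℝ≥0∞ :=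
  covolume (Γ.subgroupOf (cent δ)) (cent δ) ν

end Geometric

/-! ### The functions `f` -/

section Smooth

variable {d : ℕ} {G : Type u} [Group G] [TopologicalSpace G]
  [ChartedSpace (EuclideanSpace ℝ (Fin d)) G] [LieGroup (𝓡 d) ∞ G]

/-- The instance which the Lie algebra of `G` needs. -/
instance : LieGroup (𝓡 d) (minSmoothness ℝ 3) G :=
  LieGroup.of_le (n := ∞) (by
    rw [minSmoothness_of_isRCLikeNormedField]
    exact WithTop.coe_le_coe.2 (le_top : (3 : ℕ∞) ≤ ⊤))

/-- The derivative of `f` along the left invariant vector field of `X ∈ Lie G`. -/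
def leftInvDeriv (X : GroupLieAlgebra (𝓡 d) G) (f : G → ℂ) : G → ℂ :=
  fun x => mfderiv (𝓡 d) 𝓘(ℝ, ℂ) f x (mulInvariantVectorField X x)

variable (d) in
/-- `f` is smooth and `f` and all its left invariant derivatives `X₁ ⋯ Xₖ f` are integrable. -/
def IsSmoothL1 [MeasurableSpace G] (μ : Measure G) (f : G → ℂ) : Prop :=
  ContMDiff (𝓡 d) 𝓘(ℝ, ℂ) ∞ f ∧
    ∀ l : List (GroupLieAlgebra (𝓡 d) G), Integrable (l.foldr leftInvDeriv f) μ

end Smooth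

end EquivTrace

end

/-!
With `ψ` the dual of the representation `φ`, the trace of the operator `g^* (· * f)` on `L²(Γ\G, ψ)`
is computed twice: by integrating its kernel over the diagonal, and by decomposing the space into
irreducible representations of `G`, on which `· * f` acts by `π(f)`.

*Factorization.* A smooth function `f` with integrable left invariant derivatives is a finite sum of
convolutions `F * E`, where `F` is of the same kind and `E` is bounded with compact support
(`IsSmoothL1.mem_span_conv`). Indeed, in local coordinates at `1`, the identity
`p 0 = ∫₀¹ (p r - (1 - r) p' r) dr`, applied to one coordinate after the other, writes `f(x)` as a sum
of averages of derivatives of `f` over the translate by `x` of a small cube (`mem_span_cubeAverages`).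
Such an average is a convolution with a bounded function, since in coordinates Lebesgue measure is
bounded by a multiple of Haar measure (`exists_volume_le`).

*Trace class.* Convolution with `E`, and with the adjoint function of `F`, maps `L²(Γ\G, ψ)` boundedly
to bounded functions (`IsSupBounded`, `IsBddCompact.isSupBounded`, `IsSmoothL1.isSupBounded_adjFun`).
As `Γ\G` has finite volume, an operator with bounded point evaluations is Hilbert–Schmidt
(`isHS_of_eval`, `L2.isHS_convOp`). Hence `s ↦ s * (F * E)` is a product of two Hilbert–Schmidt
operators, which is of trace class. The trace of `g^* (· * f)` is the integral over a fundamental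
domain of the trace of the kernel `∑ f(x⁻¹ γ g x) ψ(γ)⁻¹`, by Parseval's identity at each point `x`
(`hasTraceFormula_conv`, `hasTraceFormula_of_mem_span`).

*Geometric side.* Group the sum over `γ` by the `Γ`-conjugacy classes in `Γ g`. For `δ = γ g` the
subgroup `Γ_δ` is cocompact in `G_δ` (`isCocompact_cent`), so that `G_δ` is unimodular and `Γ_δ\G_δ`
has finite volume. A function `w` on `G` with integral `1` over every coset `G_δ x` (`exists_weight`)
transfers integrals over `G_δ\G` to integrals over `G`, and the usual unfolding becomes an application
of Tonelli's theorem on `G_δ × G` (`vol_mul_lintegral`, `orbital_formula`, `hasSum_geometric`).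

*Spectral side.* Convolution with the characteristic function of a compact symmetric set is compact
and self-adjoint. Every nonzero closed invariant subspace contains a minimal one: minimize the
dimension of the intersection with an eigenspace (`HasCompactOps.exists_isMinSubrep_le`). By Zorn's
lemma the space is a sum of irreducible representations (`HasCompactOps.exists_decomposition`). The
same eigenspaces, being finite dimensional, show that multiplicities are finite and give Schur's
lemma (`IrrUnitaryRep.exists_eq_smul`, `UnitaryDual.eq_of_intertwine`). So the inclusions of the
constituents of class `π` form a basis of the space of intertwining operators from `π`
(`RepDecomposition.trace_eq`), and computing the trace of `g^* (· * f)` in a Hilbert basis adapted to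
the decomposition gives the sum over the unitary dual (`hasSum_spectral`).
-/

set_option linter.unusedSectionVars false

noncomputable section

namespace EquivTrace

open ContinuousLinearMap

/-! ### Hilbert–Schmidt operators and their products -/

section HilbertSchmidt

variable {H K L : Type*} [NormedAddCommGroup H] [InnerProductSpace ℂ H]
  [NormedAddCommGroup K] [InnerProductSpace ℂ K] [NormedAddCommGroup L] [InnerProductSpace ℂ L]

open InnerProductSpace

/-- An operator `T` between Hilbert spaces is Hilbert–Schmidt if the sums `∑ ‖T v‖²` over finite
orthonormal sets are bounded. -/
def IsHS (T : H →L[ℂ] K) : Prop :=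
  ∃ M : ℝ, ∀ s : Finset H, Orthonormal ℂ ((↑) : s → H) → ∑ v ∈ s, ‖T v‖ ^ 2 ≤ M

theorem IsHS.exists_sum_le {T : H →L[ℂ] K} (hT : IsHS T) :
    ∃ M : ℝ, 0 ≤ M ∧ ∀ {ι : Type*} (e : ι → H), Orthonormal ℂ e → ∀ s : Finset ι,
      ∑ i ∈ s, ‖T (e i)‖ ^ 2 ≤ M := by
  classical
  obtain ⟨M, hM⟩ := hT
  refine ⟨M, ?_, fun {ι} e he s => ?_⟩
  · simpa using hM ∅ (by constructor <;> simp)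
  · have hinj : Function.Injective e := he.linearIndependent.injective
    have h := hM (s.image e) (by
      have h1 : Orthonormal ℂ (Subtype.val : Set.range e → H) := he.toSubtypeRange
      have h2 := h1.comp (fun v : (s.image e : Finset H) =>
        (⟨v.1, by
          obtain ⟨i, -, hi⟩ := Finset.mem_image.1 v.2
          exact ⟨i, hi⟩⟩ : Set.range e)) (fun v w h => by
            exact Subtype.ext (congrArg (fun z : Set.range e => (z : H)) h))
      exact h2)
    rwa [Finset.sum_image fun i _ j _ h => hinj h] at h

theorem IsHS.summable {T : H →L[ℂ] K} (hT : IsHS T) {ι : Type*} {e : ι → H}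
    (he : Orthonormal ℂ e) : Summable fun i => ‖T (e i)‖ ^ 2 := by
  obtain ⟨M, -, hM⟩ := hT.exists_sum_le
  exact summable_of_sum_le (fun _ => by positivity) (hM e he)

theorem IsHS.comp_left {T : H →L[ℂ] K} (hT : IsHS T) (A : K →L[ℂ] L) : IsHS (A.comp T) := by
  obtain ⟨M, hM⟩ := hT
  refine ⟨‖A‖ ^ 2 * M, fun s hs => ?_⟩
  refine le_trans ?_ (mul_le_mul_of_nonneg_left (hM s hs) (by positivity))
  rw [Finset.mul_sum]
  refine Finset.sum_le_sum fun v _ => ?_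
  rw [← mul_pow]
  exact pow_le_pow_left₀ (norm_nonneg _) (A.le_opNorm _) 2

theorem hasSum_norm_inner_sq {ι : Type*} (b : HilbertBasis ι ℂ H) (x : H) :
    HasSum (fun i => ‖inner ℂ (b i) x‖ ^ 2) (‖x‖ ^ 2) := by
  have h := b.hasSum_inner_mul_inner x x
  have h1 : ∀ i, inner ℂ x (b i) * inner ℂ (b i) x = ((‖inner ℂ (b i) x‖ ^ 2 : ℝ) : ℂ) := by
    intro i
    rw [← inner_conj_symm x (b i), Complex.conj_mul']
    push_cast; rfl
  simp only [h1, inner_self_eq_norm_sq_to_K] at h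
  have h2 : HasSum (fun i => ((‖inner ℂ (b i) x‖ ^ 2 : ℝ) : ℂ)) ((‖x‖ ^ 2 : ℝ) : ℂ) := by
    push_cast at h ⊢; exact h
  exact Complex.hasSum_ofReal.1 h2

variable [CompleteSpace H] [CompleteSpace K] [CompleteSpace L]

/-- `‖T† v‖² = ∑ |⟨T b, v⟩|²` over a Hilbert basis, and Bessel's inequality bounds the sum over
orthonormal `v` of the terms with fixed `b` by `‖T b‖²`. -/
theorem IsHS.adj {T : H →L[ℂ] K} (hT : IsHS T) : IsHS (adjoint T) := by
  obtain ⟨M, -, hM⟩ := hT.exists_sum_le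
  obtain ⟨w, b, -⟩ := exists_hilbertBasis ℂ H
  refine ⟨M, fun s hs => ?_⟩
  have h1 : HasSum (fun i => ∑ v ∈ s, ‖inner ℂ (b i) (adjoint T v)‖ ^ 2)
      (∑ v ∈ s, ‖adjoint T v‖ ^ 2) := hasSum_sum fun v _ => hasSum_norm_inner_sq b _
  refine hasSum_le_of_sum_le h1 fun t => ?_
  refine le_trans (Finset.sum_le_sum fun i _ => ?_) (hM b b.orthonormal t)
  have h2 := hs.sum_inner_products_le (T (b i)) (s := Finset.univ)
  refine le_trans (le_of_eq ?_) h2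
  rw [Finset.univ_eq_attach, ← Finset.sum_attach]
  refine Finset.sum_congr rfl fun v _ => ?_
  rw [adjoint_inner_right, ← inner_conj_symm, RCLike.norm_conj]

theorem IsHS.comp_right {T : H →L[ℂ] K} (hT : IsHS T) (A : L →L[ℂ] H) : IsHS (T.comp A) := by
  have h := (hT.adj.comp_left (adjoint A)).adj
  rwa [← adjoint_comp, adjoint_adjoint] at h

/-- A Hilbert–Schmidt operator is the norm limit of its restrictions to finite dimensional
subspaces which nearly exhaust the sum `∑ ‖T v‖²`. -/
theorem IsHS.isCompactOperator {T : H →L[ℂ] K} (hT : IsHS T) : IsCompactOperator T := by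
  classical
  let A : Set ℝ := {r | ∃ s : Finset H, Orthonormal ℂ ((↑) : s → H) ∧ r = ∑ v ∈ s, ‖T v‖ ^ 2}
  have hA : BddAbove A := by
    obtain ⟨M, hM⟩ := hT
    exact ⟨M, by rintro r ⟨s, hs, rfl⟩; exact hM s hs⟩
  have hAne : A.Nonempty := ⟨0, ∅, by constructor <;> simp, by simp⟩
  have key : ∀ ε > 0, ∃ S : H →L[ℂ] K, IsCompactOperator S ∧ ‖T - S‖ ≤ ε := by
    intro ε hε
    obtain ⟨r, ⟨s, hs, rfl⟩, hr⟩ := exists_lt_of_lt_csSup hAne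
      (show sSup A - ε ^ 2 < sSup A by linarith [pow_pos hε 2])
    let U := Submodule.span ℂ (s : Set H)
    have : FiniteDimensional ℂ U := FiniteDimensional.span_finset ℂ s
    -- a unit vector orthogonal to `s` with `‖T e‖ > ε` would enlarge the sum beyond its supremum
    have hperp : ∀ v ∈ Uᗮ, ‖T v‖ ≤ ε * ‖v‖ := by
      intro v hv
      by_cases hv0 : v = 0
      · simp [hv0]
      have hvn : ‖v‖ ≠ 0 := norm_ne_zero_iff.2 hv0
      let e : H := (‖v‖⁻¹ : ℂ) • v
      have he1 : ‖e‖ = 1 := by simp [e, norm_smul, hvn]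
      have heU : e ∈ Uᗮ := Submodule.smul_mem _ _ hv
      have hes : e ∉ s := by
        intro h
        have h1 : e ∈ U := Submodule.subset_span h
        have h2 := heU e h1
        rw [inner_self_eq_zero] at h2
        simp [h2] at he1
      have horth : Orthonormal ℂ (Subtype.val : {x // x ∈ insert e s} → H) := by
        have h3 : Orthonormal ℂ ((↑) : ((insert e (s : Set H) : Set H)) → H) := by
          rw [orthonormal_subtype_iff_ite]
          have hs' := (orthonormal_subtype_iff_ite (𝕜 := ℂ) (s := (s : Set H))).1 hs
          rintro x (rfl | hx) y (rfl | hy)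
          · simp [he1]
          · have hne : e ≠ y := fun h => hes (h ▸ hy)
            rw [if_neg hne, ← inner_conj_symm, heU y (Submodule.subset_span hy), map_zero]
          · have hne : x ≠ e := fun h => hes (h ▸ hx)
            rw [if_neg hne, heU x (Submodule.subset_span hx)]
          · exact hs' x hx y hy
        have h4 : (insert e (s : Set H) : Set H) = ((insert e s : Finset H) : Set H) := by simp
        rw [h4] at h3
        exact h3
      have h5 := le_csSup hA ⟨insert e s, horth, rfl⟩
      rw [Finset.sum_insert hes] at h5
      have h6 : ‖T e‖ ^ 2 ≤ ε ^ 2 := by linarith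
      have h7 : ‖T e‖ ≤ ε := abs_le_of_sq_le_sq' h6 hε.le |>.2
      have h8 : v = (‖v‖ : ℂ) • e := by
        simp [e, smul_smul, hvn]
      calc ‖T v‖ = ‖v‖ * ‖T e‖ := by
            conv_lhs => rw [h8, map_smul, norm_smul]
            simp
        _ ≤ ε * ‖v‖ := by nlinarith [norm_nonneg v]
    refine ⟨T.comp U.starProjection, ?_, ?_⟩
    · have h9 : IsCompactOperator (U.orthogonalProjectionOnto : H →L[ℂ] U) :=
        (isCompactOperator_id (E := U)).comp_clm U.orthogonalProjectionOnto
      exact (h9.clm_comp U.subtypeL).clm_comp T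
    · refine ContinuousLinearMap.opNorm_le_bound _ hε.le fun x => ?_
      have h10 : (T - T.comp U.starProjection) x = T (Uᗮ.starProjection x) := by
        simp [Submodule.starProjection_orthogonal]
      rw [h10]
      refine (hperp _ (Submodule.starProjection_apply_mem _ _)).trans ?_
      gcongr
      exact Submodule.norm_starProjection_apply_le _ _
  have hcl := isClosed_setOfPred_isCompactOperator (σ₁₂ := RingHom.id ℂ) (M₁ := H) (M₂ := K)
  have : T ∈ closure {S : H →L[ℂ] K | IsCompactOperator S} := by
    rw [Metric.mem_closure_iff]
    intro ε hε
    obtain ⟨S, hS, h⟩ := key (ε / 2) (by linarith)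
    exact ⟨S, hS, by rw [dist_eq_norm]; linarith⟩
  rw [hcl.closure_eq] at this
  exact this

/-- For Hilbert–Schmidt operators `S`, `B` the sums of `⟨S e, B e⟩` over the vectors `e` of a Hilbert
basis and of `⟨B† e', S† e'⟩` over the vectors of another one agree: both are the sum of the
summable double family `⟨S e, e'⟩ ⟨e', B e⟩`. -/
theorem IsHS.hasSum_inner_swap {S B : H →L[ℂ] K} (hS : IsHS S) (hB : IsHS B) {ι κ : Type*}
    (b : HilbertBasis ι ℂ H) (c : HilbertBasis κ ℂ K) :
    ∃ t, HasSum (fun i => inner ℂ (S (b i)) (B (b i))) t ∧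
      HasSum (fun j => inner ℂ (adjoint B (c j)) (adjoint S (c j))) t := by
  have hsq : ∀ T : H →L[ℂ] K, IsHS T →
      Summable fun p : ι × κ => ‖inner ℂ (c p.2) (T (b p.1))‖ ^ 2 := by
    intro T hT
    rw [summable_prod_of_nonneg fun _ => by positivity]
    refine ⟨fun i => (hasSum_norm_inner_sq c (T (b i))).summable, ?_⟩
    simp only [fun i => (hasSum_norm_inner_sq c (T (b i))).tsum_eq]
    exact hT.summable b.orthonormal
  have hsum : Summable fun p : ι × κ =>
      inner ℂ (S (b p.1)) (c p.2) * inner ℂ (c p.2) (B (b p.1)) := by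
    refine Summable.of_norm_bounded ((hsq S hS).add (hsq B hB)) fun p => ?_
    rw [norm_mul, ← inner_conj_symm, RCLike.norm_conj]
    nlinarith [sq_nonneg (‖inner ℂ (c p.2) (S (b p.1))‖ - ‖inner ℂ (c p.2) (B (b p.1))‖),
      sq_nonneg ‖inner ℂ (c p.2) (S (b p.1))‖, sq_nonneg ‖inner ℂ (c p.2) (B (b p.1))‖]
  obtain ⟨t, ht⟩ := hsum
  have h1 : ∀ i, HasSum (fun j => inner ℂ (S (b i)) (c j) * inner ℂ (c j) (B (b i)))
      (inner ℂ (S (b i)) (B (b i))) := fun i => c.hasSum_inner_mul_inner _ _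
  have h2 : ∀ j, HasSum (fun i => inner ℂ (S (b i)) (c j) * inner ℂ (c j) (B (b i)))
      (inner ℂ (adjoint B (c j)) (adjoint S (c j))) := by
    intro j
    have h := b.hasSum_inner_mul_inner (adjoint B (c j)) (adjoint S (c j))
    have e : (fun i => inner ℂ (adjoint B (c j)) (b i) * inner ℂ (b i) (adjoint S (c j))) =
        fun i => inner ℂ (S (b i)) (c j) * inner ℂ (c j) (B (b i)) := by
      funext i
      rw [adjoint_inner_left, adjoint_inner_right, mul_comm]
    rwa [e] at h
  have h3 : HasSum (fun p : κ × ι =>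
      inner ℂ (S (b p.2)) (c p.1) * inner ℂ (c p.1) (B (b p.2))) t :=
    (Equiv.prodComm κ ι).hasSum_iff.2 ht
  exact ⟨t, ht.prod_fiberwise h1, h3.prod_fiberwise h2⟩

end HilbertSchmidt

section Trace

variable {H K L : Type u} [NormedAddCommGroup H] [InnerProductSpace ℂ H]
  [NormedAddCommGroup K] [InnerProductSpace ℂ K] [NormedAddCommGroup L] [InnerProductSpace ℂ L]

theorem IsTraceClass.zero : IsTraceClass (0 : H →L[ℂ] H) := fun e f _ _ => by
  simp [summable_zero]

theorem IsTraceClass.add {S T : H →L[ℂ] H} (hS : IsTraceClass S) (hT : IsTraceClass T) :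
    IsTraceClass (S + T) := fun e f he hf => by
  refine Summable.of_nonneg_of_le (fun _ => norm_nonneg _) (fun n => ?_)
    ((hS e f he hf).add (hT e f he hf))
  rw [add_apply, inner_add_right]
  exact norm_add_le _ _

theorem IsTraceClass.smul {T : H →L[ℂ] H} (c : ℂ) (hT : IsTraceClass T) :
    IsTraceClass (c • T) := fun e f he hf => by
  simpa [inner_smul_right] using (hT e f he hf).mul_left ‖c‖

theorem HasTrace.zero : HasTrace (0 : H →L[ℂ] H) 0 :=
  ⟨IsTraceClass.zero, fun ι b => by simp [hasSum_zero]⟩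

theorem HasTrace.add {S T : H →L[ℂ] H} {s t : ℂ} (hS : HasTrace S s) (hT : HasTrace T t) :
    HasTrace (S + T) (s + t) :=
  ⟨hS.1.add hT.1, fun ι b => by simpa [inner_add_right] using (hS.2 ι b).add (hT.2 ι b)⟩

theorem HasTrace.smul {T : H →L[ℂ] H} {t : ℂ} (c : ℂ) (hT : HasTrace T t) :
    HasTrace (c • T) (c * t) :=
  ⟨hT.1.smul c, fun ι b => by simpa [inner_smul_right] using (hT.2 ι b).mul_left c⟩

variable [CompleteSpace H] [CompleteSpace K] [CompleteSpace L]

theorem HasTrace.unique {T : H →L[ℂ] H} {s t : ℂ} (hs : HasTrace T s) (ht : HasTrace T t) :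
    s = t := by
  obtain ⟨w, b, -⟩ := exists_hilbertBasis ℂ H
  exact (hs.2 w b).unique (ht.2 w b)

theorem HasTrace.opTrace_eq {T : H →L[ℂ] H} {t : ℂ} (h : HasTrace T t) : opTrace T = t := by
  have h' : ∃ t, HasTrace T t := ⟨t, h⟩
  rw [opTrace, dif_pos h']
  exact h'.choose_spec.unique h

/-- `|⟨e, S† B f⟩| ≤ ‖S e‖ ‖B f‖`, a product of square summable sequences. -/
theorem IsHS.isTraceClass {S B : H →L[ℂ] K} (hS : IsHS S) (hB : IsHS B) :
    IsTraceClass ((adjoint S).comp B) := fun e f he hf => by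
  refine Summable.of_nonneg_of_le (fun _ => norm_nonneg _) (fun n => ?_)
    ((hS.summable he).add (hB.summable hf))
  rw [comp_apply, adjoint_inner_right]
  refine (norm_inner_le_norm _ _).trans ?_
  nlinarith [sq_nonneg (‖S (e n)‖ - ‖B (f n)‖), sq_nonneg ‖S (e n)‖, sq_nonneg ‖B (f n)‖]

/-- A product of Hilbert–Schmidt operators has a trace, given by the sum over any Hilbert basis, and
`tr (S† B) = tr (B S†)`. -/
theorem IsHS.hasTrace {S B : H →L[ℂ] K} (hS : IsHS S) (hB : IsHS B) {ι : Type*}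
    (b : HilbertBasis ι ℂ H) {t : ℂ} (ht : HasSum (fun i => inner ℂ (S (b i)) (B (b i))) t) :
    HasTrace ((adjoint S).comp B) t ∧ HasTrace (B.comp (adjoint S)) t := by
  obtain ⟨w, c, -⟩ := exists_hilbertBasis ℂ K
  have h1 : ∀ (κ : Type u) (c : HilbertBasis κ ℂ K),
      HasSum (fun j => inner ℂ (adjoint B (c j)) (adjoint S (c j))) t := by
    intro κ c
    obtain ⟨t', h1, h2⟩ := hS.hasSum_inner_swap hB b c
    rwa [ht.unique h1]
  refine ⟨⟨hS.isTraceClass hB, fun κ e => ?_⟩, ⟨?_, fun κ e => ?_⟩⟩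
  · obtain ⟨t', h2, h3⟩ := hS.hasSum_inner_swap hB e c
    rw [(h1 w c).unique h3]
    simpa [adjoint_inner_right] using h2
  · have h := hB.adj.isTraceClass hS.adj
    rwa [adjoint_adjoint] at h
  · simpa [adjoint_inner_left] using h1 κ e

/-- The span of the operators `S† B` for Hilbert–Schmidt operators `S`, `B` from `H` to `K`. -/
def hsProducts (H K : Type u) [NormedAddCommGroup H] [InnerProductSpace ℂ H]
    [NormedAddCommGroup K] [InnerProductSpace ℂ K] [CompleteSpace H] [CompleteSpace K] :
    Submodule ℂ (H →L[ℂ] H) :=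
  Submodule.span ℂ {T | ∃ S B : H →L[ℂ] K, IsHS S ∧ IsHS B ∧ T = (adjoint S).comp B}

theorem exists_hasTrace_of_mem_hsProducts {T : H →L[ℂ] H} (hT : T ∈ hsProducts H K) :
    ∃ t, HasTrace T t := by
  induction hT using Submodule.span_induction with
  | mem T h =>
    obtain ⟨S, B, hS, hB, rfl⟩ := h
    obtain ⟨w, b, -⟩ := exists_hilbertBasis ℂ H
    obtain ⟨v, c, -⟩ := exists_hilbertBasis ℂ K
    obtain ⟨t, ht, -⟩ := hS.hasSum_inner_swap hB b c
    exact ⟨t, (hS.hasTrace hB b ht).1⟩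
  | zero => exact ⟨0, HasTrace.zero⟩
  | add S T _ _ hS hT =>
    obtain ⟨s, hs⟩ := hS
    obtain ⟨t, ht⟩ := hT
    exact ⟨s + t, hs.add ht⟩
  | smul c T _ hT =>
    obtain ⟨t, ht⟩ := hT
    exact ⟨c * t, ht.smul c⟩

theorem conj_mem_hsProducts {T : H →L[ℂ] H} (hT : T ∈ hsProducts H K) (J : L →L[ℂ] H) :
    (adjoint J).comp (T.comp J) ∈ hsProducts L K := by
  induction hT using Submodule.span_induction with
  | mem T h =>
    obtain ⟨S, B, hS, hB, rfl⟩ := h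
    refine Submodule.subset_span ⟨S.comp J, B.comp J, hS.comp_right _, hB.comp_right _, ?_⟩
    rw [adjoint_comp]
    rfl
  | zero => simp
  | add S T _ _ hS hT => rw [add_comp, comp_add]; exact Submodule.add_mem _ hS hT
  | smul c T _ hT => rw [smul_comp, comp_smul]; exact Submodule.smul_mem _ _ hT

end Trace

/-! ### Discrete cocompact subgroups -/

section Cocompact

variable {G : Type u} [Group G] [TopologicalSpace G] [IsTopologicalGroup G]

/-- A subgroup `Γ` is cocompact if `Γ K = G` for some compact `K`. -/
def IsCocompact (Γ : Subgroup G) : Prop :=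
  ∃ K : Set G, IsCompact K ∧ ∀ x : G, ∃ γ : Γ, (γ : G) * x ∈ K

/-- Finitely many images of compact neighbourhoods cover the compact quotient, as the projection is
open. -/
theorem isCocompact_of_compactSpace [LocallyCompactSpace G] (Γ : Subgroup G)
    [CompactSpace (RightQuot Γ)] : IsCocompact Γ := by
  let p : G → RightQuot Γ := Quotient.mk _
  have hp : IsOpenMap p := by
    intro U hU
    have h1 : p ⁻¹' (p '' U) = ⋃ γ : Γ, (fun x => (γ : G) * x) ⁻¹' U := by
      ext x
      simp only [mem_preimage, mem_image, mem_iUnion]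
      constructor
      · rintro ⟨y, hy, h⟩
        have h2 : x * y⁻¹ ∈ Γ := QuotientGroup.rightRel_apply.1 (Quotient.exact h)
        exact ⟨⟨_, Γ.inv_mem h2⟩, by simpa using hy⟩
      · rintro ⟨γ, h⟩
        refine ⟨_, h, Quotient.sound (QuotientGroup.rightRel_apply.2 ?_)⟩
        simp
    have h2 : IsOpen (p ⁻¹' (p '' U)) := by
      rw [h1]
      exact isOpen_iUnion fun γ => hU.preimage (continuous_const_mul _)
    exact h2
  choose C hC hxC using fun x : G => exists_compact_mem_nhds x
  obtain ⟨t, ht⟩ := isCompact_univ.elim_finite_subcover (fun x => p '' interior (C x))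
    (fun x => hp _ isOpen_interior) (by
      rintro q -
      obtain ⟨x, rfl⟩ := Quotient.exists_rep q
      exact mem_iUnion.2 ⟨x, x, mem_interior_iff_mem_nhds.2 (hxC x), rfl⟩)
  refine ⟨⋃ x ∈ t, C x, t.isCompact_biUnion fun x _ => hC x, fun x => ?_⟩
  have h3 := ht (mem_univ (p x))
  simp only [mem_iUnion] at h3
  obtain ⟨y, hy, z, hz, h⟩ := h3
  have h2 : x * z⁻¹ ∈ Γ := QuotientGroup.rightRel_apply.1 (Quotient.exact h)
  exact ⟨⟨_, Γ.inv_mem h2⟩, mem_biUnion hy (interior_subset (by simpa using hz))⟩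

theorem finite_mem_of_isCompact [T2Space G] (Γ : Subgroup G) [DiscreteTopology Γ] {C : Set G}
    (hC : IsCompact C) : {γ : Γ | (γ : G) ∈ C}.Finite := by
  have h1 : IsClosed (Γ : Set G) := Subgroup.isClosed_of_discrete
  exact ((h1.isClosedEmbedding_subtypeVal).isCompact_preimage hC).finite_of_discrete

/-- For discrete cocompact `Γ` the number of `γ ∈ Γ` with `x⁻¹ γ y` in a given compact set is bounded
uniformly in `x` and `y`. -/
theorem exists_card_le [T2Space G] {Γ : Subgroup G} [DiscreteTopology Γ] (hΓ : IsCocompact Γ)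
    {B : Set G} (hB : IsCompact B) : ∃ N : ℕ, ∀ x y : G,
      {γ : Γ | x⁻¹ * γ * y ∈ B}.Finite ∧ {γ : Γ | x⁻¹ * γ * y ∈ B}.ncard ≤ N := by
  obtain ⟨K, hK, hcov⟩ := hΓ
  let C : Set G := (fun q : (G × G) × G => q.1.1 * q.1.2 * q.2⁻¹) '' ((K ×ˢ B) ×ˢ K)
  have hC : IsCompact C := ((hK.prod hB).prod hK).image (by fun_prop)
  have hfin := finite_mem_of_isCompact Γ hC
  refine ⟨{γ : Γ | (γ : G) ∈ C}.ncard, fun x y => ?_⟩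
  obtain ⟨η, hη⟩ := hcov x
  obtain ⟨θ, hθ⟩ := hcov y
  have hinj : InjOn (fun γ : Γ => η * γ * θ⁻¹) {γ : Γ | x⁻¹ * γ * y ∈ B} := by
    intro a _ b _ h
    simpa using h
  have hmaps : MapsTo (fun γ : Γ => η * γ * θ⁻¹) {γ : Γ | x⁻¹ * γ * y ∈ B}
      {γ : Γ | (γ : G) ∈ C} := by
    intro γ hγ
    refine ⟨(((η : G) * x, x⁻¹ * γ * y), (θ : G) * y), ⟨⟨hη, hγ⟩, hθ⟩, ?_⟩
    simp [mul_assoc]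
  exact ⟨hfin.of_injOn hmaps hinj, Set.ncard_le_ncard_of_injOn _ hmaps hinj hfin⟩

theorem exists_tsum_indicator_le [T2Space G] {Γ : Subgroup G} [DiscreteTopology Γ]
    (hΓ : IsCocompact Γ) {B : Set G} (hB : IsCompact B) : ∃ N : ℕ, ∀ x y : G,
      ∑' γ : Γ, B.indicator (fun _ => (1 : ℝ≥0∞)) (x⁻¹ * γ * y) ≤ N := by
  obtain ⟨N, hN⟩ := exists_card_le hΓ hB
  refine ⟨N, fun x y => ?_⟩
  obtain ⟨h1, h2⟩ := hN x y
  have h3 : ∀ γ : Γ, B.indicator (fun _ => (1 : ℝ≥0∞)) (x⁻¹ * γ * y) =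
      {γ : Γ | x⁻¹ * γ * y ∈ B}.indicator (fun _ => 1) γ := fun γ => rfl
  simp only [h3]
  rw [← tsum_subtype {γ : Γ | x⁻¹ * γ * y ∈ B} (fun _ => (1 : ℝ≥0∞)), ENNReal.tsum_set_one,
    ← h1.cast_ncard_eq]
  exact_mod_cast h2

end Cocompact

section Unimodular

variable {G : Type u} [Group G] [TopologicalSpace G] [IsTopologicalGroup G]
  [SecondCountableTopology G] [MeasurableSpace G] [BorelSpace G]
  {Γ : Subgroup G} [DiscreteTopology Γ] {μ : Measure G}

instance countable_of_discrete : Countable Γ :=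
  TopologicalSpace.separableSpace_iff_countable.1 inferInstance

open scoped Pointwise in
/-- The integral of a `Γ`-invariant function over a fundamental domain is at most its integral over
any set which meets all orbits. -/
theorem setLIntegral_fundDomain_le [μ.IsMulLeftInvariant] {K : Set G}
    (hcov : ∀ x : G, ∃ γ : Γ, (γ : G) * x ∈ K)
    {u : G → ℝ≥0∞} (hu : ∀ γ : Γ, ∀ᵐ x ∂μ, u ((γ : G) * x) = u x) :
    ∫⁻ x in fundDomain Γ μ, u x ∂μ ≤ ∫⁻ x in K, u x ∂μ := by
  have hF := isFundamentalDomain Γ μ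
  rw [hF.setLIntegral_eq_tsum' u K]
  have h1 : fundDomain Γ μ ⊆ ⋃ γ : Γ, γ • K ∩ fundDomain Γ μ := by
    intro x hx
    obtain ⟨γ, hγ⟩ := hcov x
    refine mem_iUnion.2 ⟨γ⁻¹, ?_, hx⟩
    rw [mem_smul_set_iff_inv_smul_mem, inv_inv]
    exact hγ
  refine (lintegral_mono_set h1).trans ((lintegral_iUnion_le _ _).trans ?_)
  refine ENNReal.tsum_le_tsum fun γ => le_of_eq (lintegral_congr_ae (ae_restrict_of_ae ?_))
  filter_upwards [hu γ⁻¹] with x hx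
  exact hx.symm

theorem measure_fundDomain_lt_top [μ.IsHaarMeasure] (hΓ : IsCocompact Γ) :
    μ (fundDomain Γ μ) < ⊤ := by
  obtain ⟨K, hK, hcov⟩ := hΓ
  have h := setLIntegral_fundDomain_le (μ := μ) hcov (u := fun _ => 1)
    fun _ => Eventually.of_forall fun _ => rfl
  simp only [lintegral_one, Measure.restrict_apply_univ] at h
  exact h.trans_lt hK.measure_lt_top

/-- A group with a discrete cocompact subgroup is unimodular: the right translates of a fundamental
domain are fundamental domains, so they all have the same finite nonzero measure. -/
theorem isMulRightInvariant_of_isCocompact [LocallyCompactSpace G] [μ.IsHaarMeasure]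
    (hΓ : IsCocompact Γ) : μ.IsMulRightInvariant := by
  refine ⟨fun z => ?_⟩
  have hF := isFundamentalDomain Γ μ
  have h1 : μ.map (· * z) = (μ.map (· * z)).haarScalarFactor μ • μ :=
    Measure.isMulLeftInvariant_eq_smul _ _
  set c := (μ.map (· * z)).haarScalarFactor μ
  have hF' : IsFundamentalDomain Γ ((· * z) ⁻¹' fundDomain Γ μ) μ :=
    hF.preimage_of_equiv (quasiMeasurePreserving_mul_right μ z) (e := id) Function.bijective_id
      fun γ x => by simp [Subgroup.smul_def, mul_assoc]
  have h2 : (μ.map (· * z)) (fundDomain Γ μ) = μ (fundDomain Γ μ) := by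
    rw [Measure.map_apply₀ (by fun_prop)
      (hF.nullMeasurableSet.mono_ac (quasiMeasurePreserving_mul_right μ z).absolutelyContinuous)]
    exact hF'.measure_eq hF
  rw [h1, Measure.smul_apply] at h2
  have h3 : c = 1 := by
    have h4 : (c : ℝ≥0∞) * μ (fundDomain Γ μ) = 1 * μ (fundDomain Γ μ) := by
      rw [one_mul]; exact h2
    have h5 := (ENNReal.mul_left_inj (hF.measure_ne_zero (NeZero.ne μ))
      (measure_fundDomain_lt_top hΓ).ne).1 h4
    exact_mod_cast h5
  rw [h1, h3, one_smul]

/-- On a unimodular group inversion transforms Haar measure by a positive constant `c`, and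
`c² = 1`. -/
theorem isInvInvariant_of_isMulRightInvariant [LocallyCompactSpace G] [μ.IsHaarMeasure]
    [μ.IsMulRightInvariant] : μ.IsInvInvariant := by
  constructor
  have h1 : μ.inv = μ.inv.haarScalarFactor μ • μ := Measure.isMulLeftInvariant_eq_smul _ _
  set c := μ.inv.haarScalarFactor μ
  have h2 : μ = (c ^ 2) • μ := by
    have h3 : μ.inv.inv = c • c • μ := by
      conv_lhs => rw [h1]
      rw [Measure.inv_def, Measure.map_smul, ← Measure.inv_def, h1]
    rwa [Measure.inv_inv, smul_smul, ← pow_two] at h3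
  obtain ⟨K⟩ : Nonempty (TopologicalSpace.PositiveCompacts G) := inferInstance
  have h3 : ((c ^ 2 : NNReal) : ℝ≥0∞) * μ K = 1 * μ K := by
    rw [one_mul]
    conv_rhs => rw [h2]
    rfl
  have h4 := (ENNReal.mul_left_inj
    (Measure.measure_pos_of_nonempty_interior _ K.interior_nonempty).ne'
    K.isCompact.measure_lt_top.ne).1 h3
  have h5 : c ^ 2 = 1 := by exact_mod_cast h4
  have h6 : c = 1 := by simpa using h5
  rw [h1, h6, one_smul]

end Unimodular

/-! ### The Hilbert space of automorphic sections and its right translations -/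

section L2Basic

variable {G W : Type u} [Group G] [TopologicalSpace G] [IsTopologicalGroup G]
  [SecondCountableTopology G] [MeasurableSpace G] [BorelSpace G]
  [NormedAddCommGroup W] [InnerProductSpace ℂ W]
  {Γ : Subgroup G} [DiscreteTopology Γ] {μ : Measure G} [μ.IsMulLeftInvariant]
  {ψ : Γ →* (W ≃ₗᵢ[ℂ] W)}

theorem L2.coe_sub (s t : L2 μ ψ) : ∀ᵐ x ∂μ, (s - t) x = s x - t x :=
  AEEqFun.coeFn_sub s.1 t.1

theorem L2.coe_restr (s : L2 μ ψ) :
    ∀ᵐ x ∂(μ.restrict (fundDomain Γ μ)), L2.restr μ ψ s x = s x :=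
  MemLp.coeFn_toLp s.2.2

theorem L2.aestronglyMeasurable (s : L2 μ ψ) : AEStronglyMeasurable s μ :=
  AEEqFun.aestronglyMeasurable s.1

theorem L2.inner_eq (s t : L2 μ ψ) :
    inner ℂ s t = ∫ x in fundDomain Γ μ, inner ℂ (s x) (t x) ∂μ := by
  have h : inner ℂ s t = inner ℂ (L2.restr μ ψ s) (L2.restr μ ψ t) := rfl
  rw [h, MeasureTheory.L2.inner_def]
  refine integral_congr_ae ?_
  filter_upwards [L2.coe_restr s, L2.coe_restr t] with x h1 h2
  rw [h1, h2]

theorem L2.integrable_inner (s t : L2 μ ψ) :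
    IntegrableOn (fun x => inner ℂ (s x) (t x)) (fundDomain Γ μ) μ := by
  refine (MeasureTheory.L2.integrable_inner (𝕜 := ℂ) (L2.restr μ ψ s) (L2.restr μ ψ t)).congr ?_
  filter_upwards [L2.coe_restr s, L2.coe_restr t] with x h1 h2
  rw [h1, h2]

theorem L2.enorm_sq (s : L2 μ ψ) :
    ‖s‖ₑ ^ 2 = ∫⁻ x in fundDomain Γ μ, ‖s x‖ₑ ^ 2 ∂μ := by
  have h1 : ‖s‖ₑ = eLpNorm s 2 (μ.restrict (fundDomain Γ μ)) := by
    rw [← ofReal_norm, L2.norm_eq, ENNReal.ofReal_toReal s.2.2.2.ne]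
  rw [h1, eLpNorm_eq_lintegral_rpow_enorm_toReal two_ne_zero ENNReal.ofNat_ne_top,
    ← ENNReal.rpow_natCast, ← ENNReal.rpow_mul]
  norm_num

theorem L2.enorm_map (s : L2 μ ψ) (γ : Γ) : ∀ᵐ x ∂μ, ‖s ((γ : G) * x)‖ₑ = ‖s x‖ₑ := by
  filter_upwards [s.2.1 γ] with x hx
  rw [hx, ← ofReal_norm, LinearIsometryEquiv.norm_map, ofReal_norm]

instance [SFinite μ] [TopologicalSpace.SeparableSpace W] : SecondCountableTopology (L2 μ ψ) := by
  have h : Isometry (L2.restr μ ψ) := AddMonoidHomClass.isometry_of_norm _ fun s => rfl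
  have : Fact ((2 : ℝ≥0∞) ≠ ⊤) := ⟨ENNReal.ofNat_ne_top⟩
  exact h.isUniformInducing.isInducing.secondCountableTopology

/-- A Cauchy sequence converges almost everywhere on the fundamental domain along a subsequence, and
then almost everywhere on `G` by equivariance. -/
instance L2.completeSpace [CompleteSpace W] : CompleteSpace (L2 μ ψ) := by
  refine Metric.complete_of_cauchySeq_tendsto fun s hs => ?_
  have hF := isFundamentalDomain Γ μ
  have hiso : Isometry (L2.restr μ ψ) := AddMonoidHomClass.isometry_of_norm _ fun s => rfl
  obtain ⟨u, hu⟩ := cauchySeq_tendsto_of_complete (hiso.uniformContinuous.comp_cauchySeq hs)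
  obtain ⟨ns, hns, hlim⟩ := (tendstoInMeasure_of_tendsto_Lp hu).exists_seq_tendsto_ae
  have h1 : ∀ᵐ x ∂(μ.restrict (fundDomain Γ μ)),
      Tendsto (fun k => s (ns k) x) atTop (𝓝 (u x)) := by
    filter_upwards [hlim, ae_all_iff.2 fun k => L2.coe_restr (s (ns k))] with x h2 h3
    simp only [← h3]
    exact h2
  have h1' := h1
  rw [ae_restrict_iff'₀ hF.nullMeasurableSet] at h1
  have h2 : ∀ᵐ x ∂μ, ∀ γ : Γ, (γ : G) * x ∈ fundDomain Γ μ →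
      Tendsto (fun k => s (ns k) ((γ : G) * x)) atTop (𝓝 (u ((γ : G) * x))) :=
    ae_all_iff.2 fun γ => ae_mul_left (γ : G) h1
  have h3 : ∀ᵐ x ∂μ, ∀ k, ∀ γ : Γ, s (ns k) ((γ : G) * x) = ψ γ (s (ns k) x) :=
    ae_all_iff.2 fun k => ae_all_iff.2 (s (ns k)).2.1
  obtain ⟨v, hv, hvlim⟩ := exists_stronglyMeasurable_limit_of_tendsto_ae
    (f := fun k x => s (ns k) x) (μ := μ) (fun k => L2.aestronglyMeasurable _) (by
      filter_upwards [h2, h3, hF.ae_covers] with x h4 h5 ⟨γ, hγ⟩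
      refine ⟨(ψ γ).symm (u ((γ : G) * x)), ?_⟩
      have h6 := ((ψ γ).symm.continuous.tendsto _).comp (h4 γ hγ)
      refine h6.congr fun k => ?_
      simp [h5 k γ])
  have hvu : ∀ᵐ x ∂(μ.restrict (fundDomain Γ μ)), v x = u x := by
    filter_upwards [h1', ae_restrict_of_ae hvlim] with x h4 h5
    exact tendsto_nhds_unique h5 h4
  have hv0 : ∀ᵐ x ∂μ, AEEqFun.mk v hv.aestronglyMeasurable x = v x :=
    AEEqFun.coeFn_mk v hv.aestronglyMeasurable
  let w : L2 μ ψ := ⟨AEEqFun.mk v hv.aestronglyMeasurable, by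
    refine ⟨fun γ => ?_, ?_⟩
    · filter_upwards [hv0, ae_mul_left (γ : G) hv0, hvlim, ae_mul_left (γ : G) hvlim, h3]
        with x h4 h5 h6 h7 h8
      rw [h4, h5]
      refine tendsto_nhds_unique h7 ?_
      refine (((ψ γ).continuous.tendsto _).comp h6).congr fun k => ?_
      exact (h8 k γ).symm
    · refine (memLp_congr_ae ?_).2 (Lp.memLp u)
      filter_upwards [ae_restrict_of_ae hv0, hvu] with x h4 h5
      rw [h4, h5]⟩
  refine ⟨w, ?_⟩
  have hwu : L2.restr μ ψ w = u := by
    refine Lp.ext ?_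
    filter_upwards [L2.coe_restr w, ae_restrict_of_ae hv0, hvu] with x h4 h5 h6
    rw [h4, ← h6]
    exact h5
  rw [hiso.isUniformInducing.isInducing.tendsto_nhds_iff, hwu]
  exact hu

end L2Basic

section Translation

variable {G W : Type u} [Group G] [TopologicalSpace G] [IsTopologicalGroup G]
  [LocallyCompactSpace G]  [SecondCountableTopology G] [MeasurableSpace G] [BorelSpace G]
  [NormedAddCommGroup W] [InnerProductSpace ℂ W]
  {Γ : Subgroup G} [DiscreteTopology Γ] {μ : Measure G} [μ.IsHaarMeasure] [μ.IsMulRightInvariant]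
  {ψ : Γ →* (W ≃ₗᵢ[ℂ] W)}

/-- The integral of a `Γ`-invariant function over the fundamental domain is invariant under right
translations. -/
theorem setLIntegral_mul_right {u : G → ℝ≥0∞} (hu : ∀ γ : Γ, ∀ᵐ x ∂μ, u ((γ : G) * x) = u x)
    (z : G) : ∫⁻ x in fundDomain Γ μ, u (x * z) ∂μ = ∫⁻ x in fundDomain Γ μ, u x ∂μ := by
  have hF := isFundamentalDomain Γ μ
  have hF' : IsFundamentalDomain Γ ((fun x => x * z⁻¹) ⁻¹' fundDomain Γ μ) μ :=
    hF.preimage_of_equiv (measurePreserving_mul_right μ z⁻¹).quasiMeasurePreserving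
      (e := id) Function.bijective_id fun γ x => by simp [Subgroup.smul_def, mul_assoc]
  have h3 := (measurePreserving_mul_right μ z).setLIntegral_comp_preimage_emb
    (measurableEmbedding_mulRight z) u ((fun x => x * z⁻¹) ⁻¹' fundDomain Γ μ)
  have h4 : (fun x => x * z) ⁻¹' ((fun x => x * z⁻¹) ⁻¹' fundDomain Γ μ) = fundDomain Γ μ := by
    ext x; simp
  rw [h4] at h3
  rw [h3]
  exact setLIntegral_fundDomain hF' hF hu

/-- The right translate `x ↦ s (x z)`. -/
def L2.rightFun (z : G) (s : L2 μ ψ) : L2 μ ψ :=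
  ⟨s.1.compMeasurePreserving (fun x => x * z) (measurePreserving_mul_right μ z), by
    have h0 : ∀ᵐ x ∂μ, s.1.compMeasurePreserving (fun x => x * z)
        (measurePreserving_mul_right μ z) x = s (x * z) :=
      AEEqFun.coeFn_compMeasurePreserving _ _
    refine ⟨fun γ => ?_, ?_⟩
    · filter_upwards [h0, ae_mul_left (γ : G) h0, ae_mul_right z (s.2.1 γ)] with x h1 h2 h3
      rw [h1, h2, mul_assoc, h3]
    · refine ⟨AEEqFun.aestronglyMeasurable _ |>.restrict, ?_⟩
      have h2 : (2 : ℝ≥0∞) ≠ 0 := two_ne_zero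
      rw [eLpNorm_congr_ae (ae_restrict_of_ae h0)]
      refine lt_of_eq_of_lt ?_ s.2.2.2
      rw [eLpNorm_eq_lintegral_rpow_enorm_toReal h2 ENNReal.ofNat_ne_top,
        eLpNorm_eq_lintegral_rpow_enorm_toReal h2 ENNReal.ofNat_ne_top]
      congr 1
      refine setLIntegral_mul_right (u := fun x => ‖s x‖ₑ ^ (2 : ℝ≥0∞).toReal) (fun γ => ?_) z
      filter_upwards [L2.enorm_map s γ] with x hx
      rw [hx]⟩

theorem L2.coe_rightFun (z : G) (s : L2 μ ψ) : ∀ᵐ x ∂μ, L2.rightFun z s x = s (x * z) :=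
  AEEqFun.coeFn_compMeasurePreserving _ (measurePreserving_mul_right μ z)

theorem L2.norm_rightFun (z : G) (s : L2 μ ψ) : ‖L2.rightFun z s‖ = ‖s‖ := by
  have h : ‖L2.rightFun z s‖ₑ ^ 2 = ‖s‖ₑ ^ 2 := by
    rw [L2.enorm_sq, L2.enorm_sq,
      ← setLIntegral_mul_right (u := fun x => ‖s x‖ₑ ^ 2) (fun γ => ?_) z]
    · refine lintegral_congr_ae (ae_restrict_of_ae ?_)
      filter_upwards [L2.coe_rightFun z s] with x hx
      rw [hx]
    · filter_upwards [L2.enorm_map s γ] with x hx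
      rw [hx]
  have h1 := (ENNReal.pow_right_strictMono two_ne_zero).injective h
  rw [← toReal_enorm, h1, toReal_enorm]

theorem L2.rightFun_mul (z w : G) (s : L2 μ ψ) :
    L2.rightFun (z * w) s = L2.rightFun z (L2.rightFun w s) := L2.ext <| by
  filter_upwards [L2.coe_rightFun (z * w) s, L2.coe_rightFun z (L2.rightFun w s),
    ae_mul_right z (L2.coe_rightFun w s)] with x h1 h2 h3
  rw [h1, h2, h3, mul_assoc]

theorem L2.rightFun_one (s : L2 μ ψ) : L2.rightFun 1 s = s := L2.ext <| by
  filter_upwards [L2.coe_rightFun 1 s] with x h1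
  rw [h1, mul_one]

/-- The unitary representation of `G` on `L²(Γ\G, ψ)` by right translations. -/
def L2.right : G →* (L2 μ ψ ≃ₗᵢ[ℂ] L2 μ ψ) where
  toFun z :=
    { toFun := L2.rightFun z
      invFun := L2.rightFun z⁻¹
      left_inv := fun s => by rw [← L2.rightFun_mul, inv_mul_cancel, L2.rightFun_one]
      right_inv := fun s => by rw [← L2.rightFun_mul, mul_inv_cancel, L2.rightFun_one]
      map_add' := fun s t => L2.ext <| by
        filter_upwards [L2.coe_rightFun z (s + t), L2.coe_rightFun z s, L2.coe_rightFun z t,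
          L2.coe_add (L2.rightFun z s) (L2.rightFun z t), ae_mul_right z (L2.coe_add s t)]
          with x h1 h2 h3 h4 h5
        rw [h1, h4, h2, h3, h5]
      map_smul' := fun c s => L2.ext <| by
        filter_upwards [L2.coe_rightFun z (c • s), L2.coe_rightFun z s,
          L2.coe_smul c (L2.rightFun z s), ae_mul_right z (L2.coe_smul c s)] with x h1 h2 h3 h4
        rw [h1, RingHom.id_apply, h3, h2, h4]
      norm_map' := L2.norm_rightFun z }
  map_one' := by ext1 s; exact L2.rightFun_one s
  map_mul' z w := by ext1 s; exact L2.rightFun_mul z w s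

theorem L2.coe_right (z : G) (s : L2 μ ψ) : ∀ᵐ x ∂μ, L2.right z s x = s (x * z) :=
  L2.coe_rightFun z s

theorem mem_homG_iff {π : IrrUnitaryRep G} {T : π.space →L[ℂ] L2 μ ψ} :
    T ∈ homG μ ψ π ↔ ∀ z v, T (π.rep z v) = L2.right z (T v) := by
  constructor
  · intro h z v
    refine L2.ext ?_
    filter_upwards [h z v, L2.coe_right z (T v)] with x h1 h2
    rw [h1, h2]
  · intro h z v
    filter_upwards [L2.coe_right z (T v)] with x h2
    rw [h z v, h2]

/-- The number of `γ ∈ Γ` with `x⁻¹ γ y` in a given compact set is bounded, so an integral over a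
translate of that set is bounded by an integral over the fundamental domain. -/
theorem exists_lintegral_indicator_le [T2Space G] (hΓ : IsCocompact Γ) {B : Set G}
    (hB : IsCompact B) : ∃ N : ℕ, ∀ (x : G) (u : G → ℝ≥0∞), AEMeasurable u μ →
      (∀ γ : Γ, ∀ᵐ y ∂μ, u ((γ : G) * y) = u y) →
        ∫⁻ y, B.indicator (fun _ => 1) (x⁻¹ * y) * u y ∂μ ≤
          N * ∫⁻ y in fundDomain Γ μ, u y ∂μ := by
  obtain ⟨N, hN⟩ := exists_tsum_indicator_le hΓ hB
  refine ⟨N, fun x u hum hu => ?_⟩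
  rw [(isFundamentalDomain Γ μ).lintegral_eq_tsum'']
  have h1 : ∀ γ : Γ, ∫⁻ y in fundDomain Γ μ,
      B.indicator (fun _ => (1 : ℝ≥0∞)) (x⁻¹ * γ • y) * u (γ • y) ∂μ =
      ∫⁻ y in fundDomain Γ μ, B.indicator (fun _ => 1) (x⁻¹ * γ * y) * u y ∂μ := by
    intro γ
    refine lintegral_congr_ae (ae_restrict_of_ae ?_)
    filter_upwards [hu γ] with y hy
    simp only [Subgroup.smul_def, smul_eq_mul, hy, mul_assoc]
  simp only [h1]
  have hm : ∀ γ : Γ, Measurable fun y => B.indicator (fun _ => (1 : ℝ≥0∞)) (x⁻¹ * γ * y) :=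
    fun γ => (measurable_const.indicator hB.measurableSet).comp (measurable_const_mul _)
  have hm' : ∀ γ : Γ, AEMeasurable
      (fun y => B.indicator (fun _ => (1 : ℝ≥0∞)) (x⁻¹ * γ * y) * u y)
      (μ.restrict (fundDomain Γ μ)) := fun γ => (hm γ).aemeasurable.mul hum.restrict
  rw [← lintegral_tsum hm']
  rw [← lintegral_const_mul' _ _ (ENNReal.natCast_ne_top N)]
  refine lintegral_mono fun y => ?_
  rw [ENNReal.tsum_mul_right]
  gcongr
  exact hN x y

/-- Continuity of right translations: on a compact neighbourhood of a compact set `K` with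
`Γ K = G`, a section is square integrable over `G`, where translations are continuous. -/
theorem L2.continuous_right [T2Space G] (hΓ : IsCocompact Γ) (s : L2 μ ψ) :
    Continuous fun z => L2.right z s := by
  suffices h : ∀ s : L2 μ ψ, Tendsto (fun z => L2.right z s) (𝓝 1) (𝓝 s) by
    refine continuous_iff_continuousAt.2 fun z₀ => ?_
    have h1 : Tendsto (fun z => z₀⁻¹ * z) (𝓝 z₀) (𝓝 1) := by
      have := (continuous_const_mul z₀⁻¹).tendsto z₀
      rwa [inv_mul_cancel] at this
    have h2 := ((L2.right (μ := μ) (ψ := ψ) z₀).continuous.tendsto _).comp ((h s).comp h1)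
    refine h2.congr fun z => ?_
    change L2.right z₀ (L2.right (z₀⁻¹ * z) s) = L2.right z s
    conv_rhs => rw [show z = z₀ * (z₀⁻¹ * z) by simp, map_mul]
    rfl
  clear s
  intro s
  obtain ⟨Z, hZ, h1Z⟩ := exists_compact_mem_nhds (1 : G)
  have hΓ' := hΓ
  obtain ⟨K, hK, hcov⟩ := hΓ'
  -- `B` contains `x z` for all `x ∈ K` and all `z` in the neighbourhood `Z` of `1`
  let B : Set G := (fun q : G × G => q.1 * q.2) '' (K ×ˢ Z)
  have hB : IsCompact B := (hK.prod hZ).image (by fun_prop)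
  have hsB : MemLp (B.indicator s) 2 μ := by
    refine ⟨(L2.aestronglyMeasurable s).indicator hB.measurableSet, ?_⟩
    obtain ⟨N, hN⟩ := exists_lintegral_indicator_le (μ := μ) hΓ hB
    have h2 := hN 1 (fun y => ‖s y‖ₑ ^ 2) ((L2.aestronglyMeasurable s).enorm.pow_const 2)
      (fun γ => by filter_upwards [L2.enorm_map s γ] with x hx; rw [hx])
    rw [← L2.enorm_sq] at h2
    rw [eLpNorm_lt_top_iff_lintegral_rpow_enorm_lt_top two_ne_zero ENNReal.ofNat_ne_top]
    refine lt_of_le_of_lt (le_of_eq ?_) (h2.trans_lt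
      (ENNReal.mul_lt_top (ENNReal.natCast_lt_top N) (ENNReal.pow_lt_top enorm_lt_top)))
    refine lintegral_congr fun y => ?_
    by_cases hy : y ∈ B <;> simp [hy]
  let t : Lp W 2 μ := hsB.toLp
  have ht : ∀ᵐ x ∂μ, t x = B.indicator s x := hsB.coeFn_toLp
  let τ : G → C(G, G) := fun z => ⟨fun x => x * z, continuous_mul_const z⟩
  have hτ : Continuous τ :=
    ContinuousMap.continuous_of_continuous_uncurry _ (continuous_snd.mul continuous_fst)
  have hτm : ∀ z, MeasurePreserving (τ z) μ μ := fun z => measurePreserving_mul_right μ z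
  let tr : G → Lp W 2 μ := fun z => Lp.compMeasurePreserving (τ z) (hτm z) t
  have htr : Continuous tr :=
    continuous_const.compMeasurePreservingLp hτ hτm ENNReal.ofNat_ne_top
  have htr1 : ∀ z, ∀ᵐ x ∂μ, tr z x = t (x * z) := fun z =>
    Lp.coeFn_compMeasurePreserving t (hτm z)
  have key : ∀ᶠ z in 𝓝 (1 : G), ‖L2.right z s - s‖ₑ ^ 2 ≤ ‖tr z - tr 1‖ₑ ^ 2 := by
    filter_upwards [h1Z] with z hz
    have h3 : ∀ᵐ x ∂μ, (L2.right z s - s) x = s (x * z) - s x := by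
      filter_upwards [L2.coe_sub (L2.right z s) s, L2.coe_right z s] with x h4 h5
      rw [h4, h5]
    have h6 : ‖tr z - tr 1‖ₑ ^ 2 = ∫⁻ x, ‖(tr z - tr 1) x‖ₑ ^ 2 ∂μ := by
      rw [Lp.enorm_def, eLpNorm_eq_lintegral_rpow_enorm_toReal two_ne_zero ENNReal.ofNat_ne_top,
        ← ENNReal.rpow_natCast, ← ENNReal.rpow_mul]
      norm_num
    rw [L2.enorm_sq, h6]
    refine (setLIntegral_fundDomain_le (K := K) hcov (fun γ => ?_)).trans ?_
    · filter_upwards [L2.enorm_map (L2.right z s - s) γ] with x hx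
      rw [hx]
    · refine le_trans ?_ (setLIntegral_le_lintegral K _)
      refine lintegral_mono_ae ?_
      rw [ae_restrict_iff' hK.measurableSet]
      filter_upwards [h3, Lp.coeFn_sub (tr z) (tr 1), htr1 z, htr1 1, ht, ae_mul_right z ht]
        with x h7 h8 h9 h10 h11 h12 hx
      have hxB : x ∈ B := ⟨(x, 1), ⟨hx, mem_of_mem_nhds h1Z⟩, by simp⟩
      have hxzB : x * z ∈ B := ⟨(x, z), ⟨hx, hz⟩, rfl⟩
      rw [h7, h8, Pi.sub_apply, h9, h10, mul_one, h11, h12, indicator_of_mem hxB,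
        indicator_of_mem hxzB]
  have h13 : Tendsto (fun z => tr z - tr 1) (𝓝 1) (𝓝 0) := by
    have := (htr.tendsto 1).sub (tendsto_const_nhds (x := tr 1))
    rwa [sub_self] at this
  rw [tendsto_iff_norm_sub_tendsto_zero]
  refine squeeze_zero' (Eventually.of_forall fun _ => norm_nonneg _) ?_ (tendsto_zero_iff_norm_tendsto_zero.1 h13)
  filter_upwards [key] with z hz
  have h14 := (ENNReal.pow_right_strictMono two_ne_zero).le_iff_le.1 hz
  rw [← toReal_enorm, ← toReal_enorm]
  exact ENNReal.toReal_mono enorm_ne_top h14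

end Translation

/-! ### Convolution, and integration of unitary representations -/

section Conv

variable {G : Type u} [Group G] [MeasurableSpace G]

/-- The convolution `(a * b)(x) = ∫ a(v) b(v⁻¹ x) dv`. -/
def conv (μ : Measure G) (a b : G → ℂ) : G → ℂ := fun x => ∫ v, a v * b (v⁻¹ * x) ∂μ

/-- The adjoint function `x ↦ conj (f (x⁻¹))`. -/
def adjFun (f : G → ℂ) : G → ℂ := fun x => (starRingEnd ℂ) (f x⁻¹)

theorem adjFun_adjFun (f : G → ℂ) : adjFun (adjFun f) = f := by
  funext x; simp [adjFun]

theorem adjFun_add (f h : G → ℂ) : adjFun (f + h) = adjFun f + adjFun h := by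
  funext x; simp [adjFun]

theorem adjFun_smul (c : ℂ) (f : G → ℂ) : adjFun (c • f) = (starRingEnd ℂ) c • adjFun f := by
  funext x; simp [adjFun]

variable [TopologicalSpace G] [IsTopologicalGroup G] [SecondCountableTopology G] [BorelSpace G]
  {μ : Measure G}

theorem measurable_adjFun {f : G → ℂ} (hf : Measurable f) : Measurable (adjFun f) :=
  (Complex.continuous_conj.measurable.comp hf).comp measurable_inv

theorem integrable_adjFun [μ.IsInvInvariant] {f : G → ℂ} (hf : Integrable f μ) :
    Integrable (adjFun f) μ :=
  Complex.conjCLE.toContinuousLinearMap.integrable_comp hf.comp_inv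

theorem measurable_conv [SFinite μ] {a b : G → ℂ} (ha : Measurable a) (hb : Measurable b) :
    Measurable (conv μ a b) := by
  refine StronglyMeasurable.measurable ?_
  refine StronglyMeasurable.integral_prod_right' (f := fun p : G × G => a p.2 * b (p.2⁻¹ * p.1)) ?_
  exact ((ha.comp measurable_snd).mul
    (hb.comp (measurable_snd.inv.mul measurable_fst))).stronglyMeasurable

theorem integrable_conv_prod [SFinite μ] [μ.IsMulLeftInvariant] {a b : G → ℂ}
    (ha : Integrable a μ) (hb : Integrable b μ) :
    Integrable (fun p : G × G => a p.1 * b (p.1⁻¹ * p.2)) (μ.prod μ) :=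
  ((measurePreserving_prod_inv_mul μ μ).integrable_comp (ha.mul_prod hb).aestronglyMeasurable).2
    (ha.mul_prod hb)

theorem integrable_conv [SFinite μ] [μ.IsMulLeftInvariant] {a b : G → ℂ}
    (ha : Integrable a μ) (hb : Integrable b μ) : Integrable (conv μ a b) μ :=
  (integrable_conv_prod ha hb).integral_prod_right

theorem adjFun_conv [μ.IsMulLeftInvariant] (a b : G → ℂ) :
    adjFun (conv μ a b) = conv μ (adjFun b) (adjFun a) := by
  funext x
  simp only [adjFun, conv]
  rw [← integral_conj, ← integral_mul_left_eq_self _ x⁻¹]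
  refine integral_congr_ae (Eventually.of_forall fun v => ?_)
  simp [mul_comm]

end Conv

section RepInt

variable {G : Type u} [Group G] [TopologicalSpace G] [IsTopologicalGroup G]
  [SecondCountableTopology G] [MeasurableSpace G] [BorelSpace G]
  {H K : Type*} [NormedAddCommGroup H] [InnerProductSpace ℂ H]
  [NormedAddCommGroup K] [InnerProductSpace ℂ K]
  {ρ : G →* (H ≃ₗᵢ[ℂ] H)} {σ : G →* (K ≃ₗᵢ[ℂ] K)} {μ : Measure G} {f : G → ℂ}

theorem integrable_smul_rep (hρ : ∀ v, Continuous fun x => ρ x v) (hf : Integrable f μ) (v : H) :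
    Integrable (fun x => f x • ρ x⁻¹ v) μ := by
  refine (hf.norm.mul_const ‖v‖).mono' ?_ ?_
  · exact hf.aestronglyMeasurable.smul ((hρ v).comp continuous_inv).aestronglyMeasurable
  · exact Eventually.of_forall fun x => by simp [norm_smul]

/-- The operator `v ↦ ∫ f(x) ρ(x⁻¹) v dx` of a unitary representation `ρ`. -/
def repInt (hρ : ∀ v, Continuous fun x => ρ x v) (hf : Integrable f μ) : H →L[ℂ] H :=
  LinearMap.mkContinuous
    { toFun := fun v => ∫ x, f x • ρ x⁻¹ v ∂μ
      map_add' := fun v w => by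
        rw [← integral_add (integrable_smul_rep hρ hf v) (integrable_smul_rep hρ hf w)]
        simp
      map_smul' := fun c v => by
        rw [RingHom.id_apply, ← integral_smul]
        simp [smul_comm c] }
    (∫ x, ‖f x‖ ∂μ) (fun v => by
      refine (norm_integral_le_integral_norm _).trans ?_
      rw [← integral_mul_const]
      exact le_of_eq (integral_congr_ae (Eventually.of_forall fun x => by simp [norm_smul])))

theorem repInt_apply (hρ : ∀ v, Continuous fun x => ρ x v) (hf : Integrable f μ) (v : H) :
    repInt hρ hf v = ∫ x, f x • ρ x⁻¹ v ∂μ := rfl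

theorem IrrUnitaryRep.op_apply (π : IrrUnitaryRep G) (hf : Integrable f μ) (v : π.space) :
    π.op μ f v = ∫ x, f x • π.rep x⁻¹ v ∂μ := by
  rw [IrrUnitaryRep.op, dif_pos hf]
  rfl

theorem IrrUnitaryRep.op_eq_repInt (π : IrrUnitaryRep G) (hf : Integrable f μ) :
    π.op μ f = repInt π.continuous_orbit hf := by
  ext v
  rw [π.op_apply hf, repInt_apply]

theorem repInt_congr (hρ : ∀ v, Continuous fun x => ρ x v) (hf : Integrable f μ) {h : G → ℂ}
    (hh : Integrable h μ) (e : f = h) : repInt hρ hf = repInt hρ hh := by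
  subst e; rfl

theorem repInt_add (hρ : ∀ v, Continuous fun x => ρ x v) (hf : Integrable f μ) {h : G → ℂ}
    (hh : Integrable h μ) : repInt hρ (hf.add hh) = repInt hρ hf + repInt hρ hh := by
  ext v
  rw [add_apply, repInt_apply, repInt_apply, repInt_apply,
    ← integral_add (integrable_smul_rep hρ hf v) (integrable_smul_rep hρ hh v)]
  simp [add_smul]

theorem repInt_smul (hρ : ∀ v, Continuous fun x => ρ x v) (hf : Integrable f μ) (c : ℂ) :
    repInt hρ (hf.smul c) = c • repInt hρ hf := by
  ext v
  rw [smul_apply, repInt_apply, repInt_apply, ← integral_smul]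
  simp [mul_smul]

theorem repInt_intertwine [CompleteSpace H] [CompleteSpace K]
    (hρ : ∀ v, Continuous fun x => ρ x v) (hσ : ∀ v, Continuous fun x => σ x v)
    (hf : Integrable f μ) {T : H →L[ℂ] K} (hT : ∀ x v, T (ρ x v) = σ x (T v)) (v : H) :
    T (repInt hρ hf v) = repInt hσ hf (T v) := by
  rw [repInt_apply, repInt_apply, ← T.integral_comp_comm (integrable_smul_rep hρ hf v)]
  simp only [map_smul, hT]

variable [CompleteSpace H]

theorem repInt_adjoint [μ.IsInvInvariant] (hρ : ∀ v, Continuous fun x => ρ x v)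
    (hf : Integrable f μ) :
    adjoint (repInt hρ hf) = repInt hρ (integrable_adjFun hf) := by
  symm
  rw [eq_adjoint_iff]
  intro v w
  have h1 := integral_inner (𝕜 := ℂ) (integrable_smul_rep hρ (integrable_adjFun hf) v) w
  have h2 := integral_inner (𝕜 := ℂ) (integrable_smul_rep hρ hf w) v
  rw [repInt_apply, repInt_apply, ← h2, ← inner_conj_symm, ← h1, ← integral_conj,
    ← integral_inv_eq_self _ μ]
  refine integral_congr_ae (Eventually.of_forall fun x => ?_)
  have h3 : inner ℂ v (ρ x⁻¹ w) = inner ℂ (ρ x v) w := by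
    rw [← (ρ x).inner_map_map v (ρ x⁻¹ w)]
    congr 1
    have : (ρ x * ρ x⁻¹) w = w := by rw [← map_mul, mul_inv_cancel, map_one]; rfl
    exact this
  simp only [adjFun, inv_inv, inner_smul_right, map_mul, Complex.conj_conj, inner_conj_symm, h3]

/-- The order is reversed because `repInt` integrates `ρ(x⁻¹)`: it corresponds to convolution from
the right. -/
theorem repInt_conv [SFinite μ] [μ.IsMulLeftInvariant] (hρ : ∀ v, Continuous fun x => ρ x v)
    {a b : G → ℂ} (ha : Integrable a μ) (hb : Integrable b μ) :
    repInt hρ (integrable_conv ha hb) = (repInt hρ hb).comp (repInt hρ ha) := by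
  ext w
  have hint : Integrable (fun p : G × G => (a p.1 * b (p.1⁻¹ * p.2)) • ρ p.2⁻¹ w) (μ.prod μ) := by
    have h0 := integrable_conv_prod (μ := μ) ha hb
    refine (h0.norm.mul_const ‖w‖).mono' ?_ ?_
    · exact h0.aestronglyMeasurable.smul
        ((hρ w).comp (continuous_inv.comp continuous_snd)).aestronglyMeasurable
    · exact Eventually.of_forall fun x => by simp [norm_smul]
  have h1 : repInt hρ (integrable_conv ha hb) w =
      ∫ u, ∫ v, (a v * b (v⁻¹ * u)) • ρ u⁻¹ w ∂μ ∂μ := by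
    rw [repInt_apply]
    refine integral_congr_ae (Eventually.of_forall fun u => ?_)
    exact (integral_smul_const _ _).symm
  have h2 : Integrable (Function.uncurry fun u v : G => (a v * b (v⁻¹ * u)) • ρ u⁻¹ w)
      (μ.prod μ) := hint.swap
  rw [h1, integral_integral_swap h2, comp_apply, repInt_apply hρ ha,
    ← (repInt hρ hb).integral_comp_comm (integrable_smul_rep hρ ha w)]
  refine integral_congr_ae (Eventually.of_forall fun v => ?_)
  simp only [map_smul]
  rw [repInt_apply, ← integral_smul, ← integral_mul_left_eq_self _ v]
  refine integral_congr_ae (Eventually.of_forall fun u => ?_)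
  simp only [inv_mul_cancel_left, mul_inv_rev, map_mul, mul_smul]
  rfl

/-- Averages over small symmetric neighbourhoods of `1` approximate the identity. -/
theorem exists_repInt_indicator_ne_zero [LocallyCompactSpace G] [T2Space G] [μ.IsHaarMeasure]
    (hρ : ∀ v, Continuous fun x => ρ x v) {v : H} (hv : v ≠ 0) :
    ∃ U : Set G, IsCompact U ∧ U⁻¹ = U ∧ ∀ h : Integrable (U.indicator fun _ => (1 : ℂ)) μ,
      repInt hρ h v ≠ 0 := by
  have hv' : 0 < ‖v‖ := norm_pos_iff.2 hv
  have h1 : {x : G | ‖ρ x⁻¹ v - v‖ < ‖v‖ / 2} ∈ 𝓝 (1 : G) := by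
    have hc : Continuous fun x : G => ‖ρ x⁻¹ v - v‖ :=
      (((hρ v).comp continuous_inv).sub continuous_const).norm
    refine (isOpen_lt hc continuous_const).mem_nhds ?_
    have h2 : ρ (1 : G)⁻¹ v = v := by rw [inv_one, map_one]; rfl
    change ‖ρ (1 : G)⁻¹ v - v‖ < ‖v‖ / 2
    rw [h2, sub_self, norm_zero]
    exact half_pos hv'
  obtain ⟨C, hC1, hC2, hC⟩ := local_compact_nhds h1
  have hC' : C⁻¹ ∈ 𝓝 (1 : G) := inv_mem_nhds_one G hC1
  have hUc : IsCompact (C ∩ C⁻¹) := hC.inter hC.inv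
  refine ⟨C ∩ C⁻¹, hUc, by rw [Set.inter_inv, inv_inv, inter_comm], fun h h0 => ?_⟩
  set U := C ∩ C⁻¹
  have hUm : MeasurableSet U := hUc.measurableSet
  have hU0 : 0 < μ.real U := by
    refine ENNReal.toReal_pos ?_ hUc.measure_lt_top.ne
    exact (Measure.measure_pos_of_mem_nhds μ (inter_mem hC1 hC')).ne'
  have h2 : repInt hρ h v = ∫ x in U, ρ x⁻¹ v ∂μ := by
    rw [repInt_apply, ← integral_indicator hUm]
    refine integral_congr_ae (Eventually.of_forall fun x => ?_)
    by_cases hx : x ∈ U <;> simp [hx]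
  have hint : IntegrableOn (fun x => ρ x⁻¹ v) U μ :=
    ((hρ v).comp continuous_inv).continuousOn.integrableOn_compact hUc
  have h3 : ∫ x in U, (ρ x⁻¹ v - v) ∂μ = - (μ.real U • v) := by
    rw [integral_sub hint (integrableOn_const hUc.measure_lt_top.ne), ← h2, h0, setIntegral_const,
      zero_sub]
  have h4 : ‖∫ x in U, (ρ x⁻¹ v - v) ∂μ‖ ≤ ‖v‖ / 2 * μ.real U := by
    refine norm_setIntegral_le_of_norm_le_const hUc.measure_lt_top fun x hx => ?_
    exact (hC2 hx.1 : _ < _).le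
  rw [h3, norm_neg, norm_smul, Real.norm_of_nonneg hU0.le] at h4
  nlinarith

end RepInt

/-! ### Functions whose convolution operators are bounded from `L²` to bounded functions -/

/-- Cauchy–Schwarz with a weight `w`. -/
theorem sq_lintegral_mul_le {X : Type*} [MeasurableSpace X] {m : Measure X} {w u : X → ℝ≥0∞}
    (hw : AEMeasurable w m) (hu : AEMeasurable u m) :
    (∫⁻ x, w x * u x ∂m) ^ 2 ≤ (∫⁻ x, w x ∂m) * ∫⁻ x, w x * u x ^ 2 ∂m := by
  have hpq : (2 : ℝ).HolderConjugate 2 := Real.HolderConjugate.two_two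
  have h := ENNReal.lintegral_mul_le_Lp_mul_Lq m hpq (f := fun x => w x ^ (1 / 2 : ℝ))
    (g := fun x => w x ^ (1 / 2 : ℝ) * u x) (hw.pow_const _) ((hw.pow_const _).mul hu)
  have h1 : ∀ c : ℝ≥0∞, c ^ (1 / 2 : ℝ) * c ^ (1 / 2 : ℝ) = c := fun c => by
    rw [← ENNReal.rpow_add_of_nonneg _ _ (by norm_num) (by norm_num)]; norm_num
  have h2 : ∀ c : ℝ≥0∞, c ^ (2 : ℝ) = c * c := fun c => by
    rw [show (2 : ℝ) = ((2 : ℕ) : ℝ) by norm_num, ENNReal.rpow_natCast, pow_two]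
  simp only [Pi.mul_apply, h2] at h
  have e1 : ∀ x, w x ^ (1 / 2 : ℝ) * (w x ^ (1 / 2 : ℝ) * u x) = w x * u x := fun x => by
    rw [← mul_assoc, h1]
  have e2 : ∀ x, w x ^ (1 / 2 : ℝ) * u x * (w x ^ (1 / 2 : ℝ) * u x) = w x * u x ^ 2 := fun x => by
    rw [mul_mul_mul_comm, h1, pow_two]
  simp only [e1, e2, h1] at h
  calc (∫⁻ x, w x * u x ∂m) ^ 2
      ≤ ((∫⁻ x, w x ∂m) ^ (1 / 2 : ℝ) * (∫⁻ x, w x * u x ^ 2 ∂m) ^ (1 / 2 : ℝ)) ^ 2 := by gcongr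
    _ = _ := by rw [pow_two, mul_mul_mul_comm, h1, h1]

theorem ennreal_add_sq_le (A B : ℝ≥0∞) : (A + B) ^ 2 ≤ 2 * (A ^ 2 + B ^ 2) := by
  rcases eq_or_ne A ⊤ with rfl | hA
  · simp
  rcases eq_or_ne B ⊤ with rfl | hB
  · simp
  lift A to NNReal using hA
  lift B to NNReal using hB
  exact_mod_cast add_sq_le (a := A) (b := B)

section SupBounded

variable {G : Type u} [Group G] [TopologicalSpace G] [IsTopologicalGroup G]
  [LocallyCompactSpace G] [SecondCountableTopology G] [MeasurableSpace G] [BorelSpace G]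
  {Γ : Subgroup G} [DiscreteTopology Γ] {μ : Measure G} [μ.IsHaarMeasure]

theorem lintegral_inv_mul [μ.IsInvInvariant] (x : G) (p : G → G → ℝ≥0∞) :
    ∫⁻ y, p (y⁻¹ * x) y ∂μ = ∫⁻ z, p z (x * z⁻¹) ∂μ := by
  rw [← lintegral_mul_left_eq_self _ x, ← lintegral_inv_eq_self]
  simp

theorem integral_inv_mul {E : Type*} [NormedAddCommGroup E] [NormedSpace ℝ E] [μ.IsInvInvariant]
    (x : G) (p : G → G → E) :
    ∫ y, p (y⁻¹ * x) y ∂μ = ∫ z, p z (x * z⁻¹) ∂μ := by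
  rw [← integral_mul_left_eq_self _ x, ← integral_inv_eq_self]
  simp

variable (Γ μ) in
/-- The measurable functions `a` for which `u ↦ u * |a|` maps the `Γ`-invariant functions `u` with
`∫_{Γ\G} u² < ∞` boundedly to bounded functions, uniformly at every point. -/
def IsSupBounded (a : G → ℂ) : Prop :=
  Measurable a ∧ ∃ M : NNReal, ∀ (x : G) (u : G → ℝ≥0∞), AEMeasurable u μ →
    (∀ γ : Γ, ∀ᵐ y ∂μ, u ((γ : G) * y) = u y) →
      (∫⁻ y, ‖a (y⁻¹ * x)‖ₑ * u y ∂μ) ^ 2 ≤ M * ∫⁻ y in fundDomain Γ μ, u y ^ 2 ∂μ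

theorem IsSupBounded.zero : IsSupBounded Γ μ 0 :=
  ⟨measurable_zero, 0, fun x u _ _ => by simp⟩

theorem IsSupBounded.smul {a : G → ℂ} (ha : IsSupBounded Γ μ a) (c : ℂ) :
    IsSupBounded Γ μ (c • a) := by
  obtain ⟨hm, M, hM⟩ := ha
  refine ⟨hm.const_smul c, ‖c‖₊ ^ 2 * M, fun x u hu hu' => ?_⟩
  have h1 : ∫⁻ y, ‖(c • a) (y⁻¹ * x)‖ₑ * u y ∂μ = ‖c‖ₑ * ∫⁻ y, ‖a (y⁻¹ * x)‖ₑ * u y ∂μ := by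
    rw [← lintegral_const_mul' _ _ enorm_ne_top]
    simp [enorm_mul, mul_assoc]
  rw [h1, mul_pow, ENNReal.coe_mul, ENNReal.coe_pow, mul_assoc]
  exact mul_le_mul_right (hM x u hu hu') _

theorem IsSupBounded.add {a b : G → ℂ} (ha : IsSupBounded Γ μ a) (hb : IsSupBounded Γ μ b) :
    IsSupBounded Γ μ (a + b) := by
  obtain ⟨hm, M, hM⟩ := ha
  obtain ⟨hn, N, hN⟩ := hb
  refine ⟨hm.add hn, 2 * (M + N), fun x u hu hu' => ?_⟩
  have hmul : ∀ c : G → ℂ, Measurable c → AEMeasurable (fun y => ‖c (y⁻¹ * x)‖ₑ * u y) μ :=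
    fun c hc => ((hc.comp (measurable_inv.mul_const x)).enorm.aemeasurable).mul hu
  have h1 : ∫⁻ y, ‖(a + b) (y⁻¹ * x)‖ₑ * u y ∂μ ≤
      (∫⁻ y, ‖a (y⁻¹ * x)‖ₑ * u y ∂μ) + ∫⁻ y, ‖b (y⁻¹ * x)‖ₑ * u y ∂μ := by
    rw [← lintegral_add_left' (hmul a hm)]
    refine lintegral_mono fun y => ?_
    rw [← add_mul]
    gcongr
    exact enorm_add_le _ _
  have h2 := ENNReal.pow_le_pow_left (n := 2) h1
  refine h2.trans ?_
  set A := ∫⁻ y, ‖a (y⁻¹ * x)‖ₑ * u y ∂μ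
  set B := ∫⁻ y, ‖b (y⁻¹ * x)‖ₑ * u y ∂μ
  have h3 : (A + B) ^ 2 ≤ 2 * (A ^ 2 + B ^ 2) := ennreal_add_sq_le A B
  refine h3.trans ?_
  push_cast
  rw [mul_assoc, add_mul]
  gcongr
  · exact hM x u hu hu'
  · exact hN x u hu hu'

variable [T2Space G]

/-- Bounded measurable functions with compact support. -/
def IsBddCompact (E : G → ℂ) : Prop :=
  Measurable E ∧ (∃ c : NNReal, ∀ x, ‖E x‖ₑ ≤ c) ∧ ∃ B : Set G, IsCompact B ∧ ∀ x ∉ B, E x = 0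

theorem IsBddCompact.adjFun {E : G → ℂ} (hE : IsBddCompact E) : IsBddCompact (adjFun E) := by
  obtain ⟨hm, ⟨c, hc⟩, B, hB, h⟩ := hE
  refine ⟨measurable_adjFun hm, ⟨c, fun x => ?_⟩, B⁻¹, hB.inv, fun x hx => ?_⟩
  · rw [EquivTrace.adjFun, RCLike.enorm_conj]
    exact hc _
  · rw [EquivTrace.adjFun, h _ (by simpa using hx), map_zero]

theorem IsBddCompact.exists_enorm_le {E : G → ℂ} (hE : IsBddCompact E) :
    ∃ (c : NNReal) (B : Set G), IsCompact B ∧ ∀ x, ‖E x‖ₑ ≤ c * B.indicator (fun _ => 1) x := by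
  obtain ⟨hm, ⟨c, hc⟩, B, hB, h⟩ := hE
  refine ⟨c, B, hB, fun x => ?_⟩
  by_cases hx : x ∈ B
  · simpa [hx] using hc x
  · simp [h x hx]

theorem IsBddCompact.integrable {E : G → ℂ} (hE : IsBddCompact E) : Integrable E μ := by
  refine ⟨hE.1.aestronglyMeasurable, ?_⟩
  obtain ⟨c, B, hB, h⟩ := hE.exists_enorm_le
  refine lt_of_le_of_lt (lintegral_mono h) ?_
  rw [lintegral_const_mul' _ _ ENNReal.coe_ne_top, lintegral_indicator_const hB.measurableSet]
  exact ENNReal.mul_lt_top ENNReal.coe_lt_top (by simpa using hB.measure_lt_top)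

theorem isBddCompact_indicator {B : Set G} (hB : IsCompact B) :
    IsBddCompact (B.indicator fun _ => (1 : ℂ)) :=
  ⟨measurable_const.indicator hB.measurableSet, ⟨1, fun x => by
    by_cases hx : x ∈ B <;> simp [hx]⟩, B, hB, fun x hx => by simp [hx]⟩

variable [μ.IsMulRightInvariant]

/-- Cauchy–Schwarz over the support `x B⁻¹` of `y ↦ E(y⁻¹ x)`, which meets each `Γ`-orbit in a
bounded number of points. -/
theorem IsBddCompact.isSupBounded (hΓ : IsCocompact Γ) {E : G → ℂ} (hE : IsBddCompact E) :
    IsSupBounded Γ μ E := by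
  obtain ⟨c, B, hB, hc⟩ := hE.exists_enorm_le
  obtain ⟨N, hN⟩ := exists_lintegral_indicator_le (μ := μ) hΓ hB.inv
  obtain ⟨m, hm⟩ : ∃ m : NNReal, μ B⁻¹ = m := ⟨_, (ENNReal.coe_toNNReal
    hB.inv.measure_lt_top.ne).symm⟩
  refine ⟨hE.1, c ^ 2 * (m * N), fun x u hu hu' => ?_⟩
  let w : G → ℝ≥0∞ := fun y => B⁻¹.indicator (fun _ => 1) (x⁻¹ * y)
  have hw : Measurable w :=
    (measurable_const.indicator hB.inv.measurableSet).comp (measurable_const_mul _)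
  have h1 : ∫⁻ y, ‖E (y⁻¹ * x)‖ₑ * u y ∂μ ≤ c * ∫⁻ y, w y * u y ∂μ := by
    rw [← lintegral_const_mul' _ _ ENNReal.coe_ne_top]
    refine lintegral_mono fun y => ?_
    rw [← mul_assoc]
    gcongr
    refine (hc _).trans (le_of_eq ?_)
    have : (y⁻¹ * x ∈ B) ↔ (x⁻¹ * y ∈ B⁻¹) := by simp
    simp only [w]
    by_cases h : y⁻¹ * x ∈ B
    · rw [indicator_of_mem h, indicator_of_mem (this.1 h)]
    · rw [indicator_of_notMem h, indicator_of_notMem fun h' => h (this.2 h')]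
  have h2 : ∫⁻ y, w y ∂μ = m := by
    rw [← hm, ← lintegral_indicator_one hB.inv.measurableSet]
    exact lintegral_mul_left_eq_self (B⁻¹.indicator fun _ => (1 : ℝ≥0∞)) x⁻¹
  calc (∫⁻ y, ‖E (y⁻¹ * x)‖ₑ * u y ∂μ) ^ 2 ≤ (c * ∫⁻ y, w y * u y ∂μ) ^ 2 := by gcongr
    _ = c ^ 2 * (∫⁻ y, w y * u y ∂μ) ^ 2 := mul_pow _ _ _
    _ ≤ c ^ 2 * ((∫⁻ y, w y ∂μ) * ∫⁻ y, w y * u y ^ 2 ∂μ) := by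
        gcongr
        exact sq_lintegral_mul_le hw.aemeasurable hu
    _ ≤ c ^ 2 * (m * (N * ∫⁻ y in fundDomain Γ μ, u y ^ 2 ∂μ)) := by
        rw [h2]
        gcongr
        refine hN x (fun y => u y ^ 2) (hu.pow_const 2) fun γ => ?_
        filter_upwards [hu' γ] with y hy
        rw [hy]
    _ = _ := by push_cast; ring

variable [μ.IsInvInvariant]

/-- The pointwise bound `u * |a * b| ≤ (u * |a|) * |b|`. -/
theorem lintegral_enorm_conv_le {a b : G → ℂ} (ha : Measurable a) (hb : Measurable b) (x : G)
    {u : G → ℝ≥0∞} (hu : AEMeasurable u μ) :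
    ∫⁻ y, ‖conv μ a b (y⁻¹ * x)‖ₑ * u y ∂μ ≤
      ∫⁻ z, ‖b (z⁻¹ * x)‖ₑ * (∫⁻ y, ‖a (y⁻¹ * z)‖ₑ * u y ∂μ) ∂μ := by
  have h1 : ∀ y, ‖conv μ a b (y⁻¹ * x)‖ₑ * u y ≤
      ∫⁻ z, ‖a (y⁻¹ * z)‖ₑ * ‖b (z⁻¹ * x)‖ₑ * u y ∂μ := by
    intro y
    have hm : Measurable fun z => ‖a (y⁻¹ * z)‖ₑ * ‖b (z⁻¹ * x)‖ₑ :=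
      (ha.comp (measurable_const_mul _)).enorm.mul (hb.comp (measurable_inv.mul_const _)).enorm
    rw [lintegral_mul_const _ hm]
    gcongr
    refine (enorm_integral_le_lintegral_enorm _).trans (le_of_eq ?_)
    rw [← lintegral_mul_left_eq_self _ y⁻¹]
    refine lintegral_congr fun z => ?_
    rw [enorm_mul]
    congr 3
    group
  refine (lintegral_mono h1).trans ?_
  rw [lintegral_lintegral_swap]
  · refine lintegral_mono fun z => ?_
    rw [← lintegral_const_mul' _ _ enorm_ne_top]
    refine le_of_eq (lintegral_congr fun y => ?_)
    ring
  · exact ((ha.comp (measurable_fst.inv.mul measurable_snd)).enorm.mul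
      (hb.comp (measurable_snd.inv.mul_const x)).enorm).aemeasurable.mul hu.comp_fst

theorem aemeasurable_lintegral_enorm_mul {a : G → ℂ} (ha : Measurable a)
    {u : G → ℝ≥0∞} (hu : AEMeasurable u μ) :
    AEMeasurable (fun z => ∫⁻ y, ‖a (y⁻¹ * z)‖ₑ * u y ∂μ) μ := by
  refine AEMeasurable.lintegral_prod_right' (f := fun p : G × G => ‖a (p.2⁻¹ * p.1)‖ₑ * u p.2) ?_
  exact (ha.comp (measurable_snd.inv.mul measurable_fst)).enorm.aemeasurable.mul hu.comp_snd

theorem exists_lintegral_enorm_eq {F : G → ℂ} (hF : Integrable F μ) :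
    ∃ m : NNReal, ∫⁻ y, ‖F y‖ₑ ∂μ = m :=
  ⟨_, (ENNReal.coe_toNNReal hF.2.ne).symm⟩

theorem lintegral_enorm_inv_mul (F : G → ℂ) (x : G) :
    ∫⁻ y, ‖F (y⁻¹ * x)‖ₑ ∂μ = ∫⁻ y, ‖F y‖ₑ ∂μ :=
  lintegral_inv_mul x fun z _ => ‖F z‖ₑ

/-- Right convolution with an integrable function preserves bounded functions. -/
theorem IsSupBounded.conv_integrable {a F : G → ℂ} (ha : IsSupBounded Γ μ a) (hFm : Measurable F)
    (hF : Integrable F μ) : IsSupBounded Γ μ (conv μ a F) := by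
  obtain ⟨hm, M, hM⟩ := ha
  obtain ⟨m, hm'⟩ := exists_lintegral_enorm_eq hF
  refine ⟨measurable_conv hm hFm, m * (m * M), fun x u hu hu' => ?_⟩
  set I := ∫⁻ y in fundDomain Γ μ, u y ^ 2 ∂μ
  calc (∫⁻ y, ‖conv μ a F (y⁻¹ * x)‖ₑ * u y ∂μ) ^ 2
      ≤ (∫⁻ z, ‖F (z⁻¹ * x)‖ₑ * (∫⁻ y, ‖a (y⁻¹ * z)‖ₑ * u y ∂μ) ∂μ) ^ 2 :=
        ENNReal.pow_le_pow_left (lintegral_enorm_conv_le hm hFm x hu)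
    _ ≤ (∫⁻ z, ‖F (z⁻¹ * x)‖ₑ ∂μ) *
        ∫⁻ z, ‖F (z⁻¹ * x)‖ₑ * (∫⁻ y, ‖a (y⁻¹ * z)‖ₑ * u y ∂μ) ^ 2 ∂μ :=
        sq_lintegral_mul_le (hFm.comp (measurable_inv.mul_const x)).enorm.aemeasurable
          (aemeasurable_lintegral_enorm_mul hm hu)
    _ ≤ (∫⁻ z, ‖F (z⁻¹ * x)‖ₑ ∂μ) * ∫⁻ z, ‖F (z⁻¹ * x)‖ₑ * (M * I) ∂μ := by
        gcongr with z
        exact hM z u hu hu'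
    _ = _ := by
        have hm2 : Measurable fun z => ‖F (z⁻¹ * x)‖ₑ :=
          (hFm.comp (measurable_inv.mul_const x)).enorm
        rw [lintegral_mul_const _ hm2, lintegral_enorm_inv_mul, hm']
        push_cast; ring

/-- Right convolution with an integrable function is bounded for the `L²` norm on `Γ\G`. -/
theorem lintegral_sq_conv_le {F : G → ℂ} (hFm : Measurable F) {u : G → ℝ≥0∞}
    (hu : AEMeasurable u μ) (hu' : ∀ γ : Γ, ∀ᵐ y ∂μ, u ((γ : G) * y) = u y) :
    ∫⁻ z in fundDomain Γ μ, (∫⁻ y, ‖F (y⁻¹ * z)‖ₑ * u y ∂μ) ^ 2 ∂μ ≤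
      (∫⁻ y, ‖F y‖ₑ ∂μ) ^ 2 * ∫⁻ y in fundDomain Γ μ, u y ^ 2 ∂μ := by
  have h1 : ∀ z, (∫⁻ y, ‖F (y⁻¹ * z)‖ₑ * u y ∂μ) ^ 2 ≤
      (∫⁻ y, ‖F y‖ₑ ∂μ) * ∫⁻ w, ‖F w‖ₑ * u (z * w⁻¹) ^ 2 ∂μ := by
    intro z
    refine (sq_lintegral_mul_le (hFm.comp (measurable_inv.mul_const z)).enorm.aemeasurable
      hu).trans (le_of_eq ?_)
    congr 1
    · exact lintegral_enorm_inv_mul F z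
    · exact lintegral_inv_mul z fun w y => ‖F w‖ₑ * u y ^ 2
  refine (lintegral_mono h1).trans ?_
  have hq : Measure.QuasiMeasurePreserving (fun p : G × G => p.1 * p.2⁻¹)
      ((μ.restrict (fundDomain Γ μ)).prod μ) μ := by
    have h := quasiMeasurePreserving_div (μ := μ) (ν := μ) (G := G)
    simp only [div_eq_mul_inv] at h
    exact h.mono_left (Measure.AbsolutelyContinuous.prod
      Measure.restrict_le_self.absolutelyContinuous (Measure.AbsolutelyContinuous.refl μ))
  have hm2 : AEMeasurable (fun p : G × G => ‖F p.2‖ₑ * u (p.1 * p.2⁻¹) ^ 2)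
      ((μ.restrict (fundDomain Γ μ)).prod μ) :=
    (hFm.comp measurable_snd).enorm.aemeasurable.mul
      ((hu.comp_quasiMeasurePreserving hq).pow_const 2)
  rw [lintegral_const_mul'' _ hm2.lintegral_prod_right', lintegral_lintegral_swap hm2]
  have h2 : ∀ w, ∫⁻ z in fundDomain Γ μ, ‖F w‖ₑ * u (z * w⁻¹) ^ 2 ∂μ =
      ‖F w‖ₑ * ∫⁻ y in fundDomain Γ μ, u y ^ 2 ∂μ := by
    intro w
    rw [lintegral_const_mul' _ _ enorm_ne_top]
    congr 1
    refine setLIntegral_mul_right (u := fun y => u y ^ 2) (fun γ => ?_) w⁻¹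
    filter_upwards [hu' γ] with y hy
    rw [hy]
  simp only [h2]
  rw [lintegral_mul_const _ hFm.enorm, ← mul_assoc, pow_two]

/-- Right convolution with an integrable function preserves `L²(Γ\G)`. -/
theorem IsSupBounded.integrable_conv {a F : G → ℂ} (ha : IsSupBounded Γ μ a) (hFm : Measurable F)
    (hF : Integrable F μ) : IsSupBounded Γ μ (conv μ F a) := by
  obtain ⟨hm, M, hM⟩ := ha
  obtain ⟨m, hm'⟩ := exists_lintegral_enorm_eq hF
  refine ⟨measurable_conv hFm hm, M * m ^ 2, fun x u hu hu' => ?_⟩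
  calc (∫⁻ y, ‖conv μ F a (y⁻¹ * x)‖ₑ * u y ∂μ) ^ 2
      ≤ (∫⁻ z, ‖a (z⁻¹ * x)‖ₑ * (∫⁻ y, ‖F (y⁻¹ * z)‖ₑ * u y ∂μ) ∂μ) ^ 2 :=
        ENNReal.pow_le_pow_left (lintegral_enorm_conv_le hFm hm x hu)
    _ ≤ M * ∫⁻ z in fundDomain Γ μ, (∫⁻ y, ‖F (y⁻¹ * z)‖ₑ * u y ∂μ) ^ 2 ∂μ := by
        refine hM x _ (aemeasurable_lintegral_enorm_mul hFm hu) fun γ =>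
          Eventually.of_forall fun z => ?_
        rw [← lintegral_mul_left_eq_self _ (γ : G)]
        refine lintegral_congr_ae ?_
        filter_upwards [hu' γ] with y hy
        rw [hy]
        congr 3
        group
    _ ≤ M * ((∫⁻ y, ‖F y‖ₑ ∂μ) ^ 2 * ∫⁻ y in fundDomain Γ μ, u y ^ 2 ∂μ) := by
        gcongr
        exact lintegral_sq_conv_le hFm hu hu'
    _ = _ := by rw [hm']; push_cast; ring

end SupBounded

/-! ### Convolution operators on `L²(Γ\G, ψ)` -/

section BesselBound

variable {H W : Type*} [NormedAddCommGroup H] [InnerProductSpace ℂ H] [CompleteSpace H]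
  [NormedAddCommGroup W] [InnerProductSpace ℂ W] [CompleteSpace W]

/-- Bessel's inequality for an operator with values in a finite dimensional space. -/
theorem sum_norm_sq_le_of_orthonormal {κ : Type*} [Fintype κ] (w : OrthonormalBasis κ ℂ W)
    (ℓ : H →L[ℂ] W) {c : ℝ} (hc : ‖ℓ‖ ≤ c) {ι : Type*} {e : ι → H} (he : Orthonormal ℂ e)
    (s : Finset ι) : ∑ i ∈ s, ‖ℓ (e i)‖ ^ 2 ≤ Fintype.card κ * c ^ 2 := by
  have h1 : ∀ i, ‖ℓ (e i)‖ ^ 2 = ∑ j, ‖inner ℂ (e i) (adjoint ℓ (w j))‖ ^ 2 := by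
    intro i
    rw [← w.sum_sq_norm_inner_right]
    refine Finset.sum_congr rfl fun j _ => ?_
    rw [adjoint_inner_right, ← inner_conj_symm, RCLike.norm_conj]
  simp only [h1]
  rw [Finset.sum_comm]
  have h2 : ∀ j, ∑ i ∈ s, ‖inner ℂ (e i) (adjoint ℓ (w j))‖ ^ 2 ≤ c ^ 2 := by
    intro j
    refine (he.sum_inner_products_le _).trans ?_
    gcongr
    refine ((adjoint ℓ).le_opNorm _).trans ?_
    rw [w.orthonormal.1 j, mul_one, LinearIsometryEquiv.norm_map]
    exact hc
  refine (Finset.sum_le_sum fun j _ => h2 j).trans (le_of_eq ?_)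
  simp

end BesselBound

section Eval

variable {G W : Type u} [Group G] [TopologicalSpace G] [IsTopologicalGroup G]
  [LocallyCompactSpace G] [T2Space G] [SecondCountableTopology G] [MeasurableSpace G]
  [BorelSpace G] [NormedAddCommGroup W] [InnerProductSpace ℂ W] [CompleteSpace W]
  {Γ : Subgroup G} [DiscreteTopology Γ] {μ : Measure G} [μ.IsHaarMeasure]
  [μ.IsMulRightInvariant] [μ.IsInvInvariant] {ψ : Γ →* (W ≃ₗᵢ[ℂ] W)} {a : G → ℂ}

theorem IsSupBounded.exists_bound (ha : IsSupBounded Γ μ a) : ∃ M : NNReal,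
    ∀ (x : G) (s : L2 μ ψ), ∫⁻ y, ‖a (y⁻¹ * x) • s y‖ₑ ∂μ ≤ M * ‖s‖ₑ := by
  obtain ⟨hm, M, hM⟩ := ha
  refine ⟨NNReal.sqrt M, fun x s => ?_⟩
  have h := hM x (fun y => ‖s y‖ₑ) (L2.aestronglyMeasurable s).enorm fun γ => L2.enorm_map s γ
  rw [← L2.enorm_sq] at h
  simp only [enorm_smul]
  have h2 : (M : ℝ≥0∞) * ‖s‖ₑ ^ 2 = ((NNReal.sqrt M : NNReal) * ‖s‖ₑ) ^ 2 := by
    rw [mul_pow, ← ENNReal.coe_pow, NNReal.sq_sqrt]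
  rw [h2] at h
  exact (ENNReal.pow_right_strictMono two_ne_zero).le_iff_le.1 h

theorem IsSupBounded.aestronglyMeasurable_smul (ha : IsSupBounded Γ μ a) (x : G) (s : L2 μ ψ) :
    AEStronglyMeasurable (fun y => a (y⁻¹ * x) • s y) μ :=
  (ha.1.comp (measurable_inv.mul_const x)).aestronglyMeasurable.smul (L2.aestronglyMeasurable s)

theorem IsSupBounded.integrable_smul (ha : IsSupBounded Γ μ a) (x : G) (s : L2 μ ψ) :
    Integrable (fun y => a (y⁻¹ * x) • s y) μ := by
  obtain ⟨M, hM⟩ := ha.exists_bound (ψ := ψ)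
  exact ⟨ha.aestronglyMeasurable_smul x s,
    (hM x s).trans_lt (ENNReal.mul_lt_top ENNReal.coe_lt_top enorm_lt_top)⟩

/-- A uniform bound for the norms of the functionals `s ↦ ∫ a(y⁻¹ x) s(y) dy`. -/
def IsSupBounded.bound (ha : IsSupBounded Γ μ a) (ψ : Γ →* (W ≃ₗᵢ[ℂ] W)) : NNReal :=
  (ha.exists_bound (ψ := ψ)).choose

theorem IsSupBounded.norm_integral_le (ha : IsSupBounded Γ μ a) (x : G) (s : L2 μ ψ) :
    ‖∫ y, a (y⁻¹ * x) • s y ∂μ‖ ≤ ha.bound ψ * ‖s‖ := by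
  have h := (enorm_integral_le_lintegral_enorm (μ := μ) fun y => a (y⁻¹ * x) • s y).trans
    ((ha.exists_bound (ψ := ψ)).choose_spec x s)
  have h1 := ENNReal.toReal_mono (ENNReal.mul_ne_top ENNReal.coe_ne_top enorm_ne_top) h
  simpa [IsSupBounded.bound] using h1

variable (ψ) in
/-- The value at `x` of `s * a`, as a function of `s`. -/
def L2.eval (ha : IsSupBounded Γ μ a) (x : G) : L2 μ ψ →L[ℂ] W :=
  LinearMap.mkContinuous
    { toFun := fun s => ∫ y, a (y⁻¹ * x) • s y ∂μ
      map_add' := fun s t => by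
        rw [← integral_add (ha.integrable_smul x s) (ha.integrable_smul x t)]
        refine integral_congr_ae ?_
        filter_upwards [L2.coe_add s t] with y hy
        rw [hy, smul_add]
      map_smul' := fun c s => by
        rw [RingHom.id_apply, ← integral_smul]
        refine integral_congr_ae ?_
        filter_upwards [L2.coe_smul c s] with y hy
        rw [hy, smul_comm] }
    (ha.bound ψ) (ha.norm_integral_le x)

theorem L2.eval_apply (ha : IsSupBounded Γ μ a) (x : G) (s : L2 μ ψ) :
    L2.eval ψ ha x s = ∫ y, a (y⁻¹ * x) • s y ∂μ := rfl

theorem L2.norm_eval_le (ha : IsSupBounded Γ μ a) (x : G) : ‖L2.eval ψ ha x‖ ≤ ha.bound ψ :=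
  LinearMap.mkContinuous_norm_le _ NNReal.zero_le_coe _

theorem L2.eval_mul (ha : IsSupBounded Γ μ a) (γ : Γ) (x : G) (s : L2 μ ψ) :
    L2.eval ψ ha ((γ : G) * x) s = ψ γ (L2.eval ψ ha x s) := by
  rw [L2.eval_apply, L2.eval_apply, ← integral_mul_left_eq_self _ (γ : G)]
  refine Eq.trans ?_ ((ψ γ).toContinuousLinearEquiv.integral_comp_comm _)
  refine integral_congr_ae ?_
  filter_upwards [s.2.1 γ] with y hy
  rw [hy, mul_inv_rev, mul_assoc, inv_mul_cancel_left]
  exact (map_smul (ψ γ) _ _).symm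

theorem L2.aestronglyMeasurable_eval (ha : IsSupBounded Γ μ a) (s : L2 μ ψ) :
    AEStronglyMeasurable (fun x => L2.eval ψ ha x s) μ := by
  refine AEStronglyMeasurable.integral_prod_right'
    (f := fun p : G × G => a (p.2⁻¹ * p.1) • s p.2) ?_
  exact (ha.1.comp (measurable_snd.inv.mul measurable_fst)).aestronglyMeasurable.smul
    (L2.aestronglyMeasurable s).comp_snd

theorem L2.norm_eval_apply_le (ha : IsSupBounded Γ μ a) (x : G) (s : L2 μ ψ) :
    ‖L2.eval ψ ha x s‖ ≤ ha.bound ψ * ‖s‖ := ha.norm_integral_le x s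

/-- A bounded measurable equivariant function, as an element of `L²(Γ\G, ψ)`. -/
def L2.ofBounded (hΓ : IsCocompact Γ) (q : G → W) (hq : AEStronglyMeasurable q μ)
    (hψ : ∀ γ : Γ, ∀ᵐ x ∂μ, q ((γ : G) * x) = ψ γ (q x)) {c : ℝ} (hc : ∀ x, ‖q x‖ ≤ c) :
    L2 μ ψ :=
  ⟨AEEqFun.mk q hq, by
    have h0 : ∀ᵐ x ∂μ, AEEqFun.mk q hq x = q x := AEEqFun.coeFn_mk q hq
    refine ⟨fun γ => ?_, ?_⟩
    · filter_upwards [h0, ae_mul_left (γ : G) h0, hψ γ] with x h1 h2 h3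
      rw [h1, h2, h3]
    · have : IsFiniteMeasure (μ.restrict (fundDomain Γ μ)) :=
        ⟨by simpa using measure_fundDomain_lt_top hΓ⟩
      exact (memLp_congr_ae (ae_restrict_of_ae h0)).2
        (MemLp.of_bound hq.restrict c (Eventually.of_forall hc))⟩

theorem L2.coe_ofBounded (hΓ : IsCocompact Γ) (q : G → W) (hq : AEStronglyMeasurable q μ)
    (hψ : ∀ γ : Γ, ∀ᵐ x ∂μ, q ((γ : G) * x) = ψ γ (q x)) {c : ℝ} (hc : ∀ x, ‖q x‖ ≤ c) :
    ∀ᵐ x ∂μ, L2.ofBounded hΓ q hq hψ hc x = q x := AEEqFun.coeFn_mk q hq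

variable (ψ) in
/-- The operator `s ↦ s * a` on `L²(Γ\G, ψ)`, as an integral of right translations. -/
def L2.convOp (hΓ : IsCocompact Γ) (ha : Integrable a μ) : L2 μ ψ →L[ℂ] L2 μ ψ :=
  repInt (L2.continuous_right (ψ := ψ) hΓ) ha

/-- The operator obtained by integrating right translations is given almost everywhere by the
convolution integral, as one sees by pairing both with a section `t`. -/
theorem L2.coe_convOp (hΓ : IsCocompact Γ) (ha : Integrable a μ) (ha' : IsSupBounded Γ μ a)
    (s : L2 μ ψ) : ∀ᵐ x ∂μ, L2.convOp ψ hΓ ha s x = L2.eval ψ ha' x s := by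
  let q : L2 μ ψ := L2.ofBounded hΓ (fun x => L2.eval ψ ha' x s)
    (L2.aestronglyMeasurable_eval ha' s) (fun γ => Eventually.of_forall fun x =>
      L2.eval_mul ha' γ x s) (fun x => L2.norm_eval_apply_le ha' x s)
  have hq : ∀ᵐ x ∂μ, q x = L2.eval ψ ha' x s := L2.coe_ofBounded ..
  suffices h : L2.convOp ψ hΓ ha s = q by rw [h]; exact hq
  refine ext_inner_left ℂ fun t => ?_
  set F := fundDomain Γ μ
  have : IsFiniteMeasure (μ.restrict F) := ⟨by simpa using measure_fundDomain_lt_top hΓ⟩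
  have hqm : Measure.QuasiMeasurePreserving (fun p : G × G => p.1 * p.2⁻¹)
      ((μ.restrict F).prod μ) μ := by
    have h := quasiMeasurePreserving_div (μ := μ) (ν := μ) (G := G)
    simp only [div_eq_mul_inv] at h
    exact h.mono_left (Measure.AbsolutelyContinuous.prod
      Measure.restrict_le_self.absolutelyContinuous (Measure.AbsolutelyContinuous.refl μ))
  have hmeas : AEStronglyMeasurable (fun p : G × G => a p.2 • inner ℂ (t p.1) (s (p.1 * p.2⁻¹)))
      ((μ.restrict F).prod μ) :=
    (ha'.1.comp measurable_snd).aestronglyMeasurable.smul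
      ((L2.aestronglyMeasurable t).restrict.comp_fst.inner
        ((L2.aestronglyMeasurable s).comp_quasiMeasurePreserving hqm))
  have hsub : ∀ x, ∫⁻ z, ‖a z • s (x * z⁻¹)‖ₑ ∂μ ≤ ha'.bound ψ * ‖s‖ₑ := by
    intro x
    rw [← lintegral_inv_mul x fun z y => ‖a z • s y‖ₑ]
    exact (ha'.exists_bound (ψ := ψ)).choose_spec x s
  have hint : Integrable (fun p : G × G => a p.2 • inner ℂ (t p.1) (s (p.1 * p.2⁻¹)))
      ((μ.restrict F).prod μ) := by
    refine ⟨hmeas, ?_⟩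
    rw [HasFiniteIntegral, lintegral_prod _ hmeas.enorm]
    have h1 : ∀ x, ∫⁻ z, ‖a z • inner ℂ (t x) (s (x * z⁻¹))‖ₑ ∂μ ≤
        ‖t x‖ₑ * (ha'.bound ψ * ‖s‖ₑ) := by
      intro x
      refine le_trans ?_ (mul_le_mul_right (hsub x) _)
      rw [← lintegral_const_mul' _ _ enorm_ne_top]
      refine lintegral_mono fun z => ?_
      rw [enorm_smul, enorm_smul, mul_left_comm]
      gcongr
      simp only [← ofReal_norm]
      rw [← ENNReal.ofReal_mul (norm_nonneg _)]
      exact ENNReal.ofReal_le_ofReal (norm_inner_le_norm _ _)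
    refine (lintegral_mono h1).trans_lt ?_
    rw [lintegral_mul_const'' _ (L2.aestronglyMeasurable t).restrict.enorm]
    refine ENNReal.mul_lt_top ?_ (ENNReal.mul_lt_top ENNReal.coe_lt_top enorm_lt_top)
    exact (t.2.2.integrable one_le_two).2
  have h1 : inner ℂ t (L2.convOp ψ hΓ ha s) =
      ∫ z, ∫ x in F, a z • inner ℂ (t x) (s (x * z⁻¹)) ∂μ ∂μ := by
    have h2 := integral_inner (𝕜 := ℂ) (integrable_smul_rep (L2.continuous_right (ψ := ψ) hΓ) ha s)
      t
    rw [L2.convOp, repInt_apply, ← h2]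
    refine integral_congr_ae (Eventually.of_forall fun z => ?_)
    change inner ℂ t (a z • L2.right z⁻¹ s) = _
    rw [inner_smul_right, L2.inner_eq, ← smul_eq_mul, ← integral_smul]
    refine integral_congr_ae (ae_restrict_of_ae ?_)
    filter_upwards [L2.coe_right z⁻¹ s] with x hx
    rw [hx]
  rw [h1, ← integral_integral_swap (f := fun x z => a z • inner ℂ (t x) (s (x * z⁻¹))) hint,
    L2.inner_eq]
  refine integral_congr_ae (ae_restrict_of_ae ?_)
  filter_upwards [hq] with x hx
  have h3 : Integrable (fun z => a z • s (x * z⁻¹)) μ := by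
    refine ⟨?_, (hsub x).trans_lt (ENNReal.mul_lt_top ENNReal.coe_lt_top enorm_lt_top)⟩
    refine ha'.1.aestronglyMeasurable.smul
      ((L2.aestronglyMeasurable s).comp_quasiMeasurePreserving ?_)
    have h := quasiMeasurePreserving_div_left (μ := μ) x
    simpa only [div_eq_mul_inv] using h
  rw [hx, L2.eval_apply, integral_inv_mul x fun z y => a z • s y, ← integral_inner h3]
  refine integral_congr_ae (Eventually.of_forall fun z => ?_)
  simp only [inner_smul_right, smul_eq_mul]

theorem L2.norm_sq_eq (s : L2 μ ψ) : ‖s‖ ^ 2 = ∫ x in fundDomain Γ μ, ‖s x‖ ^ 2 ∂μ := by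
  have h3 := L2.inner_eq s s
  rw [inner_self_eq_norm_sq_to_K] at h3
  simp only [inner_self_eq_norm_sq_to_K] at h3
  have h4 := integral_ofReal (𝕜 := ℂ) (μ := μ.restrict (fundDomain Γ μ))
    (f := fun x => ‖s x‖ ^ 2)
  push_cast at h4 h3
  erw [h4] at h3
  exact_mod_cast h3

/-- An operator into `L²(Γ\G, ψ)` with bounded point evaluations is Hilbert–Schmidt: integrate
Bessel's inequality for the evaluation at `x` over the fundamental domain, which has finite
measure. -/
theorem isHS_of_eval [FiniteDimensional ℂ W] (hΓ : IsCocompact Γ) {H : Type*}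
    [NormedAddCommGroup H] [InnerProductSpace ℂ H] [CompleteSpace H] {T : H →L[ℂ] L2 μ ψ}
    {ℓ : G → H →L[ℂ] W} {c : ℝ} (hc : ∀ x, ‖ℓ x‖ ≤ c)
    (hT : ∀ s, ∀ᵐ x ∂μ, T s x = ℓ x s) : IsHS T := by
  have : IsFiniteMeasure (μ.restrict (fundDomain Γ μ)) :=
    ⟨by simpa using measure_fundDomain_lt_top hΓ⟩
  let w := stdOrthonormalBasis ℂ W
  refine ⟨∫ x in fundDomain Γ μ, (Fintype.card (Fin (Module.finrank ℂ W)) * c ^ 2) ∂μ,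
    fun s hs => ?_⟩
  have h1 : ∀ v, IntegrableOn (fun x => ‖T v x‖ ^ 2) (fundDomain Γ μ) μ := fun v =>
    (memLp_two_iff_integrable_sq_norm (T v).2.2.1).1 (T v).2.2
  have h2 : ∀ v, ‖T v‖ ^ 2 = ∫ x in fundDomain Γ μ, ‖T v x‖ ^ 2 ∂μ := fun v => L2.norm_sq_eq _
  simp only [h2]
  rw [← integral_finsetSum _ fun v _ => h1 v]
  refine integral_mono_ae (integrable_finsetSum _ fun v _ => h1 v) (integrable_const _) ?_
  refine ae_restrict_of_ae ?_
  have h5 : ∀ᵐ x ∂μ, ∀ v : s, T v x = ℓ x v := ae_all_iff.2 fun v => hT v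
  filter_upwards [h5] with x hx
  have h6 := sum_norm_sq_le_of_orthonormal w (ℓ x) (hc x) hs Finset.univ
  rw [Finset.univ_eq_attach] at h6
  refine le_trans (le_of_eq ?_) h6
  rw [← Finset.sum_attach]
  exact Finset.sum_congr rfl fun v _ => by rw [hx v]

theorem L2.isHS_convOp [FiniteDimensional ℂ W] (hΓ : IsCocompact Γ) (ha : Integrable a μ)
    (ha' : IsSupBounded Γ μ a) : IsHS (L2.convOp ψ hΓ ha) :=
  isHS_of_eval hΓ (L2.norm_eval_le ha') (L2.coe_convOp hΓ ha ha')

end Eval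

/-! ### The trace of `g^* (· * f)` as an integral over a fundamental domain -/

section Parseval

variable {H W : Type*} [NormedAddCommGroup H] [InnerProductSpace ℂ H] [CompleteSpace H]
  [NormedAddCommGroup W] [InnerProductSpace ℂ W] [CompleteSpace W]

/-- Parseval's identity for two operators with values in a finite dimensional space. -/
theorem hasSum_inner_apply {ι κ : Type*} [Fintype κ] (b : HilbertBasis ι ℂ H)
    (w : OrthonormalBasis κ ℂ W) (ℓ m : H →L[ℂ] W) :
    HasSum (fun i => inner ℂ (ℓ (b i)) (m (b i)))
      (∑ j, inner ℂ (ℓ (adjoint m (w j))) (w j)) := by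
  have h1 : ∀ i, inner ℂ (ℓ (b i)) (m (b i)) =
      ∑ j, inner ℂ (adjoint m (w j)) (b i) * inner ℂ (b i) (adjoint ℓ (w j)) := by
    intro i
    rw [← w.sum_inner_mul_inner]
    refine Finset.sum_congr rfl fun j _ => ?_
    rw [adjoint_inner_right, adjoint_inner_left, mul_comm]
  simp only [h1]
  refine hasSum_sum fun j _ => ?_
  rw [← adjoint_inner_right]
  exact b.hasSum_inner_mul_inner _ _

/-- The balls of radius `1 / 2` around orthonormal vectors are disjoint. -/
theorem exists_countable_hilbertBasis (H : Type u) [NormedAddCommGroup H] [InnerProductSpace ℂ H]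
    [CompleteSpace H] [SecondCountableTopology H] :
    ∃ (ι : Type u) (_ : Countable ι), Nonempty (HilbertBasis ι ℂ H) := by
  obtain ⟨w, b, hb⟩ := exists_hilbertBasis ℂ H
  refine ⟨w, ?_, ⟨b⟩⟩
  have h : Pairwise (Function.onFun Disjoint fun i : w => Metric.ball (b i) (1 / 2)) := by
    intro i j hij
    refine Metric.ball_disjoint_ball ?_
    rw [dist_eq_norm]
    have h1 : ‖b i - b j‖ * ‖b i - b j‖ = 2 := by
      rw [norm_sub_mul_self (𝕜 := ℂ), b.orthonormal.2 hij, b.orthonormal.1, b.orthonormal.1]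
      norm_num
    nlinarith [norm_nonneg (b i - b j)]
  exact Pairwise.countable_of_isOpen_disjoint h (fun i => Metric.isOpen_ball)
    fun i => ⟨b i, Metric.mem_ball_self (by norm_num)⟩

end Parseval

section Trace

variable {G W : Type u} [Group G] [TopologicalSpace G] [IsTopologicalGroup G]
  [LocallyCompactSpace G] [T2Space G] [SecondCountableTopology G] [MeasurableSpace G]
  [BorelSpace G] [NormedAddCommGroup W] [InnerProductSpace ℂ W] [CompleteSpace W]
  {Γ : Subgroup G} [DiscreteTopology Γ] {μ : Measure G} [μ.IsHaarMeasure]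
  [μ.IsMulRightInvariant] [μ.IsInvInvariant] {ψ : Γ →* (W ≃ₗᵢ[ℂ] W)} {F E : G → ℂ}

theorem IsBddCompact.exists_tsum_enorm_le (hΓ : IsCocompact Γ) (hE : IsBddCompact E) :
    ∃ M : NNReal, ∀ z y : G, ∑' γ : Γ, ‖E (z⁻¹ * γ * y)‖ₑ ≤ M := by
  obtain ⟨c, B, hB, hc⟩ := hE.exists_enorm_le
  obtain ⟨N, hN⟩ := exists_tsum_indicator_le hΓ hB
  refine ⟨c * N, fun z y => (ENNReal.tsum_le_tsum fun γ => hc _).trans ?_⟩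
  rw [ENNReal.tsum_mul_left]
  push_cast
  gcongr
  exact hN z y

/-- The kernel `∑ conj E(z⁻¹ γ y) ψ(γ) w` which represents `s ↦ ⟨w, (s * E)(y)⟩`. -/
def kerFun (ψ : Γ →* (W ≃ₗᵢ[ℂ] W)) (E : G → ℂ) (y : G) (w : W) (z : G) : W :=
  ∑' γ : Γ, (starRingEnd ℂ) (E (z⁻¹ * γ * y)) • ψ γ w

theorem enorm_kerFun_term (y : G) (w : W) (z : G) (γ : Γ) :
    ‖(starRingEnd ℂ) (E (z⁻¹ * γ * y)) • ψ γ w‖ₑ = ‖E (z⁻¹ * γ * y)‖ₑ * ‖w‖ₑ := by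
  rw [enorm_smul, RCLike.enorm_conj, LinearIsometryEquiv.enorm_map]

theorem summable_kerFun (hΓ : IsCocompact Γ) (hE : IsBddCompact E) (y : G) (w : W) (z : G) :
    Summable fun γ : Γ => (starRingEnd ℂ) (E (z⁻¹ * γ * y)) • ψ γ w := by
  obtain ⟨M, hM⟩ := hE.exists_tsum_enorm_le hΓ
  refine Summable.of_enorm ?_
  simp only [enorm_kerFun_term, ENNReal.tsum_mul_right]
  exact ENNReal.mul_ne_top (ne_top_of_le_ne_top ENNReal.coe_ne_top (hM z y)) enorm_ne_top

theorem aestronglyMeasurable_kerFun_term (hE : IsBddCompact E) (y : G) (w : W) (γ : Γ) :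
    AEStronglyMeasurable (fun z => (starRingEnd ℂ) (E (z⁻¹ * γ * y)) • ψ γ w) μ := by
  have h : Measurable fun z => (starRingEnd ℂ) (E (z⁻¹ * γ * y)) :=
    (Complex.continuous_conj.measurable).comp (hE.1.comp ((measurable_inv.mul_const _).mul_const _))
  exact h.aestronglyMeasurable.smul_const _

theorem aestronglyMeasurable_kerFun (hΓ : IsCocompact Γ) (hE : IsBddCompact E) (y : G) (w : W) :
    AEStronglyMeasurable (kerFun ψ E y w) μ := by
  refine aestronglyMeasurable_of_tendsto_ae (u := atTop (α := Finset Γ))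
    (f := fun s z => ∑ γ ∈ s, (starRingEnd ℂ) (E (z⁻¹ * γ * y)) • ψ γ w) (fun s => ?_)
    (Eventually.of_forall fun z => (summable_kerFun hΓ hE y w z).hasSum)
  exact Finset.aestronglyMeasurable_fun_sum s fun γ _ => aestronglyMeasurable_kerFun_term hE y w γ

theorem exists_norm_kerFun_le (hΓ : IsCocompact Γ) (hE : IsBddCompact E) (y : G) (w : W) :
    ∃ c : ℝ, ∀ z, ‖kerFun ψ E y w z‖ ≤ c := by
  obtain ⟨M, hM⟩ := hE.exists_tsum_enorm_le hΓ
  refine ⟨M * ‖w‖, fun z => ?_⟩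
  have h : ‖kerFun ψ E y w z‖ₑ ≤ M * ‖w‖ₑ := by
    refine enorm_tsum_le_tsum_enorm.trans ?_
    simp only [enorm_kerFun_term, ENNReal.tsum_mul_right]
    gcongr
    exact hM z y
  simpa using ENNReal.toReal_mono (ENNReal.mul_ne_top ENNReal.coe_ne_top enorm_ne_top) h

theorem kerFun_mul (η : Γ) (y : G) (w : W) (z : G) :
    kerFun ψ E y w ((η : G) * z) = ψ η (kerFun ψ E y w z) := by
  rw [kerFun, kerFun, ← (Equiv.mulLeft η).tsum_eq]
  refine Eq.trans (tsum_congr fun γ => ?_) ((ψ η).toContinuousLinearEquiv.map_tsum).symm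
  refine Eq.trans ?_ (map_smul (ψ η) _ _).symm
  have h1 : (((η : G) * z)⁻¹ * ((Equiv.mulLeft η γ : Γ) : G) * y) = z⁻¹ * γ * y := by
    rw [Equiv.coe_mulLeft, Subgroup.coe_mul]
    group
  rw [h1, Equiv.coe_mulLeft, map_mul]
  rfl

variable (μ ψ) in
/-- `kerFun` as an element of `L²(Γ\G, ψ)`. -/
def L2.ker (hΓ : IsCocompact Γ) (hE : IsBddCompact E) (y : G) (w : W) : L2 μ ψ :=
  L2.ofBounded hΓ (kerFun ψ E y w) (aestronglyMeasurable_kerFun hΓ hE y w)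
    (fun γ => Eventually.of_forall fun z => kerFun_mul γ y w z)
    (exists_norm_kerFun_le hΓ hE y w).choose_spec

theorem L2.coe_ker (hΓ : IsCocompact Γ) (hE : IsBddCompact E) (y : G) (w : W) :
    ∀ᵐ z ∂μ, L2.ker μ ψ hΓ hE y w z = kerFun ψ E y w z := L2.coe_ofBounded ..

/-- `L2.ker` represents the evaluation functionals of `s ↦ s * E`: unfold the integral over `G` into
a sum over `Γ` of integrals over a fundamental domain. -/
theorem L2.adjoint_eval (hΓ : IsCocompact Γ) (hE : IsBddCompact E) (hE' : IsSupBounded Γ μ E)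
    (y : G) (w : W) : adjoint (L2.eval ψ hE' y) w = L2.ker μ ψ hΓ hE y w := by
  refine ext_inner_right ℂ fun s => ?_
  rw [adjoint_inner_left, L2.eval_apply, ← integral_inner (hE'.integrable_smul y s),
    (isFundamentalDomain Γ μ).integral_eq_tsum' _ ((hE'.integrable_smul y s).const_inner w),
    L2.inner_eq]
  rw [← integral_tsum]
  · refine integral_congr_ae (ae_restrict_of_ae ?_)
    have h : ∀ᵐ z ∂μ, ∀ γ : Γ, s ((γ : G) * z) = ψ γ (s z) := ae_all_iff.2 s.2.1
    filter_upwards [h, L2.coe_ker (ψ := ψ) hΓ hE y w] with z hz hk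
    rw [hk, kerFun]
    refine Eq.trans (tsum_congr fun γ => ?_) ((innerSLFlip ℂ (s z)).map_tsum
      (summable_kerFun hΓ hE y w z)).symm
    change inner ℂ w (E (((γ⁻¹ : Γ) • z)⁻¹ * y) • s ((γ⁻¹ : Γ) • z)) = inner ℂ _ (s z)
    have h2 : (γ⁻¹ : Γ) • z = ((γ⁻¹ : Γ) : G) * z := rfl
    rw [h2, hz, inner_smul_right, inner_smul_left, RCLike.conj_conj,
      ← LinearIsometryEquiv.inner_map_map (ψ γ) w]
    have h3 : ψ γ (ψ γ⁻¹ (s z)) = s z := by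
      have : (ψ γ * ψ γ⁻¹) (s z) = s z := by rw [← map_mul, mul_inv_cancel, map_one]; rfl
      exact this
    rw [h3]
    simp
  · intro γ
    have h1 := ((hE'.integrable_smul y s).const_inner (𝕜 := ℂ) w).aestronglyMeasurable
    exact (h1.comp_quasiMeasurePreserving
      (measurePreserving_mul_left μ ((γ⁻¹ : Γ) : G)).quasiMeasurePreserving).restrict
  · have h := (isFundamentalDomain Γ μ).lintegral_eq_tsum'
      (fun x => ‖inner ℂ w (E (x⁻¹ * y) • s x)‖ₑ)
    rw [← h]
    exact ((hE'.integrable_smul y s).const_inner (𝕜 := ℂ) w).2.ne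

variable [FiniteDimensional ℂ W]

theorem lintegral_tsum_enorm_le (hΓ : IsCocompact Γ) (hF : Integrable F μ) (hE : IsBddCompact E) :
    ∃ M : NNReal, ∀ x y : G,
      ∑' γ : Γ, ∫⁻ z, ‖F (x⁻¹ * z) * E (z⁻¹ * γ * y)‖ₑ ∂μ ≤ M := by
  obtain ⟨M, hM⟩ := hE.exists_tsum_enorm_le hΓ
  obtain ⟨m, hm⟩ := exists_lintegral_enorm_eq hF
  refine ⟨m * M, fun x y => ?_⟩
  have hF' : AEStronglyMeasurable (fun z => F (x⁻¹ * z)) μ :=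
    hF.1.comp_quasiMeasurePreserving (measurePreserving_mul_left μ x⁻¹).quasiMeasurePreserving
  rw [← lintegral_tsum fun γ => by
    exact hF'.enorm.mul (hE.1.comp ((measurable_inv.mul_const _).mul_const _)).enorm.aemeasurable
      |>.congr (Eventually.of_forall fun z => (enorm_mul _ _).symm)]
  calc ∫⁻ z, ∑' γ : Γ, ‖F (x⁻¹ * z) * E (z⁻¹ * γ * y)‖ₑ ∂μ
      ≤ ∫⁻ z, ‖F (x⁻¹ * z)‖ₑ * M ∂μ := by
        refine lintegral_mono fun z => ?_
        simp only [enorm_mul, ENNReal.tsum_mul_left]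
        gcongr
        exact hM z y
    _ = _ := by
        rw [lintegral_mul_const'' _ hF'.enorm,
          lintegral_mul_left_eq_self (fun z => ‖F z‖ₑ) x⁻¹, hm, ENNReal.coe_mul]

theorem integral_mul_eq_conv (x : G) (y : G) (γ : G) :
    ∫ z, F (x⁻¹ * z) * E (z⁻¹ * γ * y) ∂μ = conv μ F E (x⁻¹ * γ * y) := by
  rw [conv, ← integral_mul_left_eq_self _ x]
  refine integral_congr_ae (Eventually.of_forall fun z => ?_)
  simp only [inv_mul_cancel_left]
  congr 2
  group

theorem exists_tsum_conv_le (hΓ : IsCocompact Γ) (hF : Integrable F μ) (hE : IsBddCompact E) :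
    ∃ M : NNReal, ∀ x y : G, ∑' γ : Γ, ‖conv μ F E (x⁻¹ * γ * y)‖ₑ ≤ M := by
  obtain ⟨M, hM⟩ := lintegral_tsum_enorm_le hΓ hF hE
  refine ⟨M, fun x y => (ENNReal.tsum_le_tsum fun γ => ?_).trans (hM x y)⟩
  rw [← integral_mul_eq_conv]
  exact enorm_integral_le_lintegral_enorm _

/-- The value of `s * F^*` at `x`, for `s` the kernel of `s ↦ s * E` at `y`: the adjoint of the
automorphic kernel `∑ (F * E)(x⁻¹ γ y) ψ(γ)⁻¹`, applied to `w`. -/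
theorem L2.eval_ker (hΓ : IsCocompact Γ) (hF : Integrable F μ)
    (hF' : IsSupBounded Γ μ (adjFun F)) (hE : IsBddCompact E) (x y : G) (w : W) :
    HasSum (fun γ : Γ => (starRingEnd ℂ) (conv μ F E (x⁻¹ * γ * y)) • ψ γ w)
      (L2.eval ψ hF' x (L2.ker μ ψ hΓ hE y w)) := by
  obtain ⟨M, hM⟩ := lintegral_tsum_enorm_le hΓ hF hE
  have hxF : AEStronglyMeasurable (fun z => F (x⁻¹ * z)) μ :=
    hF.1.comp_quasiMeasurePreserving (measurePreserving_mul_left μ x⁻¹).quasiMeasurePreserving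
  have hmeas : ∀ γ : Γ, AEStronglyMeasurable (fun z =>
      (starRingEnd ℂ) (F (x⁻¹ * z)) • (starRingEnd ℂ) (E (z⁻¹ * γ * y)) • ψ γ w) μ := fun γ =>
    (Complex.continuous_conj.comp_aestronglyMeasurable hxF).smul
      (aestronglyMeasurable_kerFun_term hE y w γ)
  have hen : ∀ (γ : Γ) z,
      ‖(starRingEnd ℂ) (F (x⁻¹ * z)) • (starRingEnd ℂ) (E (z⁻¹ * γ * y)) • ψ γ w‖ₑ =
        ‖F (x⁻¹ * z) * E (z⁻¹ * γ * y)‖ₑ * ‖w‖ₑ := fun γ z => by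
    rw [enorm_smul, enorm_kerFun_term, RCLike.enorm_conj, enorm_mul, mul_assoc ‖F (x⁻¹ * z)‖ₑ]
  have hfin : ∑' γ : Γ, ∫⁻ z,
      ‖(starRingEnd ℂ) (F (x⁻¹ * z)) • (starRingEnd ℂ) (E (z⁻¹ * γ * y)) • ψ γ w‖ₑ ∂μ ≠ ⊤ := by
    simp only [hen]
    simp_rw [lintegral_mul_const' _ _ enorm_ne_top]
    rw [ENNReal.tsum_mul_right]
    exact ENNReal.mul_ne_top (ne_top_of_le_ne_top ENNReal.coe_ne_top (hM x y)) enorm_ne_top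
  have h1 : L2.eval ψ hF' x (L2.ker μ ψ hΓ hE y w) = ∑' γ : Γ, ∫ z,
      (starRingEnd ℂ) (F (x⁻¹ * z)) • (starRingEnd ℂ) (E (z⁻¹ * γ * y)) • ψ γ w ∂μ := by
    rw [← integral_tsum hmeas hfin, L2.eval_apply]
    refine integral_congr_ae ?_
    filter_upwards [L2.coe_ker (ψ := ψ) hΓ hE y w] with z hz
    rw [hz, kerFun, adjFun, mul_inv_rev, inv_inv, (summable_kerFun hΓ hE y w z).tsum_const_smul]
  have h2 : ∀ γ : Γ, ∫ z,
      (starRingEnd ℂ) (F (x⁻¹ * z)) • (starRingEnd ℂ) (E (z⁻¹ * γ * y)) • ψ γ w ∂μ =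
        (starRingEnd ℂ) (conv μ F E (x⁻¹ * γ * y)) • ψ γ w := by
    intro γ
    rw [← integral_mul_eq_conv, ← integral_conj, ← integral_smul_const]
    refine integral_congr_ae (Eventually.of_forall fun z => ?_)
    simp only [smul_smul, map_mul]
  simp only [h2] at h1
  rw [h1]
  refine Summable.hasSum (Summable.of_enorm ?_)
  refine ne_top_of_le_ne_top hfin (ENNReal.tsum_le_tsum fun γ => ?_)
  rw [← h2]
  exact enorm_integral_le_lintegral_enorm _

/-- The complex conjugate of the character of a representation. -/
def conjChar (ψ : Γ →* (W ≃ₗᵢ[ℂ] W)) (γ : Γ) : ℂ :=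
  ∑ j, inner ℂ (ψ γ (stdOrthonormalBasis ℂ W j)) (stdOrthonormalBasis ℂ W j)

variable {g : G} (hg : ∀ x, x ∈ Γ ↔ g * x * g⁻¹ ∈ Γ)
  (hψ : ∀ γ η : Γ, (η : G) = g * γ * g⁻¹ → ψ η = ψ γ)

variable (μ) in
/-- A function `f` for which `s ↦ s * f` is a sum of products of two Hilbert–Schmidt operators, and
the trace of `g^* (· * f)` is given by integration of the kernel over the diagonal. The other fields
say that `s * f` and the kernel converge absolutely, with uniform bounds. -/
structure HasTraceFormula (f : G → ℂ) (hΓ : IsCocompact Γ) : Prop where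
  measurable : Measurable f
  integrable : Integrable f μ
  isSupBounded : IsSupBounded Γ μ f
  mem_hsProducts : L2.convOp ψ hΓ integrable ∈ hsProducts (L2 μ ψ) (L2 μ ψ)
  bound : ∃ M : NNReal, ∀ x y : G, ∑' γ : Γ, ‖f (x⁻¹ * γ * y)‖ₑ ≤ M
  hasTrace : HasTrace ((L2.pull hg hψ).comp (L2.convOp ψ hΓ integrable))
    (∑' γ : Γ, conjChar ψ γ * ∫ x in fundDomain Γ μ, f (x⁻¹ * γ * g * x) ∂μ)

/-- The trace of the automorphic kernel of `F * E` at `(x, y)`, expanded along a Hilbert basis. -/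
theorem hasSum_kernel (hΓ : IsCocompact Γ) (hF : Integrable F μ)
    (hF' : IsSupBounded Γ μ (adjFun F)) (hE : IsBddCompact E) (hE' : IsSupBounded Γ μ E)
    {ι : Type*} (b : HilbertBasis ι ℂ (L2 μ ψ)) (x y : G) :
    HasSum (fun i => inner ℂ (L2.eval ψ hF' x (b i)) (L2.eval ψ hE' y (b i)))
      (∑' γ : Γ, conjChar ψ γ * conv μ F E (x⁻¹ * γ * y)) := by
  have h1 := hasSum_inner_apply b (stdOrthonormalBasis ℂ W) (L2.eval ψ hF' x) (L2.eval ψ hE' y)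
  convert h1 using 1
  refine HasSum.tsum_eq ?_
  have h2 : ∀ γ : Γ, conjChar ψ γ * conv μ F E (x⁻¹ * γ * y) =
      ∑ j, inner ℂ ((starRingEnd ℂ) (conv μ F E (x⁻¹ * γ * y)) •
        ψ γ (stdOrthonormalBasis ℂ W j)) (stdOrthonormalBasis ℂ W j) := by
    intro γ
    simp only [inner_smul_left, RCLike.conj_conj]
    rw [← Finset.mul_sum, mul_comm, conjChar]
  simp only [h2]
  refine hasSum_sum fun j _ => ?_
  rw [L2.adjoint_eval hΓ hE]
  exact (L2.eval_ker (ψ := ψ) hΓ hF hF' hE x y (stdOrthonormalBasis ℂ W j)).mapL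
    (innerSLFlip ℂ (stdOrthonormalBasis ℂ W j))

theorem HasTrace.congr {H : Type u} [NormedAddCommGroup H] [InnerProductSpace ℂ H] {T : H →L[ℂ] H}
    {s t : ℂ} (h : HasTrace T s) (e : s = t) : HasTrace T t := e ▸ h

theorem setIntegral_fundDomain_integrableOn {hΓ : IsCocompact Γ} {f : G → ℂ}
    (hf : Measurable f) {M : NNReal} (hM : ∀ x y : G, ∑' γ : Γ, ‖f (x⁻¹ * γ * y)‖ₑ ≤ M) :
    (∀ γ : Γ, IntegrableOn (fun x => f (x⁻¹ * γ * g * x)) (fundDomain Γ μ) μ) ∧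
      ∑' γ : Γ, ∫⁻ x in fundDomain Γ μ, ‖f (x⁻¹ * γ * g * x)‖ₑ ∂μ < ⊤ := by
  have hm : ∀ γ : Γ, Measurable fun x => f (x⁻¹ * γ * g * x) := fun γ =>
    hf.comp (((measurable_inv.mul_const _).mul_const _).mul measurable_id)
  have h1 : ∑' γ : Γ, ∫⁻ x in fundDomain Γ μ, ‖f (x⁻¹ * γ * g * x)‖ₑ ∂μ < ⊤ := by
    rw [← lintegral_tsum fun γ => (hm γ).enorm.aemeasurable]
    calc ∫⁻ x in fundDomain Γ μ, ∑' γ : Γ, ‖f (x⁻¹ * γ * g * x)‖ₑ ∂μ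
        ≤ ∫⁻ x in fundDomain Γ μ, M ∂μ := by
          refine lintegral_mono fun x => ?_
          simpa only [mul_assoc] using hM x (g * x)
      _ < ⊤ := by
          rw [lintegral_const]
          exact ENNReal.mul_lt_top ENNReal.coe_lt_top
            (by simpa using measure_fundDomain_lt_top hΓ)
  refine ⟨fun γ => ⟨(hm γ).aestronglyMeasurable, ?_⟩, h1⟩
  exact (ENNReal.le_tsum γ).trans_lt h1

theorem norm_conjChar_le (γ : Γ) : ‖conjChar ψ γ‖ ≤ Module.finrank ℂ W := by
  refine (norm_sum_le _ _).trans ?_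
  refine (Finset.sum_le_card_nsmul _ _ 1 fun j _ => ?_).trans (by simp)
  refine (norm_inner_le_norm _ _).trans ?_
  rw [LinearIsometryEquiv.norm_map, (stdOrthonormalBasis ℂ W).orthonormal.1, one_mul]

/-- Absolute convergence of the kernel on the diagonal. -/
theorem summable_setIntegral {hΓ : IsCocompact Γ} {f : G → ℂ}
    (hf : Measurable f) (hM : ∃ M : NNReal, ∀ x y : G, ∑' γ : Γ, ‖f (x⁻¹ * γ * y)‖ₑ ≤ M) :
    Summable fun γ : Γ => conjChar ψ γ * ∫ x in fundDomain Γ μ, f (x⁻¹ * γ * g * x) ∂μ := by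
  obtain ⟨M, hM⟩ := hM
  have h := (setIntegral_fundDomain_integrableOn (μ := μ) (g := g) (hΓ := hΓ) hf hM).2
  have h1 : Summable fun γ : Γ => ∫ x in fundDomain Γ μ, f (x⁻¹ * γ * g * x) ∂μ :=
    Summable.of_enorm (ne_top_of_le_ne_top h.ne
      (ENNReal.tsum_le_tsum fun γ => enorm_integral_le_lintegral_enorm _))
  refine Summable.of_norm_bounded (g := fun γ : Γ => (Module.finrank ℂ W : ℝ) *
    ‖∫ x in fundDomain Γ μ, f (x⁻¹ * γ * g * x) ∂μ‖) (h1.norm.mul_left _) fun γ => ?_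
  rw [norm_mul]
  gcongr
  exact norm_conjChar_le γ

theorem HasTraceFormula.zero (hΓ : IsCocompact Γ) : HasTraceFormula μ hg hψ 0 hΓ where
  measurable := measurable_zero
  integrable := integrable_zero _ _ _
  isSupBounded := IsSupBounded.zero
  mem_hsProducts := by
    have : L2.convOp ψ hΓ (integrable_zero G ℂ μ) = 0 := by
      ext1 s
      exact (repInt_apply _ _ _).trans (by simp)
    exact this ▸ Submodule.zero_mem _
  bound := ⟨0, fun x y => by simp⟩
  hasTrace := by
    have : L2.convOp ψ hΓ (integrable_zero G ℂ μ) = 0 := by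
      ext1 s
      exact (repInt_apply _ _ _).trans (by simp)
    have h2 : L2.convOp ψ hΓ (a := (0 : G → ℂ)) (integrable_zero G ℂ μ) = 0 := this
    rw [h2, ContinuousLinearMap.comp_zero]
    simpa using HasTrace.zero (H := L2 μ ψ)

theorem HasTraceFormula.add {hΓ : IsCocompact Γ} {f h : G → ℂ}
    (hf : HasTraceFormula μ hg hψ f hΓ) (hh : HasTraceFormula μ hg hψ h hΓ) :
    HasTraceFormula μ hg hψ (f + h) hΓ where
  measurable := hf.measurable.add hh.measurable
  integrable := hf.integrable.add hh.integrable
  isSupBounded := hf.isSupBounded.add hh.isSupBounded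
  mem_hsProducts := by
    rw [L2.convOp, repInt_add _ hf.integrable hh.integrable]
    exact Submodule.add_mem _ hf.mem_hsProducts hh.mem_hsProducts
  bound := by
    obtain ⟨M, hM⟩ := hf.bound
    obtain ⟨N, hN⟩ := hh.bound
    refine ⟨M + N, fun x y => ?_⟩
    push_cast
    refine le_trans ?_ (add_le_add (hM x y) (hN x y))
    rw [← ENNReal.tsum_add]
    exact ENNReal.tsum_le_tsum fun γ => enorm_add_le _ _
  hasTrace := by
    rw [L2.convOp, repInt_add _ hf.integrable hh.integrable, ContinuousLinearMap.comp_add]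
    refine (hf.hasTrace.add hh.hasTrace).congr ?_
    rw [← (summable_setIntegral (hΓ := hΓ) hf.measurable hf.bound).tsum_add
      (summable_setIntegral (hΓ := hΓ) hh.measurable hh.bound)]
    obtain ⟨M, hM⟩ := hf.bound
    obtain ⟨N, hN⟩ := hh.bound
    refine tsum_congr fun γ => ?_
    rw [← mul_add, ← integral_add
      ((setIntegral_fundDomain_integrableOn (hΓ := hΓ) hf.measurable hM).1 γ)
      ((setIntegral_fundDomain_integrableOn (hΓ := hΓ) hh.measurable hN).1 γ)]
    rfl

theorem HasTraceFormula.smul {hΓ : IsCocompact Γ} {f : G → ℂ} (c : ℂ)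
    (hf : HasTraceFormula μ hg hψ f hΓ) : HasTraceFormula μ hg hψ (c • f) hΓ where
  measurable := hf.measurable.const_smul c
  integrable := hf.integrable.smul c
  isSupBounded := hf.isSupBounded.smul c
  mem_hsProducts := by
    rw [L2.convOp, repInt_smul _ hf.integrable]
    exact Submodule.smul_mem _ _ hf.mem_hsProducts
  bound := by
    obtain ⟨M, hM⟩ := hf.bound
    refine ⟨‖c‖₊ * M, fun x y => ?_⟩
    simp only [Pi.smul_apply, enorm_smul, ENNReal.tsum_mul_left]
    rw [ENNReal.coe_mul]
    exact mul_le_mul_right (hM x y) _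
  hasTrace := by
    rw [L2.convOp, repInt_smul _ hf.integrable, ContinuousLinearMap.comp_smul]
    refine (hf.hasTrace.smul c).congr ?_
    rw [← tsum_mul_left]
    refine tsum_congr fun γ => ?_
    simp only [Pi.smul_apply, smul_eq_mul]
    rw [integral_const_mul]
    ring

/-- The trace formula for `f = F * E`: here `g^* (· * f)` is `B S†` with the Hilbert–Schmidt
operators `B = g^* (· * E)`, `S = · * F^*`, and `tr B S† = ∑ ⟨S e, B e⟩` over an orthonormal basis
is the integral of `∑ ⟨(S e)(x), (B e)(x)⟩`, which Parseval's identity evaluates. -/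
theorem hasTraceFormula_conv (hΓ : IsCocompact Γ) (hFm : Measurable F) (hF : Integrable F μ)
    (hF' : IsSupBounded Γ μ (adjFun F)) (hE : IsBddCompact E) :
    HasTraceFormula μ hg hψ (conv μ F E) hΓ := by
  have hE' : IsSupBounded Γ μ E := hE.isSupBounded hΓ
  have hEi : Integrable E μ := hE.integrable
  have hfm : Measurable (conv μ F E) := measurable_conv hFm hE.1
  set S := L2.convOp ψ hΓ (integrable_adjFun hF) with hS
  have hSHS : IsHS S := L2.isHS_convOp hΓ _ hF'
  have hSadj : adjoint S = L2.convOp ψ hΓ hF := by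
    rw [hS, L2.convOp, repInt_adjoint]
    exact repInt_congr _ _ _ (adjFun_adjFun F)
  have hC : L2.convOp ψ hΓ (integrable_conv hF hEi) = (L2.convOp ψ hΓ hEi).comp (adjoint S) := by
    rw [hSadj]
    exact repInt_conv _ hF hEi
  have hBHS : IsHS (L2.convOp ψ hΓ hEi) := L2.isHS_convOp hΓ _ hE'
  have hb := exists_tsum_conv_le hΓ hF hE
  refine ⟨hfm, integrable_conv hF hEi, hE'.integrable_conv hFm hF, ?_, hb, ?_⟩
  · rw [hC]
    refine Submodule.subset_span ⟨adjoint (L2.convOp ψ hΓ hEi), adjoint S, hBHS.adj, hSHS.adj, ?_⟩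
    rw [adjoint_adjoint]
  · rw [hC, ← ContinuousLinearMap.comp_assoc]
    set B := (L2.pull hg hψ).comp (L2.convOp ψ hΓ hEi) with hB
    have hBHS' : IsHS B := hBHS.comp_left _
    obtain ⟨ι, hι, ⟨b⟩⟩ := exists_countable_hilbertBasis (L2 μ ψ)
    refine (hSHS.hasTrace hBHS' b ?_).2
    -- countability of the basis allows a common null set
    have hSb : ∀ᵐ x ∂μ, ∀ i, S (b i) x = L2.eval ψ hF' x (b i) :=
      ae_all_iff.2 fun i => L2.coe_convOp hΓ _ hF' _
    have hBb : ∀ᵐ x ∂μ, ∀ i, B (b i) x = L2.eval ψ hE' (g * x) (b i) := by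
      refine ae_all_iff.2 fun i => ?_
      filter_upwards [L2.coe_pull hg hψ (L2.convOp ψ hΓ hEi (b i)),
        ae_mul_left g (L2.coe_convOp hΓ hEi hE' (b i))] with x h1 h2
      exact h1.trans h2
    have hsum := hasSum_integral_of_summable_integral_norm
      (F := fun i x => inner ℂ (S (b i) x) (B (b i) x))
      (fun i => L2.integrable_inner (S (b i)) (B (b i))) ?_
    · have e1 : ∀ i, ∫ x in fundDomain Γ μ, inner ℂ (S (b i) x) (B (b i) x) ∂μ =
          inner ℂ (S (b i)) (B (b i)) := fun i => (L2.inner_eq _ _).symm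
      simp only [e1] at hsum
      have e2 : ∀ᵐ x ∂μ, ∑' i, inner ℂ (S (b i) x) (B (b i) x) =
          ∑' γ : Γ, conjChar ψ γ * conv μ F E (x⁻¹ * γ * g * x) := by
        filter_upwards [hSb, hBb] with x h1 h2
        simp only [h1, h2]
        rw [(hasSum_kernel hΓ hF hF' hE hE' b x (g * x)).tsum_eq]
        simp only [mul_assoc]
      rw [integral_congr_ae (ae_restrict_of_ae e2)] at hsum
      refine (congrArg (HasSum _) ?_).mp hsum
      obtain ⟨M, hM⟩ := hb
      obtain ⟨h3, h4⟩ := setIntegral_fundDomain_integrableOn (μ := μ) (g := g) (hΓ := hΓ) hfm hM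
      rw [integral_tsum]
      · exact tsum_congr fun γ => integral_const_mul _ _
      · exact fun γ => ((h3 γ).const_mul _).aestronglyMeasurable
      · refine ne_top_of_le_ne_top (ENNReal.mul_ne_top (a := (Module.finrank ℂ W : ℝ≥0∞))
          (ENNReal.natCast_ne_top _) h4.ne) ?_
        rw [← ENNReal.tsum_mul_left]
        refine ENNReal.tsum_le_tsum fun γ => ?_
        rw [← lintegral_const_mul' _ _ (ENNReal.natCast_ne_top _)]
        refine lintegral_mono fun x => ?_
        rw [enorm_mul]
        gcongr
        rw [← ofReal_norm]
        exact (ENNReal.ofReal_le_ofReal (norm_conjChar_le γ)).trans (by simp)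
    · have h1 := hSHS.summable b.orthonormal
      have h2 := hBHS'.summable b.orthonormal
      have hsq : ∀ s : L2 μ ψ, Integrable (fun x => ‖s x‖ ^ 2) (μ.restrict (fundDomain Γ μ)) :=
        fun s => (memLp_two_iff_integrable_sq_norm s.2.2.1).1 s.2.2
      have hn : ∀ s : L2 μ ψ, ∫ x in fundDomain Γ μ, ‖s x‖ ^ 2 ∂μ = ‖s‖ ^ 2 :=
        fun s => (L2.norm_sq_eq s).symm
      refine Summable.of_nonneg_of_le (fun i => integral_nonneg fun x => norm_nonneg _)
        (fun i => ?_) (h1.add h2)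
      rw [← hn, ← hn, ← integral_add (hsq _) (hsq _)]
      refine integral_mono (L2.integrable_inner (S (b i)) (B (b i))).norm
        ((hsq _).add (hsq _)) fun x => ?_
      refine (norm_inner_le_norm _ _).trans ?_
      nlinarith [sq_nonneg (‖S (b i) x‖ - ‖B (b i) x‖), sq_nonneg (‖S (b i) x‖),
        sq_nonneg (‖B (b i) x‖)]

/-- The trace formula holds for all sums of convolutions `F * E`. -/
theorem hasTraceFormula_of_mem_span (hΓ : IsCocompact Γ) {f : G → ℂ}
    (hf : f ∈ Submodule.span ℂ {f : G → ℂ | ∃ F E : G → ℂ, Measurable F ∧ Integrable F μ ∧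
      IsSupBounded Γ μ (adjFun F) ∧ IsBddCompact E ∧ f = conv μ F E}) :
    HasTraceFormula μ hg hψ f hΓ := by
  induction hf using Submodule.span_induction with
  | mem f hf =>
    obtain ⟨F, E, h1, h2, h3, h4, rfl⟩ := hf
    exact hasTraceFormula_conv hg hψ hΓ h1 h2 h3 h4
  | zero => exact HasTraceFormula.zero hg hψ hΓ
  | add f h _ _ hf hh => exact hf.add hg hψ hh
  | smul c f _ hf => exact hf.smul hg hψ c

end Trace

/-! ### Local coordinates at the identity -/

section Coordinates

variable {d : ℕ} {G : Type u} [Group G] [TopologicalSpace G]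
  [ChartedSpace (EuclideanSpace ℝ (Fin d)) G] [LieGroup (𝓡 d) ∞ G]

variable (d) in
/-- The coordinates of a chart at `1`, vanishing at `1`. -/
def coord (w : G) : Fin d → ℝ :=
  WithLp.ofLp (extChartAt (𝓡 d) (1 : G) w - extChartAt (𝓡 d) (1 : G) 1)

/-- The inverse of the chart `coord`. -/
def cexp (G : Type u) [Group G] [TopologicalSpace G] [ChartedSpace (EuclideanSpace ℝ (Fin d)) G]
    (t : Fin d → ℝ) : G :=
  (extChartAt (𝓡 d) (1 : G)).symm (extChartAt (𝓡 d) (1 : G) 1 + WithLp.toLp 2 t)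

theorem cexp_zero : cexp G (0 : Fin d → ℝ) = 1 := by
  rw [cexp, WithLp.toLp_zero, add_zero, extChartAt_to_inv]

theorem coord_one : coord d (1 : G) = 0 := by
  rw [coord, sub_self, WithLp.ofLp_zero]

/-- The coordinate domain in `ℝᵈ`. -/
def coordTarget (d : ℕ) (G : Type u) [Group G] [TopologicalSpace G]
    [ChartedSpace (EuclideanSpace ℝ (Fin d)) G] : Set (Fin d → ℝ) :=
  {t | extChartAt (𝓡 d) (1 : G) 1 + WithLp.toLp 2 t ∈ (extChartAt (𝓡 d) (1 : G)).target}

theorem isOpen_coordTarget : IsOpen (coordTarget d G) :=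
  (isOpen_extChartAt_target (1 : G)).preimage (by fun_prop)

theorem zero_mem_coordTarget : (0 : Fin d → ℝ) ∈ coordTarget d G := by
  change extChartAt (𝓡 d) (1 : G) 1 + WithLp.toLp 2 (0 : Fin d → ℝ) ∈
    (extChartAt (𝓡 d) (1 : G)).target
  rw [WithLp.toLp_zero, add_zero]
  exact mem_extChartAt_target _

theorem coord_cexp {t : Fin d → ℝ} (ht : t ∈ coordTarget d G) : coord d (cexp G t) = t := by
  rw [coord, cexp, (extChartAt (𝓡 d) (1 : G)).right_inv ht, add_sub_cancel_left]

theorem cexp_coord {w : G} (hw : w ∈ (extChartAt (𝓡 d) (1 : G)).source) :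
    cexp G (coord d w) = w := by
  rw [coord, cexp, WithLp.toLp_ofLp, add_sub_cancel, (extChartAt (𝓡 d) (1 : G)).left_inv hw]

theorem cexp_mem_source {t : Fin d → ℝ} (ht : t ∈ coordTarget d G) :
    cexp G t ∈ (extChartAt (𝓡 d) (1 : G)).source :=
  (extChartAt (𝓡 d) (1 : G)).map_target ht

theorem contMDiffAt_cexp {t : Fin d → ℝ} (ht : t ∈ coordTarget d G) :
    ContMDiffAt 𝓘(ℝ, Fin d → ℝ) (𝓡 d) ∞ (cexp G) t := by
  have : IsManifold (𝓡 d) ∞ G := LieGroup.toContMDiffMul.toIsManifold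
  have h1 : ContMDiffAt 𝓘(ℝ, EuclideanSpace ℝ (Fin d)) (𝓡 d) ∞ (extChartAt (𝓡 d) (1 : G)).symm
      (extChartAt (𝓡 d) (1 : G) 1 + WithLp.toLp 2 t) :=
    (contMDiffOn_extChartAt_symm (1 : G)).contMDiffAt
      ((isOpen_extChartAt_target (1 : G)).mem_nhds ht)
  have h2 : ContDiff ℝ ∞ fun t : Fin d → ℝ => extChartAt (𝓡 d) (1 : G) 1 + WithLp.toLp 2 t :=
    contDiff_const.add (PiLp.continuousLinearEquiv 2 ℝ fun _ : Fin d => ℝ).symm.contDiff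
  exact ContMDiffAt.comp t h1 h2.contMDiff.contMDiffAt

theorem contMDiffAt_coord {w : G} (hw : w ∈ (extChartAt (𝓡 d) (1 : G)).source) :
    ContMDiffAt (𝓡 d) 𝓘(ℝ, Fin d → ℝ) ∞ (coord d) w := by
  have : IsManifold (𝓡 d) ∞ G := LieGroup.toContMDiffMul.toIsManifold
  have h1 : ContMDiffAt (𝓡 d) 𝓘(ℝ, EuclideanSpace ℝ (Fin d)) ∞ (extChartAt (𝓡 d) (1 : G)) w :=
    contMDiffAt_extChartAt' (by rwa [extChartAt_source] at hw)
  have h2 : ContDiff ℝ ∞ fun v : EuclideanSpace ℝ (Fin d) =>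
      WithLp.ofLp (v - extChartAt (𝓡 d) (1 : G) 1) :=
    (PiLp.continuousLinearEquiv 2 ℝ fun _ : Fin d => ℝ).contDiff.comp
      (contDiff_id.sub contDiff_const)
  exact ContMDiffAt.comp (I' := 𝓘(ℝ, EuclideanSpace ℝ (Fin d))) w
    (g := fun v => WithLp.ofLp (v - extChartAt (𝓡 d) (1 : G) 1)) h2.contMDiff.contMDiffAt h1

/-- The quotient `x⁻¹ y` in the coordinates at `1`. -/
def cdiv (G : Type u) [Group G] [TopologicalSpace G] [ChartedSpace (EuclideanSpace ℝ (Fin d)) G]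
    (p : (Fin d → ℝ) × (Fin d → ℝ)) : Fin d → ℝ :=
  coord d ((cexp G p.1)⁻¹ * cexp G p.2)

theorem contDiffAt_cdiv {p : (Fin d → ℝ) × (Fin d → ℝ)} (h1 : p.1 ∈ coordTarget d G)
    (h2 : p.2 ∈ coordTarget d G)
    (h3 : (cexp G p.1)⁻¹ * cexp G p.2 ∈ (extChartAt (𝓡 d) (1 : G)).source) :
    ContDiffAt ℝ ∞ (cdiv G) p := by
  rw [← contMDiffAt_iff_contDiffAt]
  have e1 : ContMDiffAt 𝓘(ℝ, (Fin d → ℝ) × (Fin d → ℝ)) (𝓡 d) ∞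
      (fun p : (Fin d → ℝ) × (Fin d → ℝ) => (cexp G p.1)⁻¹) p :=
    ((contMDiffAt_cexp h1).comp p (contDiff_fst.contMDiff.contMDiffAt)).inv
  have e2 : ContMDiffAt 𝓘(ℝ, (Fin d → ℝ) × (Fin d → ℝ)) (𝓡 d) ∞
      (fun p : (Fin d → ℝ) × (Fin d → ℝ) => cexp G p.2) p :=
    (contMDiffAt_cexp h2).comp p (contDiff_snd.contMDiff.contMDiffAt)
  exact ContMDiffAt.comp p (contMDiffAt_coord h3) (e1.mul e2)

/-- The vector `d/dt cexp(t v)` in the Lie algebra. -/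
def coordVec (G : Type u) [Group G] [TopologicalSpace G]
    [ChartedSpace (EuclideanSpace ℝ (Fin d)) G] [LieGroup (𝓡 d) ∞ G] (v : Fin d → ℝ) : GroupLieAlgebra (𝓡 d) G :=
  (mfderiv 𝓘(ℝ, Fin d → ℝ) (𝓡 d) (cexp G) (0 : Fin d → ℝ) v : EuclideanSpace ℝ (Fin d))

/-- A left invariant derivative at `y` is the derivative at `1` of the left translate by `y`. -/
theorem mfderiv_mul_left_apply {F : G → ℂ} (hF : ContMDiff (𝓡 d) 𝓘(ℝ, ℂ) ∞ F) (y : G)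
    (X : GroupLieAlgebra (𝓡 d) G) :
    leftInvDeriv X F y = mfderiv (𝓡 d) 𝓘(ℝ, ℂ) (fun z => F (y * z)) 1 X := by
  have h := mfderiv_comp_of_eq (I := 𝓡 d) (I' := 𝓡 d) (I'' := 𝓘(ℝ, ℂ)) (x := (1 : G))
    (f := fun z => y * z) (g := F) (y := y)
    ((hF y).mdifferentiableAt (by simp)) ((contMDiff_mul_left (I := 𝓡 d) (n := ∞)
      (a := y)).contMDiffAt.mdifferentiableAt (by simp)) (mul_one y)
  have e : ∀ z, z = y → (mfderiv (𝓡 d) 𝓘(ℝ, ℂ) F z : EuclideanSpace ℝ (Fin d) →L[ℝ] ℂ) =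
      (mfderiv (𝓡 d) 𝓘(ℝ, ℂ) F y : EuclideanSpace ℝ (Fin d) →L[ℝ] ℂ) := by
    rintro z rfl
    rfl
  have h' : (mfderiv (𝓡 d) 𝓘(ℝ, ℂ) (F ∘ fun z => y * z) 1 : EuclideanSpace ℝ (Fin d) →L[ℝ] ℂ) =
      ContinuousLinearMap.comp (mfderiv (𝓡 d) 𝓘(ℝ, ℂ) F (y * 1) : EuclideanSpace ℝ (Fin d) →L[ℝ] ℂ)
        (mfderiv (𝓡 d) (𝓡 d) (fun z => y * z) (1 : G) :
          EuclideanSpace ℝ (Fin d) →L[ℝ] EuclideanSpace ℝ (Fin d)) := h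
  rw [e _ (mul_one y)] at h'
  exact (congrArg (fun L => L X) h').symm

theorem hasFDerivAt_comp_cexp_zero {F : G → ℂ} (hF : ContMDiff (𝓡 d) 𝓘(ℝ, ℂ) ∞ F) (y : G) :
    ∃ L : (Fin d → ℝ) →L[ℝ] ℂ, HasFDerivAt (fun t : Fin d → ℝ => F (y * cexp G t)) L 0 ∧
      ∀ v, L v = leftInvDeriv (coordVec G v) F y := by
  have hH : ContMDiff (𝓡 d) 𝓘(ℝ, ℂ) ∞ fun z => F (y * z) :=
    hF.comp (contMDiff_mul_left (I := 𝓡 d) (n := ∞) (a := y))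
  have h0 := contMDiffAt_cexp (zero_mem_coordTarget (d := d) (G := G))
  have h1 : MDifferentiableAt 𝓘(ℝ, Fin d → ℝ) (𝓡 d) (cexp G) (0 : Fin d → ℝ) :=
    h0.mdifferentiableAt (by simp)
  have h2 := mfderiv_comp_of_eq (I := 𝓘(ℝ, Fin d → ℝ)) (I' := 𝓡 d) (I'' := 𝓘(ℝ, ℂ))
    (x := (0 : Fin d → ℝ)) (f := cexp G) (g := fun z => F (y * z)) (y := (1 : G))
    ((hH 1).mdifferentiableAt (by simp)) h1 cexp_zero
  have h3 : MDifferentiableAt 𝓘(ℝ, Fin d → ℝ) 𝓘(ℝ, ℂ) (fun t => F (y * cexp G t))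
      (0 : Fin d → ℝ) :=
    (ContMDiffAt.comp (0 : Fin d → ℝ) (hH _) h0).mdifferentiableAt (by simp)
  refine ⟨_, (mdifferentiableAt_iff_differentiableAt.1 h3).hasFDerivAt, fun v => ?_⟩
  rw [← mfderiv_eq_fderiv, mfderiv_mul_left_apply hF]
  have e : ∀ z, z = (1 : G) →
      (mfderiv (𝓡 d) 𝓘(ℝ, ℂ) (fun z => F (y * z)) z : EuclideanSpace ℝ (Fin d) →L[ℝ] ℂ) =
      (mfderiv (𝓡 d) 𝓘(ℝ, ℂ) (fun z => F (y * z)) (1 : G) :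
        EuclideanSpace ℝ (Fin d) →L[ℝ] ℂ) := by
    rintro z rfl
    rfl
  have h' : (mfderiv 𝓘(ℝ, Fin d → ℝ) 𝓘(ℝ, ℂ) ((fun z => F (y * z)) ∘ cexp G) (0 : Fin d → ℝ) :
        (Fin d → ℝ) →L[ℝ] ℂ) =
      ContinuousLinearMap.comp (mfderiv (𝓡 d) 𝓘(ℝ, ℂ) (fun z => F (y * z))
          (cexp G (0 : Fin d → ℝ)) : EuclideanSpace ℝ (Fin d) →L[ℝ] ℂ)
        (mfderiv 𝓘(ℝ, Fin d → ℝ) (𝓡 d) (cexp G) (0 : Fin d → ℝ) :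
          (Fin d → ℝ) →L[ℝ] EuclideanSpace ℝ (Fin d)) := h2
  rw [e _ cexp_zero] at h'
  exact congrArg (fun L => L v) h'

theorem coordVec_sum (v : Fin d → ℝ) (F : G → ℂ) (y : G) :
    leftInvDeriv (coordVec G v) F y =
      ∑ j, v j • leftInvDeriv (coordVec G (Pi.single j 1)) F y := by
  let A : (Fin d → ℝ) →L[ℝ] EuclideanSpace ℝ (Fin d) :=
    mfderiv 𝓘(ℝ, Fin d → ℝ) (𝓡 d) (cexp G) (0 : Fin d → ℝ)
  let B : EuclideanSpace ℝ (Fin d) →L[ℝ] EuclideanSpace ℝ (Fin d) :=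
    mfderiv (𝓡 d) (𝓡 d) (fun z => y * z) (1 : G)
  let C : EuclideanSpace ℝ (Fin d) →L[ℝ] ℂ := mfderiv (𝓡 d) 𝓘(ℝ, ℂ) F y
  change C.comp (B.comp A) v = ∑ j, v j • C.comp (B.comp A) (Pi.single j 1)
  conv_lhs => rw [pi_eq_sum_univ' v]
  rw [map_sum]
  exact Finset.sum_congr rfl fun j _ => map_smul _ _ _

/-- The derivative at `t` is reduced to the derivative at `0` by writing
`x cexp(s) = (x cexp(t)) cexp(cdiv(t, s))`. The direction depends on `t`, but not on `x`. -/
theorem hasFDerivAt_comp_cexp {F : G → ℂ} (hF : ContMDiff (𝓡 d) 𝓘(ℝ, ℂ) ∞ F) (x : G)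
    {t : Fin d → ℝ} (ht : t ∈ coordTarget d G) :
    ∃ L : (Fin d → ℝ) →L[ℝ] ℂ, HasFDerivAt (fun s : Fin d → ℝ => F (x * cexp G s)) L t ∧
      ∀ v, L v = leftInvDeriv (coordVec G (fderiv ℝ (fun s => cdiv G (t, s)) t v)) F
        (x * cexp G t) := by
  obtain ⟨L, hL, hL'⟩ := hasFDerivAt_comp_cexp_zero hF (x * cexp G t)
  have hsrc : (1 : G) ∈ (extChartAt (𝓡 d) (1 : G)).source := mem_extChartAt_source _
  have h1 : DifferentiableAt ℝ (fun s => cdiv G (t, s)) t := by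
    have h : ContDiffAt ℝ ∞ (cdiv G) (t, t) := contDiffAt_cdiv ht ht (by simp)
    exact (h.differentiableAt (by simp)).comp t (by fun_prop)
  have h2 : cdiv G (t, t) = 0 := by rw [cdiv, inv_mul_cancel, coord_one]
  refine ⟨L.comp (fderiv ℝ (fun s => cdiv G (t, s)) t), ?_, fun v => hL' _⟩
  have h3 : HasFDerivAt (fun s => F (x * cexp G t * cexp G (cdiv G (t, s))))
      (L.comp (fderiv ℝ (fun s => cdiv G (t, s)) t)) t := by
    refine HasFDerivAt.comp t (g := fun s => F (x * cexp G t * cexp G s)) ?_ h1.hasFDerivAt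
    rwa [h2]
  refine h3.congr_of_eventuallyEq ?_
  have := topologicalGroup_of_lieGroup (𝓡 d) ∞ (G := G)
  have hc : ContinuousAt (fun s => (cexp G t)⁻¹ * cexp G s) t :=
    continuousAt_const.mul (contMDiffAt_cexp ht).continuousAt
  have h4 := hc.preimage_mem_nhds (t := (extChartAt (𝓡 d) (1 : G)).source)
    ((isOpen_extChartAt_source (1 : G)).mem_nhds (by simp))
  filter_upwards [h4] with s hs
  rw [cdiv, cexp_coord hs]
  congr 1
  group

end Coordinates

section SmoothL1

variable {d : ℕ} {G : Type u} [Group G] [TopologicalSpace G]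
  [ChartedSpace (EuclideanSpace ℝ (Fin d)) G] [LieGroup (𝓡 d) ∞ G]

/-- Over a constant base point the tangent coordinates of a derivative are the derivative itself. -/
theorem inTangentCoordinates_const (z : G) (p : G → ℂ)
    (A : G → EuclideanSpace ℝ (Fin d) →L[ℝ] ℂ) (x₀ x : G) :
    haveI : IsManifold (𝓡 d) 1 G :=
      haveI : IsManifold (𝓡 d) ∞ G := LieGroup.toContMDiffMul.toIsManifold
      IsManifold.of_le (n := ∞) (by simp)
    inTangentCoordinates (𝓡 d) 𝓘(ℝ, ℂ) (fun _ : G => z) p A x₀ x = A x := by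
  have hM : IsManifold (𝓡 d) ∞ G := LieGroup.toContMDiffMul.toIsManifold
  have hM1 : IsManifold (𝓡 d) 1 G := IsManifold.of_le (n := ∞) (by simp)
  rw [inTangentCoordinates_eq (I := 𝓡 d) (I' := 𝓘(ℝ, ℂ)) (fun _ : G => z) p A
    (x₀ := x₀) (x := x) (mem_chart_source _ _)
    (by rw [chartAt_self_eq]; exact mem_univ _)]
  ext v
  simp only [ContinuousLinearMap.comp_apply]
  rw [(tangentBundleCore (𝓡 d) G).coordChange_self _ _ (by
    rw [tangentBundleCore_baseSet]; exact mem_chart_source _ _)]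
  simp

/-- The derivative of `z ↦ F (x z)` at `1` depends smoothly on `x`. -/
theorem contMDiff_leftInvDeriv {F : G → ℂ} (hF : ContMDiff (𝓡 d) 𝓘(ℝ, ℂ) ∞ F)
    (X : GroupLieAlgebra (𝓡 d) G) : ContMDiff (𝓡 d) 𝓘(ℝ, ℂ) ∞ (leftInvDeriv X F) := by
  have hM : IsManifold (𝓡 d) ∞ G := LieGroup.toContMDiffMul.toIsManifold
  have hM1 : IsManifold (𝓡 d) 1 G := IsManifold.of_le (n := ∞) (by simp)
  intro x₀
  have h1 : ContMDiffAt ((𝓡 d).prod (𝓡 d)) 𝓘(ℝ, ℂ) ∞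
      (Function.uncurry fun x z : G => F (x * z)) (x₀, 1) :=
    (hF.comp (contMDiff_mul (𝓡 d) ∞)).contMDiffAt
  have h2 := ContMDiffAt.mfderiv (m := ∞) (fun x z : G => F (x * z)) (fun _ : G => (1 : G)) h1
    contMDiffAt_const le_rfl
  let X' : EuclideanSpace ℝ (Fin d) := X
  have h3 := h2.clm_apply (contMDiffAt_const (c := X'))
  refine h3.congr_of_eventuallyEq (Eventually.of_forall fun x => ?_)
  refine (mfderiv_mul_left_apply hF x X).trans ?_
  exact (congrArg (fun L : EuclideanSpace ℝ (Fin d) →L[ℝ] ℂ => L X')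
    (inTangentCoordinates_const 1 (fun x => F (x * 1))
      (fun x => mfderiv (𝓡 d) 𝓘(ℝ, ℂ) (fun z => F (x * z)) 1) x₀ x)).symm

theorem IsSmoothL1.isSmoothL1_leftInvDeriv [MeasurableSpace G] {μ : Measure G} {F : G → ℂ}
    (hF : IsSmoothL1 d μ F) (X : GroupLieAlgebra (𝓡 d) G) :
    IsSmoothL1 d μ (leftInvDeriv X F) :=
  ⟨contMDiff_leftInvDeriv hF.1 X, fun l => by simpa using hF.2 (l ++ [X])⟩

theorem IsSmoothL1.integrable [MeasurableSpace G] {μ : Measure G} {F : G → ℂ}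
    (hF : IsSmoothL1 d μ F) : Integrable F μ := hF.2 []

end SmoothL1

/-! ### Haar measure in local coordinates -/

section HaarCoordinates

variable {d : ℕ} {G : Type u} [Group G] [TopologicalSpace G]
  [ChartedSpace (EuclideanSpace ℝ (Fin d)) G] [LieGroup (𝓡 d) ∞ G] [IsTopologicalGroup G]

theorem continuousOn_cexp : ContinuousOn (cexp G) (coordTarget d G) := fun _ ht =>
  (contMDiffAt_cexp ht).continuousAt.continuousWithinAt

theorem continuousOn_coord :
    ContinuousOn (coord d (G := G)) (extChartAt (𝓡 d) (1 : G)).source := fun _ hw =>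
  (contMDiffAt_coord hw).continuousAt.continuousWithinAt

variable (d G) in
/-- Left translation by elements near `1` is uniformly Lipschitz in the coordinates. -/
theorem exists_lipschitz_translation : ∃ (L : NNReal) (r r' : ℝ), 0 < r ∧ 0 < r' ∧
    Metric.ball (0 : Fin d → ℝ) r ⊆ coordTarget d G ∧
    Metric.ball (0 : Fin d → ℝ) r' ⊆ coordTarget d G ∧
    ∀ s ∈ Metric.ball (0 : Fin d → ℝ) r', ∃ q : (Fin d → ℝ) → Fin d → ℝ,
      LipschitzOnWith L q (Metric.ball 0 r) ∧ ∀ t ∈ Metric.ball (0 : Fin d → ℝ) r',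
        ∃ t' ∈ Metric.ball (0 : Fin d → ℝ) r, q t' = t ∧
          (cexp G s)⁻¹ * cexp G t' = cexp G t := by
  have hsrc : (extChartAt (𝓡 d) (1 : G)).source ∈ 𝓝 (1 : G) := extChartAt_source_mem_nhds _
  have h0 := zero_mem_coordTarget (d := d) (G := G)
  have hT : coordTarget d G ∈ 𝓝 (0 : Fin d → ℝ) := isOpen_coordTarget.mem_nhds h0
  have h1 : ContDiffAt ℝ ∞ (cdiv (d := d) G) (0, 0) :=
    contDiffAt_cdiv h0 h0 (by simp [cexp_zero])
  obtain ⟨L, T, hTn, hL⟩ := ((h1.of_le (m := 1) (by simp)).exists_lipschitzOnWith)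
  rw [nhds_prod_eq, mem_prod_same_iff] at hTn
  obtain ⟨T', hT', hTT⟩ := hTn
  obtain ⟨r, hr, hrT⟩ := Metric.mem_nhds_iff.1 (inter_mem hT' hT)
  have hc0 : ContinuousAt (cexp G) (0 : Fin d → ℝ) := (contMDiffAt_cexp h0).continuousAt
  have hc : ContinuousAt (fun p : (Fin d → ℝ) × (Fin d → ℝ) => cexp G p.1 * cexp G p.2) (0, 0) :=
    (hc0.comp (x := ((0 : Fin d → ℝ), (0 : Fin d → ℝ))) continuousAt_fst).mul
      (hc0.comp (x := ((0 : Fin d → ℝ), (0 : Fin d → ℝ))) continuousAt_snd)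
  have hO : (extChartAt (𝓡 d) (1 : G)).source ∩ coord d ⁻¹' Metric.ball 0 r ∈ 𝓝 (1 : G) := by
    refine inter_mem hsrc ?_
    refine (contMDiffAt_coord (mem_of_mem_nhds hsrc)).continuousAt.preimage_mem_nhds ?_
    rw [coord_one]
    exact Metric.ball_mem_nhds _ hr
  have hn := hc.preimage_mem_nhds
    (t := (extChartAt (𝓡 d) (1 : G)).source ∩ coord d ⁻¹' Metric.ball 0 r)
    (by simpa only [cexp_zero, mul_one] using hO)
  rw [nhds_prod_eq, mem_prod_same_iff] at hn
  obtain ⟨T2, hT2, hTT2⟩ := hn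
  obtain ⟨r', hr', hrT'⟩ := Metric.mem_nhds_iff.1 (inter_mem (inter_mem hT2 hT) hT')
  refine ⟨L, r, r', hr, hr', fun t ht => (hrT ht).2, fun t ht => (hrT' ht).1.2,
    fun s hs => ⟨fun t => cdiv G (s, t), ?_, fun t ht => ?_⟩⟩
  · have h2 : LipschitzOnWith L (fun t : Fin d → ℝ => cdiv G (s, t)) (Metric.ball 0 r) := by
      intro t ht t' ht'
      have h3 := hL (x := (s, t)) (hTT ⟨(hrT' hs).2, (hrT ht).1⟩) (y := (s, t'))
        (hTT ⟨(hrT' hs).2, (hrT ht').1⟩)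
      simpa [Prod.edist_eq] using h3
    exact h2
  · obtain ⟨h3, h4⟩ := hTT2 (show (s, t) ∈ T2 ×ˢ T2 from ⟨(hrT' hs).1.1, (hrT' ht).1.1⟩)
    refine ⟨coord d (cexp G s * cexp G t), h4, ?_, ?_⟩
    · change coord d ((cexp G s)⁻¹ * cexp G (coord d (cexp G s * cexp G t))) = t
      rw [cexp_coord h3, inv_mul_cancel_left, coord_cexp (hrT' ht).1.2]
    · rw [cexp_coord h3, inv_mul_cancel_left]

variable [LocallyCompactSpace G] [SecondCountableTopology G] [MeasurableSpace G] [BorelSpace G]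
  {μ : Measure G} [μ.IsHaarMeasure] [μ.IsMulRightInvariant] [μ.IsInvInvariant]

/-- In the coordinates at `1`, Lebesgue measure is bounded by a multiple of Haar measure. -/
theorem exists_volume_le : ∃ (C : NNReal) (r : ℝ), 0 < r ∧
    Metric.ball (0 : Fin d → ℝ) r ⊆ coordTarget d G ∧ ∀ A : Set G, MeasurableSet A →
      volume {t ∈ Metric.ball (0 : Fin d → ℝ) r | cexp G t ∈ A} ≤ C * μ A := by
  obtain ⟨L, r, r', hr, hr', hB, hB', h⟩ := exists_lipschitz_translation d G
  set B := Metric.ball (0 : Fin d → ℝ) r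
  set B' := Metric.ball (0 : Fin d → ℝ) r'
  obtain ⟨K, hK, hK1⟩ := exists_compact_mem_nhds (1 : G)
  set W := ((extChartAt (𝓡 d) (1 : G)).source ∩ coord d ⁻¹' B') ∩ interior K
  have hWo : IsOpen W := (continuousOn_coord.isOpen_inter_preimage
    (isOpen_extChartAt_source (1 : G)) Metric.isOpen_ball).inter isOpen_interior
  have h1W : (1 : G) ∈ W := ⟨⟨mem_extChartAt_source _, by
    simp only [mem_preimage, coord_one]; exact Metric.mem_ball_self hr'⟩,
    mem_interior_iff_mem_nhds.2 hK1⟩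
  have hW0 : μ W ≠ 0 := (hWo.measure_pos μ ⟨1, h1W⟩).ne'
  have hWt : μ W ≠ ⊤ := ne_top_of_le_ne_top hK.measure_lt_top.ne
    (measure_mono (inter_subset_right.trans interior_subset))
  obtain ⟨b, hb⟩ : ∃ b : NNReal, volume B = b := ⟨_, (ENNReal.coe_toNNReal
    measure_ball_lt_top.ne).symm⟩
  obtain ⟨w, hw⟩ : ∃ w : NNReal, μ W = w := ⟨_, (ENNReal.coe_toNNReal hWt).symm⟩
  have hw0 : w ≠ 0 := by
    rintro rfl
    exact hW0 (by simpa using hw)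
  refine ⟨w⁻¹ * (L ^ d * b), r', hr', hB', fun A hA => ?_⟩
  set v := volume {t ∈ B' | cexp G t ∈ A}
  -- the bound for translation by a fixed element
  have h2 : ∀ x ∈ W, v ≤ L ^ d * volume {t ∈ B | x⁻¹ * cexp G t ∈ A} := by
    intro x hx
    obtain ⟨q, hq, hq'⟩ := h (coord d x) hx.1.2
    have h3 : {t ∈ B' | cexp G t ∈ A} ⊆ q '' {t ∈ B | x⁻¹ * cexp G t ∈ A} := by
      rintro t ⟨ht, htA⟩
      obtain ⟨t', ht', e1, e2⟩ := hq' t ht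
      rw [cexp_coord hx.1.1] at e2
      exact ⟨t', ⟨ht', by rwa [e2]⟩, e1⟩
    refine (measure_mono h3).trans ?_
    have h4 := (hq.mono (fun t ht => ht.1 :
      {t ∈ B | x⁻¹ * cexp G t ∈ A} ⊆ B)).hausdorffMeasure_image_le (Nat.cast_nonneg d : (0 : ℝ) ≤ d)
    have h5 := hausdorffMeasure_pi_real (ι := Fin d)
    rw [Fintype.card_fin] at h5
    rw [h5] at h4
    simpa using h4
  -- a measurable version of the coordinates
  classical
  let p : (Fin d → ℝ) → G := B.piecewise (cexp G) fun _ => 1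
  have hp : Measurable p :=
    (continuousOn_cexp.mono hB).measurable_piecewise continuousOn_const
      measurableSet_ball
  have h6 : ∀ x, volume {t ∈ B | x⁻¹ * cexp G t ∈ A} =
      ∫⁻ t in B, A.indicator (fun _ => 1) (x⁻¹ * p t) := by
    intro x
    have hm : MeasurableSet {t | x⁻¹ * p t ∈ A} := (hp.const_mul x⁻¹) hA
    have e : ∀ t, A.indicator (fun _ => (1 : ℝ≥0∞)) (x⁻¹ * p t) =
        {t | x⁻¹ * p t ∈ A}.indicator 1 t := fun t => rfl
    simp only [e]
    rw [lintegral_indicator_one hm, Measure.restrict_apply hm]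
    congr 1
    ext t
    simp only [mem_ofPred_eq, mem_inter_iff]
    constructor
    · rintro ⟨h7, h8⟩
      exact ⟨by simpa [p, h7] using h8, h7⟩
    · rintro ⟨h7, h8⟩
      exact ⟨h8, by simpa [p, h8] using h7⟩
  have hmeas : Measurable fun z : G × (Fin d → ℝ) =>
      A.indicator (fun _ => (1 : ℝ≥0∞)) (z.1⁻¹ * p z.2) :=
    (measurable_const.indicator hA).comp (measurable_fst.inv.mul (hp.comp measurable_snd))
  -- average the bound over the elements `x` of the neighbourhood `W` of `1`
  have h9 : v * μ W ≤ L ^ d * (b * μ A) := by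
    calc v * μ W = ∫⁻ x in W, v ∂μ := by rw [setLIntegral_const]
      _ ≤ ∫⁻ x in W, L ^ d * (∫⁻ t in B, A.indicator (fun _ => 1) (x⁻¹ * p t)) ∂μ :=
          setLIntegral_mono' hWo.measurableSet fun x hx => by
            rw [← h6]; exact h2 x hx
      _ ≤ ∫⁻ x, L ^ d * (∫⁻ t in B, A.indicator (fun _ => 1) (x⁻¹ * p t)) ∂μ :=
          setLIntegral_le_lintegral _ _
      _ = L ^ d * ∫⁻ x, (∫⁻ t in B, A.indicator (fun _ => 1) (x⁻¹ * p t)) ∂μ := by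
          rw [lintegral_const_mul' _ _ (by finiteness)]
      _ = L ^ d * ∫⁻ t in B, (∫⁻ x, A.indicator (fun _ => 1) (x⁻¹ * p t) ∂μ) := by
          rw [lintegral_lintegral_swap hmeas.aemeasurable]
      _ = L ^ d * ∫⁻ _ in B, μ A := by
          congr 1
          refine lintegral_congr fun t => ?_
          have e1 := lintegral_inv_eq_self (μ := μ)
            (fun x => A.indicator (fun _ => (1 : ℝ≥0∞)) (x * p t))
          refine e1.trans ?_
          rw [lintegral_mul_right_eq_self (fun x => A.indicator (fun _ => (1 : ℝ≥0∞)) x) (p t)]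
          exact lintegral_indicator_one hA
      _ = L ^ d * (b * μ A) := by rw [setLIntegral_const, hb, mul_comm (μ A)]
  rw [hw] at h9
  have hw0' : (w : ℝ≥0∞) ≠ 0 := by exact_mod_cast hw0
  rw [← ENNReal.le_div_iff_mul_le (Or.inl hw0') (Or.inl ENNReal.coe_ne_top)] at h9
  refine h9.trans (le_of_eq ?_)
  rw [ENNReal.div_eq_inv_mul]
  push_cast
  rw [ENNReal.coe_inv hw0]
  ring

end HaarCoordinates

/-! ### Averages over a cube -/

section Cube

variable {d : ℕ}

variable (d) in
/-- Lebesgue measure on the unit cube. -/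
def cubeMeasure : Measure (Fin d → ℝ) := Measure.pi fun _ => volume.restrict (Icc (0 : ℝ) 1)

theorem cubeMeasure_eq : cubeMeasure d = volume.restrict (Icc 0 1) := by
  rw [cubeMeasure, ← Measure.restrict_pi_pi, ← volume_pi, pi_univ_Icc]
  rfl

instance : IsProbabilityMeasure (volume.restrict (Icc (0 : ℝ) 1)) := ⟨by simp⟩

instance : IsProbabilityMeasure (cubeMeasure d) := by
  unfold cubeMeasure
  infer_instance

theorem ae_mem_cube : ∀ᵐ t ∂(cubeMeasure d), t ∈ Icc (0 : Fin d → ℝ) 1 := by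
  rw [cubeMeasure_eq]
  exact ae_restrict_mem measurableSet_Icc

/-- Resampling one coordinate preserves the measure on the cube. -/
theorem measurePreserving_update (m : Fin d) :
    MeasurePreserving (fun p : (Fin d → ℝ) × ℝ => Function.update p.1 m p.2)
      ((cubeMeasure d).prod (volume.restrict (Icc (0 : ℝ) 1))) (cubeMeasure d) := by
  have hm : Measurable fun p : (Fin d → ℝ) × ℝ => Function.update p.1 m p.2 := by
    refine measurable_pi_iff.2 fun i => ?_
    by_cases hi : i = m
    · subst hi; simpa using measurable_snd
    · simp only [Function.update_of_ne hi]; fun_prop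
  refine ⟨hm, ?_⟩
  symm
  refine Measure.pi_eq fun s hs => ?_
  rw [Measure.map_apply hm (MeasurableSet.univ_pi hs)]
  have e : (fun p : (Fin d → ℝ) × ℝ => Function.update p.1 m p.2) ⁻¹' univ.pi s =
      (univ.pi (Function.update s m univ)) ×ˢ s m := by
    ext ⟨t, r⟩
    simp only [mem_preimage, mem_univ_pi, mem_prod]
    constructor
    · intro h
      refine ⟨fun i => ?_, by simpa using h m⟩
      by_cases hi : i = m
      · subst hi; simp
      · simpa [Function.update_of_ne hi] using h i
    · rintro ⟨h1, h2⟩ i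
      by_cases hi : i = m
      · subst hi; simpa using h2
      · simpa [Function.update_of_ne hi] using h1 i
  rw [e, Measure.prod_prod, cubeMeasure, Measure.pi_pi]
  rw [← Finset.mul_prod_erase _ _ (Finset.mem_univ m),
    ← Finset.mul_prod_erase _ (fun i => (volume.restrict (Icc (0 : ℝ) 1)) (s i))
      (Finset.mem_univ m), Function.update_self, measure_univ, one_mul, mul_comm]
  congr 1
  refine Finset.prod_congr rfl fun i hi => ?_
  rw [Function.update_of_ne (Finset.ne_of_mem_erase hi)]

end Cube

/-! ### Smooth functions as sums of averages of their derivatives -/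

section Averages

variable {d : ℕ} {G : Type u} [Group G] [TopologicalSpace G] [IsTopologicalGroup G]

/-- Retain the coordinates in `S` and set the others to `0`. -/
def restrictCoords (S : Finset (Fin d)) (t : Fin d → ℝ) : Fin d → ℝ := S.piecewise t 0

theorem continuous_restrictCoords (S : Finset (Fin d)) : Continuous (restrictCoords S) := by
  refine continuous_pi fun i => ?_
  by_cases hi : i ∈ S
  · simpa [restrictCoords, hi] using continuous_apply i
  · simpa [restrictCoords, hi] using continuous_const

theorem restrictCoords_mem_cube (S : Finset (Fin d)) {t : Fin d → ℝ} (ht : t ∈ Icc 0 1) :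
    restrictCoords S t ∈ Icc 0 1 := by
  refine ⟨fun i => ?_, fun i => ?_⟩ <;> by_cases hi : i ∈ S
  · simpa [restrictCoords, hi] using ht.1 i
  · simp [restrictCoords, hi]
  · simpa [restrictCoords, hi] using ht.2 i
  · simp [restrictCoords, hi]

theorem restrictCoords_insert_update {S : Finset (Fin d)} {m : Fin d} (hm : m ∉ S)
    (t : Fin d → ℝ) (r : ℝ) : restrictCoords (insert m S) (Function.update t m r) =
      Function.update (restrictCoords S t) m r := by
  ext i
  by_cases hi : i = m
  · subst hi; simp [restrictCoords]
  · by_cases hS : i ∈ S <;> simp [restrictCoords, hi, hS]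

theorem restrictCoords_update {S : Finset (Fin d)} {m : Fin d} (hm : m ∉ S)
    (t : Fin d → ℝ) (r : ℝ) : restrictCoords S (Function.update (restrictCoords S t) m r) =
      restrictCoords S t := by
  ext i
  by_cases hi : i = m
  · subst hi; simp [restrictCoords, hm]
  · by_cases hS : i ∈ S <;> simp [restrictCoords, hS, Function.update_of_ne hi]

theorem update_mem_cube {t : Fin d → ℝ} (ht : t ∈ Icc 0 1) (m : Fin d) {r : ℝ}
    (hr : r ∈ Icc (0 : ℝ) 1) : Function.update t m r ∈ Icc 0 1 := by
  refine ⟨fun i => ?_, fun i => ?_⟩ <;> by_cases hi : i = m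
  · subst hi; simpa using hr.1
  · simpa [Function.update_of_ne hi] using ht.1 i
  · subst hi; simpa using hr.2
  · simpa [Function.update_of_ne hi] using ht.2 i

/-- Integration by parts against `1 - r`, which vanishes at the end point `1`. -/
theorem eq_integral_sub_integral_deriv {p p' : ℝ → ℂ}
    (hp : ∀ r ∈ Icc (0 : ℝ) 1, HasDerivAt p (p' r) r) (hp' : ContinuousOn p' (Icc 0 1)) :
    p 0 = ∫ r in Icc (0 : ℝ) 1, (p r - (1 - r) * p' r) := by
  have hu : uIcc (0 : ℝ) 1 = Icc 0 1 := uIcc_of_le zero_le_one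
  have hpc : ContinuousOn p (Icc 0 1) := fun r hr => (hp r hr).continuousAt.continuousWithinAt
  have h1 := intervalIntegral.integral_mul_deriv_eq_deriv_mul (a := 0) (b := 1)
    (u := fun r : ℝ => ((1 - r : ℝ) : ℂ)) (u' := fun _ => -1) (v := p) (v' := p')
    (fun r _ => by
      have := ((hasDerivAt_const r (1 : ℝ)).sub (hasDerivAt_id r)).ofReal_comp
      simpa using this)
    (fun r hr => hp r (hu ▸ hr)) intervalIntegrable_const
    (by rw [← hu] at hp'; exact hp'.intervalIntegrable)
  rw [integral_Icc_eq_integral_Ioc, ← intervalIntegral.integral_of_le zero_le_one,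
    intervalIntegral.integral_sub]
  · push_cast at h1
    rw [h1]
    simp
  · rw [← hu] at hpc; exact hpc.intervalIntegrable
  · refine ContinuousOn.intervalIntegrable ?_
    rw [hu]
    exact ContinuousOn.mul (by fun_prop) hp'

/-- The functions `x ↦ ∫ Ψ(P t) F(x Φ(P t)) dt` on `G`, where `P` is the projection of the cube
to the coordinates in `S`. -/
def cubeAverages (𝒮 : Set (G → ℂ)) (Φ : (Fin d → ℝ) → G) (S : Finset (Fin d)) : Set (G → ℂ) :=
  {h | ∃ F ∈ 𝒮, ∃ Ψ : (Fin d → ℝ) → ℂ, Measurable Ψ ∧ (∃ c : ℝ, ∀ t, ‖Ψ t‖ ≤ c) ∧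
    h = fun x => ∫ t, Ψ (restrictCoords S t) * F (x * Φ (restrictCoords S t)) ∂(cubeMeasure d)}

theorem integrable_restrictCoords {Φ : (Fin d → ℝ) → G} (hΦ : ContinuousOn Φ (Icc 0 1))
    {F : G → ℂ} (hF : Continuous F) {Ψ : (Fin d → ℝ) → ℂ} (hΨ : Measurable Ψ)
    (hΨ' : ∃ c : ℝ, ∀ t, ‖Ψ t‖ ≤ c) (x : G) (S : Finset (Fin d)) :
    Integrable (fun t => Ψ (restrictCoords S t) * F (x * Φ (restrictCoords S t)))
      (cubeMeasure d) := by
  obtain ⟨c, hc⟩ := hΨ'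
  refine Integrable.bdd_mul (c := c) ?_
    (hΨ.comp (continuous_restrictCoords S).measurable).aestronglyMeasurable
    (Eventually.of_forall fun t => hc _)
  rw [cubeMeasure_eq]
  refine ContinuousOn.integrableOn_compact isCompact_Icc
    (hF.comp_continuousOn (continuousOn_const.mul ?_))
  exact hΦ.comp (continuous_restrictCoords S).continuousOn fun t ht =>
    restrictCoords_mem_cube S ht

/-- One more coordinate: a function is the average of itself over a segment minus a weighted
average of its derivative. -/
theorem mem_span_cubeAverages_insert {𝒮 : Set (G → ℂ)} {Φ : (Fin d → ℝ) → G}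
    (hΦ : ContinuousOn Φ (Icc 0 1)) (hcont : ∀ F ∈ 𝒮, Continuous F)
    {X : Fin d → (G → ℂ) → G → ℂ} (hX : ∀ j, ∀ F ∈ 𝒮, X j F ∈ 𝒮)
    {ξ : Fin d → Fin d → (Fin d → ℝ) → ℝ} (hξ : ∀ m j, ContinuousOn (ξ m j) (Icc 0 1))
    (hderiv : ∀ F ∈ 𝒮, ∀ x, ∀ t ∈ Icc (0 : Fin d → ℝ) 1, ∀ m,
      HasDerivAt (fun r => F (x * Φ (Function.update t m r)))
        (∑ j, (ξ m j t : ℂ) * X j F (x * Φ t)) (t m))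
    {S : Finset (Fin d)} {m : Fin d} (hm : m ∉ S) :
    cubeAverages 𝒮 Φ S ⊆ Submodule.span ℂ (cubeAverages 𝒮 Φ (insert m S)) := by
  rintro h ⟨F, hF, Ψ, hΨ, ⟨c, hc⟩, rfl⟩
  have hc0 : 0 ≤ c := (norm_nonneg _).trans (hc 0)
  let Ψ₀ : (Fin d → ℝ) → ℂ := fun t => Ψ (restrictCoords S t)
  let η : Fin d → (Fin d → ℝ) → ℂ := fun j =>
    (Icc (0 : Fin d → ℝ) 1).indicator fun t => -((1 - t m : ℝ) * ξ m j t : ℂ)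
  let Ψ₁ : Fin d → (Fin d → ℝ) → ℂ := fun j t => Ψ (restrictCoords S t) * η j t
  have hηc : ∀ j, ContinuousOn (fun t : Fin d → ℝ => -((1 - t m : ℝ) * ξ m j t : ℂ)) (Icc 0 1) :=
    fun j => ContinuousOn.neg (ContinuousOn.mul (by fun_prop)
      (Complex.continuous_ofReal.comp_continuousOn (hξ m j)))
  have hη : ∀ j, Measurable (η j) := fun j => by
    classical
    have := (hηc j).measurable_piecewise (g := fun _ => 0) continuousOn_const measurableSet_Icc
    rwa [show (fun _ : Fin d → ℝ => (0 : ℂ)) = 0 from rfl, piecewise_eq_indicator] at this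
  have hηb : ∀ j, ∃ c' : ℝ, ∀ t, ‖η j t‖ ≤ c' := fun j => by
    obtain ⟨c', hc'⟩ := isCompact_Icc.exists_bound_of_continuousOn (hηc j)
    refine ⟨max c' 0, fun t => ?_⟩
    by_cases ht : t ∈ Icc (0 : Fin d → ℝ) 1
    · simp only [η, indicator_of_mem ht]
      exact (hc' t ht).trans (le_max_left _ _)
    · simp only [η, indicator_of_notMem ht, norm_zero]
      exact le_max_right _ _
  have hΨ₀ : Measurable Ψ₀ := hΨ.comp (continuous_restrictCoords S).measurable
  have hΨ₀b : ∃ c : ℝ, ∀ t, ‖Ψ₀ t‖ ≤ c := ⟨c, fun t => hc _⟩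
  have hΨ₁ : ∀ j, Measurable (Ψ₁ j) := fun j => hΨ₀.mul (hη j)
  have hΨ₁b : ∀ j, ∃ c' : ℝ, ∀ t, ‖Ψ₁ j t‖ ≤ c' := fun j => by
    obtain ⟨c', hc'⟩ := hηb j
    refine ⟨c * c', fun t => ?_⟩
    rw [norm_mul]
    exact mul_le_mul (hc _) (hc' t) (norm_nonneg _) hc0
  let T := insert m S
  have key : (fun x => ∫ t, Ψ (restrictCoords S t) * F (x * Φ (restrictCoords S t))
      ∂(cubeMeasure d)) =
      (fun x => ∫ t, Ψ₀ (restrictCoords T t) * F (x * Φ (restrictCoords T t)) ∂(cubeMeasure d)) +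
        ∑ j, fun x => ∫ t, Ψ₁ j (restrictCoords T t) * X j F (x * Φ (restrictCoords T t))
          ∂(cubeMeasure d) := by
    funext x
    rw [Pi.add_apply, Finset.sum_apply]
    have i0 := integrable_restrictCoords hΦ (hcont F hF) hΨ₀ hΨ₀b x T
    have i1 : ∀ j, Integrable (fun t => Ψ₁ j (restrictCoords T t) *
        X j F (x * Φ (restrictCoords T t))) (cubeMeasure d) := fun j =>
      integrable_restrictCoords hΦ (hcont _ (hX j F hF)) (hΨ₁ j) (hΨ₁b j) x T
    rw [← integral_finsetSum _ fun j _ => i1 j, ← integral_add i0 (integrable_finsetSum _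
      fun j _ => i1 j)]
    set K : (Fin d → ℝ) → ℂ := fun t => Ψ₀ (restrictCoords T t) * F (x * Φ (restrictCoords T t)) +
      ∑ j, Ψ₁ j (restrictCoords T t) * X j F (x * Φ (restrictCoords T t)) with hK
    have iK : Integrable K (cubeMeasure d) := i0.add (integrable_finsetSum _ fun j _ => i1 j)
    have hmp := measurePreserving_update m
    have e1 : ∫ t, K t ∂(cubeMeasure d) =
        ∫ t, (∫ r in Icc (0 : ℝ) 1, K (Function.update t m r)) ∂(cubeMeasure d) := by
      have e2 := hmp.integrable_comp_of_integrable iK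
      rw [← integral_prod (fun p : (Fin d → ℝ) × ℝ => K (Function.update p.1 m p.2)) e2]
      have h3 := integral_map hmp.measurable.aemeasurable (hmp.map_eq.symm ▸ iK.1)
      rw [hmp.map_eq] at h3
      exact h3
    rw [e1]
    refine integral_congr_ae ?_
    filter_upwards [ae_mem_cube] with t ht
    have hmem : ∀ r ∈ Icc (0 : ℝ) 1, Function.update (restrictCoords S t) m r ∈
        Icc (0 : Fin d → ℝ) 1 := fun r hr => update_mem_cube (restrictCoords_mem_cube S ht) m hr
    have hcu : Continuous fun r : ℝ => Function.update (restrictCoords S t) m r :=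
      continuous_const.update m continuous_id
    have h4 := eq_integral_sub_integral_deriv
      (p := fun r => F (x * Φ (Function.update (restrictCoords S t) m r)))
      (p' := fun r => ∑ j, (ξ m j (Function.update (restrictCoords S t) m r) : ℂ) *
        X j F (x * Φ (Function.update (restrictCoords S t) m r)))
      (fun r hr => by
        have h5 := hderiv F hF x _ (hmem r hr) m
        simpa only [Function.update_idem, Function.update_self] using h5)
      (by
        refine continuousOn_finsetSum _ fun j _ => ContinuousOn.mul ?_ ?_
        · exact Complex.continuous_ofReal.comp_continuousOn
            ((hξ m j).comp hcu.continuousOn hmem)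
        · exact (hcont _ (hX j F hF)).comp_continuousOn (continuousOn_const.mul
            (hΦ.comp hcu.continuousOn hmem)))
    have hz : Function.update (restrictCoords S t) m 0 = restrictCoords S t := by
      rw [Function.update_eq_self_iff]
      simp [restrictCoords, hm]
    rw [hz] at h4
    rw [h4, ← integral_const_mul]
    refine setIntegral_congr_fun measurableSet_Icc fun r hr => ?_
    simp only [hK, T, restrictCoords_insert_update hm, Ψ₀, Ψ₁, restrictCoords_update hm, η,
      indicator_of_mem (hmem r hr), Function.update_self]
    rw [mul_sub, sub_eq_add_neg, Finset.mul_sum, Finset.mul_sum, ← Finset.sum_neg_distrib]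
    congr 1
    refine Finset.sum_congr rfl fun j _ => ?_
    push_cast
    ring
  rw [key]
  refine Submodule.add_mem _ (Submodule.subset_span ⟨F, hF, Ψ₀, hΨ₀, hΨ₀b, rfl⟩)
    (Submodule.sum_mem _ fun j _ => Submodule.subset_span
      ⟨X j F, hX j F hF, Ψ₁ j, hΨ₁ j, hΨ₁b j, rfl⟩)

/-- Starting from `F`, the average over the single point `Φ 0 = 1`, the coordinates are added one at
a time. The hypothesis `hderiv` says that coordinate derivatives are combinations of the operations
`X j` with coefficients `ξ` independent of the function and of `x`. -/
theorem mem_span_cubeAverages {𝒮 : Set (G → ℂ)} {Φ : (Fin d → ℝ) → G}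
    (hΦ : ContinuousOn Φ (Icc 0 1)) (hΦ0 : Φ 0 = 1) (hcont : ∀ F ∈ 𝒮, Continuous F)
    {X : Fin d → (G → ℂ) → G → ℂ} (hX : ∀ j, ∀ F ∈ 𝒮, X j F ∈ 𝒮)
    {ξ : Fin d → Fin d → (Fin d → ℝ) → ℝ} (hξ : ∀ m j, ContinuousOn (ξ m j) (Icc 0 1))
    (hderiv : ∀ F ∈ 𝒮, ∀ x, ∀ t ∈ Icc (0 : Fin d → ℝ) 1, ∀ m,
      HasDerivAt (fun r => F (x * Φ (Function.update t m r)))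
        (∑ j, (ξ m j t : ℂ) * X j F (x * Φ t)) (t m))
    {F : G → ℂ} (hF : F ∈ 𝒮) :
    F ∈ Submodule.span ℂ (cubeAverages 𝒮 Φ (Finset.univ : Finset (Fin d))) := by
  suffices h : ∀ S : Finset (Fin d), F ∈ Submodule.span ℂ (cubeAverages 𝒮 Φ S) from h _
  intro S
  induction S using Finset.induction_on with
  | empty =>
    refine Submodule.subset_span ⟨F, hF, fun _ => 1, measurable_const, ⟨1, fun t => by simp⟩, ?_⟩
    funext x
    have : ∀ t : Fin d → ℝ, restrictCoords ∅ t = 0 := fun t => by simp [restrictCoords]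
    simp [this, hΦ0]
  | insert m S hm ih =>
    exact Submodule.span_le.2 (mem_span_cubeAverages_insert hΦ hcont hX hξ hderiv hm) ih

end Averages

/-! ### Smooth functions as sums of convolutions -/

section Factorization

variable {d : ℕ} {G : Type u} [Group G] [TopologicalSpace G]
  [ChartedSpace (EuclideanSpace ℝ (Fin d)) G] [LieGroup (𝓡 d) ∞ G] [IsTopologicalGroup G]

/-- The derivative of `F` along a coordinate line, in terms of left invariant derivatives. -/
theorem hasDerivAt_comp_cexp {F : G → ℂ} (hF : ContMDiff (𝓡 d) 𝓘(ℝ, ℂ) ∞ F) (x : G) (ε : ℝ)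
    {t : Fin d → ℝ} (ht : ε • t ∈ coordTarget d G) (m : Fin d) :
    HasDerivAt (fun r => F (x * cexp G (ε • Function.update t m r)))
      (∑ j, ((fderiv ℝ (fun s => cdiv G (ε • t, s)) (ε • t) (ε • Pi.single m 1) j : ℝ) : ℂ) *
        leftInvDeriv (coordVec G (Pi.single j 1)) F (x * cexp G (ε • t))) (t m) := by
  obtain ⟨L, hL, hL'⟩ := hasFDerivAt_comp_cexp hF x ht
  have h1 : HasDerivAt (fun r => ε • Function.update t m r) (ε • Pi.single m (1 : ℝ)) (t m) :=
    (hasDerivAt_update t m (t m)).const_smul ε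
  have h2 : ε • Function.update t m (t m) = ε • t := by rw [Function.update_eq_self]
  have h3 : HasDerivAt (fun r => F (x * cexp G (ε • Function.update t m r)))
      (L (ε • Pi.single m (1 : ℝ))) (t m) :=
    HasFDerivAt.comp_hasDerivAt (l := fun s => F (x * cexp G s)) (t m) (by rwa [h2]) h1
  rw [hL', coordVec_sum] at h3
  simpa using h3

theorem continuousOn_fderiv_cdiv (v : Fin d → ℝ) :
    ContinuousOn (fun t => fderiv ℝ (fun s => cdiv G (t, s)) t v) (coordTarget d G) := by
  intro t ht
  refine ContinuousAt.continuousWithinAt ?_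
  have hsrc : (1 : G) ∈ (extChartAt (𝓡 d) (1 : G)).source := mem_extChartAt_source _
  have h : ∀ t ∈ coordTarget d G, ContDiffAt ℝ ∞ (cdiv G) (t, t) := fun t ht =>
    contDiffAt_cdiv ht ht (by simp)
  have h1 : ∀ᶠ s in 𝓝 t, fderiv ℝ (fun s' => cdiv G (s, s')) s v =
      fderiv ℝ (cdiv G) (s, s) ((0 : Fin d → ℝ), v) := by
    filter_upwards [isOpen_coordTarget.mem_nhds ht] with s hs
    have h2 : HasFDerivAt (fun s' : Fin d → ℝ => (s, s'))
        (ContinuousLinearMap.inr ℝ (Fin d → ℝ) (Fin d → ℝ)) s := hasFDerivAt_prodMk_right s s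
    have h3 := (((h s hs).differentiableAt (by simp)).hasFDerivAt.comp s h2).fderiv
    exact congrArg (fun A => A v) h3
  refine ContinuousAt.congr_of_eventuallyEq ?_ h1
  have h4 : ContinuousAt (fderiv ℝ (cdiv (d := d) G)) (t, t) :=
    ((h t ht).fderiv_right (m := ∞) le_rfl).continuousAt
  have h5 : ContinuousAt (fun s : Fin d → ℝ => (s, s)) t := by fun_prop
  exact (ContinuousAt.comp (f := fun s : Fin d → ℝ => (s, s)) h4 h5).clm_apply continuousAt_const

variable [LocallyCompactSpace G] [T2Space G] [SecondCountableTopology G] [MeasurableSpace G]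
  [BorelSpace G] {μ : Measure G} [μ.IsHaarMeasure] [μ.IsMulRightInvariant] [μ.IsInvInvariant]

/-- An average over a small cube is a right convolution with a bounded function of compact
support. -/
theorem exists_conv_eq_cubeAverage {C : NNReal} {r : ℝ}
    (hr : Metric.ball (0 : Fin d → ℝ) r ⊆ coordTarget d G)
    (hC : ∀ A : Set G, MeasurableSet A →
      volume {t ∈ Metric.ball (0 : Fin d → ℝ) r | cexp G t ∈ A} ≤ C * μ A)
    {ε : ℝ} (hε : 0 < ε) (hεr : ∀ t ∈ Icc (0 : Fin d → ℝ) 1, ε • t ∈ Metric.ball 0 r)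
    {Ψ : (Fin d → ℝ) → ℂ} (hΨ : Measurable Ψ) (hΨ' : ∃ c : ℝ, ∀ t, ‖Ψ t‖ ≤ c) :
    ∃ E : G → ℂ, IsBddCompact E ∧ ∀ F : G → ℂ, Continuous F → ∀ x,
      ∫ t, Ψ t * F (x * cexp G (ε • t)) ∂(cubeMeasure d) = conv μ F E x := by
  classical
  obtain ⟨c, hc⟩ := hΨ'
  have hc0 : 0 ≤ c := (norm_nonneg _).trans (hc 0)
  set Q := Icc (0 : Fin d → ℝ) 1
  let Φ : (Fin d → ℝ) → G := fun t => cexp G (ε • t)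
  have hΦ : ContinuousOn Φ Q := continuousOn_cexp.comp (by fun_prop) fun t ht => hr (hεr t ht)
  have hΦm : AEMeasurable Φ (cubeMeasure d) := by
    rw [cubeMeasure_eq]
    exact hΦ.aemeasurable measurableSet_Icc
  have hcomp : IsCompact (Φ '' Q) := isCompact_Icc.image_of_continuousOn hΦ
  let lam := (cubeMeasure d).map Φ
  have hlamp : IsProbabilityMeasure lam := Measure.isProbabilityMeasure_map hΦm
  -- the factor `ε⁻ᵈ` comes from the scaling `t ↦ ε • t`
  let C' : NNReal := (Real.toNNReal (ε ^ d))⁻¹ * C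
  have hlam : ∀ A : Set G, MeasurableSet A → lam A ≤ C' * μ A := by
    intro A hA
    rw [Measure.map_apply_of_aemeasurable hΦm hA, cubeMeasure_eq]
    have h1 : (volume.restrict Q) (Φ ⁻¹' A) ≤
        volume ((fun t : Fin d → ℝ => ε • t) ⁻¹'
          {t ∈ Metric.ball (0 : Fin d → ℝ) r | cexp G t ∈ A}) := by
      rw [Measure.restrict_apply' measurableSet_Icc]
      exact measure_mono fun t ht => ⟨hεr t ht.2, ht.1⟩
    refine h1.trans ?_
    rw [Measure.addHaar_preimage_smul volume hε.ne']
    simp only [Module.finrank_fintype_fun_eq_card, Fintype.card_fin]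
    have h2 : ENNReal.ofReal |(ε ^ d)⁻¹| = ((Real.toNNReal (ε ^ d))⁻¹ : NNReal) := by
      rw [abs_of_pos (by positivity), ← Real.toNNReal_inv]
      rfl
    rw [h2, ENNReal.coe_mul, mul_assoc]
    gcongr
    exact hC A hA
  have hac : lam ≪ μ := by
    refine Measure.AbsolutelyContinuous.mk fun A hA h0 => ?_
    have := hlam A hA
    rwa [h0, mul_zero, nonpos_iff_eq_zero] at this
  have hρ' : ∀ᵐ x ∂μ, lam.rnDeriv μ x ≤ C' := by
    refine ae_le_of_forall_setLIntegral_le_of_sigmaFinite (Measure.measurable_rnDeriv _ _)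
      fun A hA _ => ?_
    rw [setLIntegral_const]
    exact (Measure.setLIntegral_rnDeriv_le A).trans (hlam A hA)
  -- the density of `lam` with respect to Haar measure, truncated so as to be bounded everywhere
  let ρ : G → ℝ≥0∞ := fun x => min (lam.rnDeriv μ x) C'
  have hρm : Measurable ρ := (Measure.measurable_rnDeriv _ _).min measurable_const
  have hwd : μ.withDensity ρ = lam := by
    rw [← Measure.withDensity_rnDeriv_eq lam μ hac]
    refine withDensity_congr_ae ?_
    filter_upwards [hρ'] with x hx
    exact min_eq_left hx
  -- a measurable left inverse of `Φ` on the cube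
  let θ : G → Fin d → ℝ :=
    (extChartAt (𝓡 d) (1 : G)).source.piecewise (fun w => ε⁻¹ • coord d w) fun _ => 0
  have hθm : Measurable θ :=
    (continuousOn_coord.const_smul ε⁻¹).measurable_piecewise continuousOn_const
      (isOpen_extChartAt_source (1 : G)).measurableSet
  have hθ : ∀ t ∈ Q, θ (Φ t) = t := by
    intro t ht
    have h1 := hr (hεr t ht)
    simp only [θ, Φ]
    rw [piecewise_eq_of_mem _ _ _ (cexp_mem_source h1), coord_cexp h1, smul_smul,
      inv_mul_cancel₀ hε.ne', one_smul]
  -- the weight `Ψ`, transported to `G`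
  let k : G → ℂ := (Φ '' Q).indicator fun w => Ψ (θ w)
  have hkm : Measurable k := (hΨ.comp hθm).indicator hcomp.measurableSet
  have hkb : ∀ w, ‖k w‖ ≤ c := fun w => by
    by_cases hw : w ∈ Φ '' Q
    · simpa only [k, indicator_of_mem hw] using hc _
    · simpa only [k, indicator_of_notMem hw, norm_zero] using hc0
  let E' : G → ℂ := fun w => ((ρ w).toReal : ℂ) * k w
  have hE'm : Measurable E' := (Complex.measurable_ofReal.comp hρm.ennreal_toReal).mul hkm
  have hρle : ∀ w, (ρ w).toReal ≤ C' := fun w =>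
    ENNReal.toReal_mono ENNReal.coe_ne_top (min_le_right _ _)
  refine ⟨fun w => E' w⁻¹, ⟨hE'm.comp measurable_inv, ⟨C' * c.toNNReal, fun w => ?_⟩,
    (Φ '' Q)⁻¹, hcomp.inv, fun w hw => ?_⟩, fun F hF x => ?_⟩
  · rw [← enorm_norm, Real.enorm_eq_ofReal (norm_nonneg _), ENNReal.ofReal_le_iff_le_toReal (by
      finiteness)]
    simp only [E', norm_mul, Complex.norm_real, Real.norm_eq_abs, abs_of_nonneg
      ENNReal.toReal_nonneg]
    rw [ENNReal.coe_toReal, NNReal.coe_mul, Real.coe_toNNReal _ hc0]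
    exact mul_le_mul (hρle _) (hkb _) (norm_nonneg _) (NNReal.coe_nonneg _)
  · have : w⁻¹ ∉ Φ '' Q := fun h => hw (by simpa using h)
    simp only [E', k, indicator_of_notMem this, mul_zero]
  · have h1 : ∫ t, Ψ t * F (x * cexp G (ε • t)) ∂(cubeMeasure d) =
        ∫ t, (fun w => k w * F (x * w)) (Φ t) ∂(cubeMeasure d) := by
      refine integral_congr_ae ?_
      filter_upwards [ae_mem_cube] with t ht
      have hw : Φ t ∈ Φ '' Q := ⟨t, ht, rfl⟩
      simp only [k, indicator_of_mem hw, hθ t ht]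
      rfl
    have hm : Measurable fun w => k w * F (x * w) :=
      hkm.mul (hF.comp (continuous_const_mul x)).measurable
    rw [h1, ← integral_map hΦm hm.aestronglyMeasurable,
      show (cubeMeasure d).map Φ = lam from rfl, ← hwd,
      integral_withDensity_eq_integral_toReal_smul hρm (Eventually.of_forall fun w =>
        (min_le_right _ _).trans_lt ENNReal.coe_lt_top), conv,
      ← integral_mul_left_eq_self (fun v => F v * E' (v⁻¹ * x)⁻¹) x]
    refine integral_congr_ae (Eventually.of_forall fun w => ?_)
    simp only [E', mul_inv_rev, inv_mul_cancel_left, inv_inv, Complex.real_smul]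
    ring

/-- A smooth function all of whose left invariant derivatives are integrable is a sum of
convolutions `F * E` of functions `F` of the same kind with bounded functions `E` of compact
support. -/
theorem IsSmoothL1.mem_span_conv {f : G → ℂ} (hf : IsSmoothL1 d μ f) :
    f ∈ Submodule.span ℂ {h : G → ℂ | ∃ F E : G → ℂ, IsSmoothL1 d μ F ∧ IsBddCompact E ∧
      h = conv μ F E} := by
  obtain ⟨C, r, hr0, hr, hC⟩ := exists_volume_le (d := d) (μ := μ)
  set ε := r / 2
  have hε : 0 < ε := half_pos hr0
  have hεr : ∀ t ∈ Icc (0 : Fin d → ℝ) 1, ε • t ∈ Metric.ball (0 : Fin d → ℝ) r := by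
    intro t ht
    rw [mem_ball_zero_iff, norm_smul, Real.norm_eq_abs, abs_of_pos hε]
    have h1 : ‖t‖ ≤ 1 := (pi_norm_le_iff_of_nonneg zero_le_one).2 fun i => by
      rw [Real.norm_eq_abs, abs_of_nonneg (ht.1 i)]
      exact ht.2 i
    calc ε * ‖t‖ ≤ ε * 1 := by gcongr
      _ < r := by rw [mul_one]; exact half_lt_self hr0
  have hT : ∀ t ∈ Icc (0 : Fin d → ℝ) 1, ε • t ∈ coordTarget d G := fun t ht => hr (hεr t ht)
  have h := mem_span_cubeAverages (𝒮 := {F : G → ℂ | IsSmoothL1 d μ F})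
    (Φ := fun t => cexp G (ε • t)) (continuousOn_cexp.comp (by fun_prop) hT)
    (by simp [cexp_zero]) (fun F hF => hF.1.continuous)
    (X := fun j => leftInvDeriv (coordVec G (Pi.single j 1)))
    (fun j F hF => hF.isSmoothL1_leftInvDeriv _)
    (ξ := fun m j t => fderiv ℝ (fun s => cdiv G (ε • t, s)) (ε • t) (ε • Pi.single m 1) j)
    (fun m j => (continuous_apply j).comp_continuousOn
      ((continuousOn_fderiv_cdiv (G := G) (ε • Pi.single m 1)).comp
        (by fun_prop : Continuous fun t : Fin d → ℝ => ε • t).continuousOn hT))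
    (fun F hF x t ht m => hasDerivAt_comp_cexp hF.1 x ε (hT t ht) m) hf
  refine Submodule.span_mono ?_ h
  rintro _ ⟨F, hF, Ψ, hΨ, hΨ', rfl⟩
  obtain ⟨E, hE, hE'⟩ := exists_conv_eq_cubeAverage hr hC hε hεr hΨ hΨ'
  refine ⟨F, E, hF, hE, ?_⟩
  funext x
  rw [← hE' F hF.1.continuous x]
  simp only [restrictCoords, Finset.piecewise_univ]

variable {Γ : Subgroup G} [DiscreteTopology Γ]

/-- `(F * E)^* = E^* * F^*`, where `E^*` is bounded with compact support and `F^*` is integrable. -/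
theorem IsSmoothL1.isSupBounded_adjFun (hΓ : IsCocompact Γ) {f : G → ℂ}
    (hf : IsSmoothL1 d μ f) : IsSupBounded Γ μ (adjFun f) := by
  have h := hf.mem_span_conv
  clear hf
  induction h using Submodule.span_induction with
  | mem h hh =>
    obtain ⟨F, E, hF, hE, rfl⟩ := hh
    rw [adjFun_conv]
    exact (hE.adjFun.isSupBounded hΓ).conv_integrable
      (measurable_adjFun hF.1.continuous.measurable) (integrable_adjFun hF.integrable)
  | zero =>
    have : adjFun (0 : G → ℂ) = 0 := by funext x; simp [adjFun]
    rw [this]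
    exact IsSupBounded.zero
  | add f h _ _ hf hh =>
    rw [adjFun_add]
    exact hf.add hh
  | smul c f _ hf =>
    rw [adjFun_smul]
    exact hf.smul _

theorem IsSmoothL1.mem_span (hΓ : IsCocompact Γ) {f : G → ℂ} (hf : IsSmoothL1 d μ f) :
    f ∈ Submodule.span ℂ {f : G → ℂ | ∃ F E : G → ℂ, Measurable F ∧ Integrable F μ ∧
      IsSupBounded Γ μ (adjFun F) ∧ IsBddCompact E ∧ f = conv μ F E} := by
  refine Submodule.span_mono ?_ hf.mem_span_conv
  rintro _ ⟨F, E, hF, hE, rfl⟩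
  exact ⟨F, E, hF.1.continuous.measurable, hF.integrable, hF.isSupBounded_adjFun hΓ, hE, rfl⟩

end Factorization

/-! ### Quotient measures -/

section QuotientMeasure

variable {G : Type u} [Group G] [TopologicalSpace G] [IsTopologicalGroup G]
  [LocallyCompactSpace G] [T2Space G] [SecondCountableTopology G] [MeasurableSpace G]
  [BorelSpace G] {H : Subgroup G} {ν : Measure H} {μ : Measure G}

/-- For a closed unimodular subgroup `H` there is a function `w` on `G` whose integral over every
coset `H x` is `1`. -/
theorem exists_weight (hH : IsClosed (H : Set G)) [ν.IsHaarMeasure] [ν.IsMulRightInvariant] :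
    ∃ w : G → ℝ≥0∞, Measurable w ∧ ∀ x, ∫⁻ t : H, w (t * x) ∂ν = 1 := by
  let K := CompactExhaustion.choice G
  have hemb : Topology.IsClosedEmbedding ((↑) : H → G) := hH.isClosedEmbedding_subtypeVal
  have : LocallyCompactSpace H := hemb.locallyCompactSpace
  have : SecondCountableTopology H := hemb.isEmbedding.secondCountableTopology
  have : SigmaCompactSpace H := inferInstance
  have : SigmaFinite ν := inferInstance
  have hKm : ∀ n, MeasurableSet (K n) := fun n => (K.isCompact n).measurableSet
  let p : ℕ → G → ℝ≥0∞ := fun n => (K n).indicator fun _ => 1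
  have hp : ∀ n, Measurable (p n) := fun n => measurable_const.indicator (hKm n)
  -- the part of a coset `H x` in `K n` has measure at most `ν (C n)`
  let C : ℕ → Set H := fun n => {t | ∃ x ∈ K n, ∃ y ∈ K n, (t : G) = x * y⁻¹}
  have hC : ∀ n, IsCompact (C n) := fun n => by
    have h1 := hemb.isCompact_preimage
      (((K.isCompact n).prod (K.isCompact n)).image (f := fun q : G × G => q.1 * q.2⁻¹)
        (by fun_prop))
    convert h1 using 1
    ext t
    simp only [C, mem_ofPred_eq, mem_preimage, mem_image, mem_prod, Prod.exists]
    constructor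
    · rintro ⟨x, hx, y, hy, h⟩
      exact ⟨x, y, ⟨hx, hy⟩, h.symm⟩
    · rintro ⟨x, y, ⟨hx, hy⟩, h⟩
      exact ⟨x, hx, y, hy, h.symm⟩
  have hle : ∀ n x, ∫⁻ t : H, p n (t * x) ∂ν ≤ ν (C n) := by
    intro n x
    have e : ∫⁻ t : H, p n (t * x) ∂ν = ν {t : H | (t : G) * x ∈ K n} := by
      have hm : MeasurableSet {t : H | (t : G) * x ∈ K n} :=
        (measurable_subtype_coe.mul_const x) (hKm n)
      rw [← lintegral_indicator_one hm]
      rfl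
    rw [e]
    by_cases h : ∃ t₀ : H, (t₀ : G) * x ∈ K n
    · obtain ⟨t₀, ht₀⟩ := h
      have h1 : {t : H | (t : G) * x ∈ K n} ⊆ (fun t => t * t₀⁻¹) ⁻¹' C n := by
        intro t ht
        refine ⟨(t : G) * x, ht, (t₀ : G) * x, ht₀, ?_⟩
        push_cast
        group
      refine (measure_mono h1).trans (le_of_eq ?_)
      exact measure_preimage_mul_right ν t₀⁻¹ (C n)
    · have : {t : H | (t : G) * x ∈ K n} = ∅ := eq_empty_of_forall_notMem fun t ht => h ⟨t, ht⟩
      rw [this, measure_empty]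
      exact bot_le
  -- weights `δ n > 0` with `∑ ν (C n) δ n < 1`, so that `∑ δ n 1_{K n}` has finite integral over
  -- cosets
  obtain ⟨δ, hδ, hδ1⟩ := ENNReal.exists_pos_tsum_mul_lt_of_countable (ε := 1) one_ne_zero
    (fun n => ν (C n)) (fun n => (hC n).measure_lt_top.ne)
  let w₀ : G → ℝ≥0∞ := fun x => ∑' n, p n x * δ n
  have hw₀ : Measurable w₀ := Measurable.tsum fun n => (hp n).mul_const _
  let I : G → ℝ≥0∞ := fun x => ∫⁻ t : H, w₀ (t * x) ∂ν
  have hIm : Measurable I := by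
    refine Measurable.lintegral_prod_right' (f := fun q : G × H => w₀ (q.2 * q.1)) ?_
    exact hw₀.comp ((measurable_subtype_coe.comp measurable_snd).mul measurable_fst)
  have hI : ∀ x, I x = ∑' n, (∫⁻ t : H, p n (t * x) ∂ν) * δ n := by
    intro x
    have hm : ∀ n, Measurable fun t : H => p n (t * x) := fun n =>
      (hp n).comp (measurable_subtype_coe.mul_const x)
    simp only [I, w₀]
    rw [lintegral_tsum fun n => ((hm n).mul_const _).aemeasurable]
    exact tsum_congr fun n => lintegral_mul_const _ (hm n)
  have hIt : ∀ x, I x ≠ ⊤ := fun x => by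
    rw [hI]
    exact ((ENNReal.tsum_le_tsum fun n => mul_le_mul_left (hle n x) _).trans_lt
      (hδ1.trans ENNReal.one_lt_top)).ne
  have hI0 : ∀ x, I x ≠ 0 := by
    intro x h0
    rw [hI, ENNReal.tsum_eq_zero] at h0
    obtain ⟨n, hn⟩ := K.exists_mem_nhds x
    have h1 : ∫⁻ t : H, p n (t * x) ∂ν = 0 := by
      rcases mul_eq_zero.1 (h0 n) with h | h
      · exact h
      · exact absurd (ENNReal.coe_eq_zero.1 h) (hδ n).ne'
    have h2 : ν {t : H | (t : G) * x ∈ interior (K n)} = 0 := by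
      have hm : MeasurableSet {t : H | (t : G) * x ∈ K n} :=
        (measurable_subtype_coe.mul_const x) (hKm n)
      refine measure_mono_null (t := {t : H | (t : G) * x ∈ K n})
        (fun t ht => interior_subset (s := K n) ht) ?_
      rw [← lintegral_indicator_one hm]
      exact h1
    have hc : Continuous fun t : H => (t : G) * x := by fun_prop
    exact ((isOpen_interior.preimage hc).measure_pos ν
      ⟨1, by simpa using mem_interior_iff_mem_nhds.2 hn⟩).ne' h2
  have hIinv : ∀ (s : H) x, I (s * x) = I x := by
    intro s x
    have := lintegral_mul_right_eq_self (μ := ν) (fun t : H => w₀ (t * x)) s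
    simp only [I]
    rw [← this]
    simp only [Subgroup.coe_mul, mul_assoc]
  -- normalize by the integral `I`, which is constant on cosets
  refine ⟨fun x => w₀ x * (I x)⁻¹, hw₀.mul hIm.inv, fun x => ?_⟩
  simp only [hIinv]
  rw [lintegral_mul_const' _ _ (ENNReal.inv_ne_top.2 (hI0 x))]
  exact ENNReal.mul_inv_cancel (hI0 x) (hIt x)

variable (H) in
/-- The projection `G → H\G`. -/
abbrev rightMk (x : G) : RightQuot H := Quotient.mk (QuotientGroup.rightRel H) x

theorem measurable_rightMk : Measurable (rightMk H) := fun _ hs => hs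

theorem out_rightMk (x : G) : ∃ s : H, (rightMk H x).out = s * x := by
  have h : (QuotientGroup.rightRel H) (rightMk H x).out x :=
    Quotient.mk_out (s := QuotientGroup.rightRel H) x
  rw [QuotientGroup.rightRel_apply] at h
  exact ⟨⟨_, H.inv_mem h⟩, by simp⟩

theorem lintegral_out_rightMk [ν.IsMulRightInvariant] (h : G → ℝ≥0∞) (x : G) :
    ∫⁻ t : H, h (t * (rightMk H x).out) ∂ν = ∫⁻ t : H, h (t * x) ∂ν := by
  obtain ⟨s, hs⟩ := out_rightMk (H := H) x
  rw [hs, ← lintegral_mul_right_eq_self (fun t : H => h (t * x)) s]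
  simp only [Subgroup.coe_mul, mul_assoc]

theorem measurable_lintegral_out [SFinite ν] [ν.IsMulRightInvariant] {h : G → ℝ≥0∞}
    (hh : Measurable h) :
    Measurable fun q : RightQuot H => ∫⁻ t : H, h (t * q.out) ∂ν := by
  refine measurable_from_quotient.2 ?_
  have e : (fun q : RightQuot H => ∫⁻ t : H, h (t * q.out) ∂ν) ∘ rightMk H =
      fun x => ∫⁻ t : H, h (t * x) ∂ν := by
    funext x
    exact lintegral_out_rightMk h x
  rw [e]
  refine Measurable.lintegral_prod_right' (f := fun q : G × H => h (q.2 * q.1)) ?_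
  exact hh.comp ((measurable_subtype_coe.comp measurable_snd).mul measurable_fst)

/-- The weight `w` realizes the quotient measure: Fubini for `∫_G ∫_H w(x) h(t x)`, substituting
`x ↦ t⁻¹ x` and using that `w` has integral `1` over every coset. -/
theorem isQuotientMeasure_map [μ.IsHaarMeasure] [SFinite ν] [ν.IsMulRightInvariant]
    [ν.IsInvInvariant] {w : G → ℝ≥0∞} (hw : Measurable w)
    (hw1 : ∀ x, ∫⁻ t : H, w (t * x) ∂ν = 1) :
    IsQuotientMeasure μ ν ((μ.withDensity w).map (rightMk H)) := by
  intro h hh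
  have hm : Measurable fun q : G × H => h (q.2 * q.1) :=
    hh.comp ((measurable_subtype_coe.comp measurable_snd).mul measurable_fst)
  rw [lintegral_map (measurable_lintegral_out hh) measurable_rightMk]
  simp only [lintegral_out_rightMk]
  rw [lintegral_withDensity_eq_lintegral_mul _ hw hm.lintegral_prod_right']
  simp only [Pi.mul_apply]
  have e1 : ∀ x, w x * ∫⁻ t : H, h (t * x) ∂ν = ∫⁻ t : H, w x * h (t * x) ∂ν := fun x =>
    (lintegral_const_mul _ (hh.comp (measurable_subtype_coe.mul_const x))).symm
  simp only [e1]
  rw [lintegral_lintegral_swap ((hw.comp measurable_fst).mul hm).aemeasurable]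
  have e2 : ∀ t : H, ∫⁻ x, w x * h (t * x) ∂μ = ∫⁻ x, w ((t⁻¹ : H) * x) * h x ∂μ := by
    intro t
    rw [← lintegral_mul_left_eq_self (fun x => w ((t⁻¹ : H) * x) * h x) (t : G)]
    simp
  simp only [e2]
  have hm2 : Measurable fun q : H × G => w ((q.1⁻¹ : H) * q.2) * h q.2 :=
    (hw.comp ((measurable_subtype_coe.comp measurable_fst.inv).mul measurable_snd)).mul
      (hh.comp measurable_snd)
  rw [lintegral_lintegral_swap hm2.aemeasurable]
  refine lintegral_congr fun x => ?_
  have hm3 : Measurable fun t : H => w ((t⁻¹ : H) * x) :=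
    hw.comp ((measurable_subtype_coe.comp measurable_inv).mul_const x)
  rw [lintegral_mul_const _ hm3,
    lintegral_inv_eq_self (fun t : H => w (t * x)), hw1, one_mul]

/-- The quotient measure is unique. -/
theorem IsQuotientMeasure.eq_map [SFinite ν] [ν.IsMulRightInvariant] {w : G → ℝ≥0∞}
    (hw : Measurable w) (hw1 : ∀ x, ∫⁻ t : H, w (t * x) ∂ν = 1) {lam : Measure (RightQuot H)}
    (h : IsQuotientMeasure μ ν lam) : lam = (μ.withDensity w).map (rightMk H) := by
  refine Measure.ext fun A hA => ?_
  have hA' : MeasurableSet (rightMk H ⁻¹' A) := measurable_rightMk hA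
  rw [Measure.map_apply measurable_rightMk hA, withDensity_apply _ hA',
    ← lintegral_indicator hA', h _ (hw.indicator hA'), ← lintegral_indicator_one hA]
  refine lintegral_congr fun q => ?_
  have e : ∀ t : H, (rightMk H ⁻¹' A).indicator w (t * q.out) =
      A.indicator 1 q * w (t * q.out) := by
    intro t
    have e1 : rightMk H ((t : G) * q.out) = q := by
      conv_rhs => rw [← Quotient.out_eq q]
      refine Quotient.sound ?_
      change (QuotientGroup.rightRel H) _ _
      rw [QuotientGroup.rightRel_apply]
      simp
    by_cases hq : q ∈ A
    · rw [indicator_of_mem (by rwa [mem_preimage, e1]), indicator_of_mem hq, Pi.one_apply, one_mul]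
    · rw [indicator_of_notMem (by rwa [mem_preimage, e1]), indicator_of_notMem hq, zero_mul]
  simp only [e]
  have hm : Measurable fun t : H => w (t * q.out) := hw.comp (measurable_subtype_coe.mul_const _)
  rw [lintegral_const_mul _ hm, hw1, mul_one]

theorem quotientMeasure_eq_map [μ.IsHaarMeasure] [SFinite ν] [ν.IsMulRightInvariant]
    [ν.IsInvInvariant] {w : G → ℝ≥0∞} (hw : Measurable w)
    (hw1 : ∀ x, ∫⁻ t : H, w (t * x) ∂ν = 1) :
    IsQuotientMeasure μ ν (quotientMeasure μ ν) ∧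
      quotientMeasure μ ν = (μ.withDensity w).map (rightMk H) := by
  have hex : ∃ lam, IsQuotientMeasure μ ν lam := ⟨_, isQuotientMeasure_map hw hw1⟩
  have h : IsQuotientMeasure μ ν (quotientMeasure μ ν) := by
    rw [quotientMeasure, dif_pos hex]
    exact hex.choose_spec
  exact ⟨h, h.eq_map hw hw1⟩

end QuotientMeasure

/-! ### Orbital integrals -/

section Centralizer

variable {G : Type u} [Group G] [TopologicalSpace G] [IsTopologicalGroup G] [T2Space G]
  {Γ : Subgroup G}

theorem isClosed_cent (δ : G) : IsClosed (cent δ : Set G) := by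
  have e : (cent δ : Set G) = {x | x * δ = δ * x} := by
    ext x
    exact Subgroup.mem_centralizer_singleton_iff
  rw [e]
  exact isClosed_eq (by fun_prop) (by fun_prop)

instance discreteTopology_subgroupOf [DiscreteTopology Γ] (H : Subgroup G) :
    DiscreteTopology (Γ.subgroupOf H) := by
  let j : Γ.subgroupOf H → Γ := fun x => ⟨(x : H), x.2⟩
  have hj : Continuous j := by
    refine Continuous.subtype_mk ?_ _
    exact continuous_subtype_val.comp continuous_subtype_val
  refine DiscreteTopology.of_continuous_injective hj fun x y h => ?_
  exact Subtype.ext (Subtype.ext (congrArg (fun z : Γ => (z : G)) h))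

/-- If `Γ` is cocompact in `G`, then so is `Γ_δ` in `G_δ` for `δ` in a coset `Γ g` of an element
normalizing `Γ`: the conjugates `η δ η⁻¹`, `η ∈ Γ`, lie in the closed discrete set `Γ g`, so that
only finitely many of them lie in a compact set. -/
theorem isCocompact_cent [DiscreteTopology Γ] (hΓ : IsCocompact Γ) {g : G}
    (hg : ∀ x, x ∈ Γ ↔ g * x * g⁻¹ ∈ Γ) (γ : Γ) :
    IsCocompact (Γ.subgroupOf (cent ((γ : G) * g))) := by
  obtain ⟨K, hK, hKΓ⟩ := hΓ
  set δ := (γ : G) * g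
  have hmem : ∀ η : Γ, (η : G) * δ * (η : G)⁻¹ * g⁻¹ ∈ Γ := by
    intro η
    have h1 : (η : G) * δ * (η : G)⁻¹ * g⁻¹ = η * γ * (g * (η⁻¹ : Γ) * g⁻¹) := by
      simp [δ, mul_assoc]
    rw [h1]
    exact Γ.mul_mem (Γ.mul_mem η.2 γ.2) ((hg _).1 (η⁻¹).2)
  -- the conjugate `η δ η⁻¹` lies in `Γ g` and equals `v η * g`; `pick` chooses one `η` per
  -- conjugate
  let v : Γ → Γ := fun η => ⟨_, hmem η⟩
  let C : Set G := (fun k => k * δ * k⁻¹ * g⁻¹) '' K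
  have hC : IsCompact C := hK.image (by fun_prop)
  have hfin : {ζ : Γ | (ζ : G) ∈ C}.Finite := finite_mem_of_isCompact Γ hC
  let pick : Γ → Γ := fun ζ => Function.invFun v ζ
  have hpick : ∀ η, v (pick (v η)) = v η := fun η => Function.invFun_eq ⟨η, rfl⟩
  have hemb : Topology.IsClosedEmbedding ((↑) : cent δ → G) :=
    (isClosed_cent δ).isClosedEmbedding_subtypeVal
  refine ⟨((↑) : cent δ → G) ⁻¹' ⋃ ζ ∈ {ζ : Γ | (ζ : G) ∈ C}, (fun x => (pick ζ : G)⁻¹ * x) '' K,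
    hemb.isCompact_preimage (hfin.isCompact_biUnion fun η _ => hK.image (by fun_prop)),
    fun h => ?_⟩
  obtain ⟨η, hη⟩ := hKΓ h
  have hh : (h : G) * δ = δ * h := Subgroup.mem_centralizer_singleton_iff.1 h.2
  have hvC : ((v η : Γ) : G) ∈ C := by
    refine ⟨_, hη, ?_⟩
    change (η : G) * h * δ * ((η : G) * h)⁻¹ * g⁻¹ = η * δ * (η : G)⁻¹ * g⁻¹
    rw [mul_assoc (η : G), hh]
    group
  have h1 : (pick (v η) : G) * δ * (pick (v η) : G)⁻¹ = η * δ * (η : G)⁻¹ := by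
    have := congrArg (fun z : Γ => (z : G)) (hpick η)
    exact mul_right_cancel this
  have h2 : (pick (v η) : G)⁻¹ * η ∈ cent δ := by
    rw [Subgroup.mem_centralizer_singleton_iff]
    have h3 : (pick (v η) : G)⁻¹ * ((pick (v η) : G) * δ * (pick (v η) : G)⁻¹) * η =
        (pick (v η) : G)⁻¹ * (η * δ * (η : G)⁻¹) * η := by rw [h1]
    simp only [mul_assoc, inv_mul_cancel_left, inv_mul_cancel, mul_one] at h3 ⊢
    exact h3.symm
  refine ⟨⟨⟨_, h2⟩, Γ.mul_mem (Γ.inv_mem (pick (v η)).2) η.2⟩, ?_⟩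
  refine mem_iUnion₂.2 ⟨v η, hvC, (η : G) * h, hη, ?_⟩
  exact (mul_assoc _ _ _).symm

/-- The element `ζ⁻¹ (γ g) ζ g⁻¹` of `Γ`. -/
def twistedConj {g : G} (hg : ∀ x, x ∈ Γ ↔ g * x * g⁻¹ ∈ Γ) (γ ζ : Γ) : Γ :=
  ⟨(ζ : G)⁻¹ * (γ * g) * ζ * g⁻¹, by
    have h1 : (ζ : G)⁻¹ * (γ * g) * ζ * g⁻¹ = (ζ : G)⁻¹ * γ * (g * ζ * g⁻¹) := by group
    rw [h1]
    exact Γ.mul_mem (Γ.mul_mem (Γ.inv_mem ζ.2) γ.2) ((hg _).1 ζ.2)⟩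

theorem twistedConj_mul {g : G} (hg : ∀ x, x ∈ Γ ↔ g * x * g⁻¹ ∈ Γ) (γ ζ : Γ) :
    (twistedConj hg γ ζ : G) * g = (ζ : G)⁻¹ * (γ * g) * ζ := by
  simp [twistedConj]

theorem mk_twistedConj {g : G} (hg : ∀ x, x ∈ Γ ↔ g * x * g⁻¹ ∈ Γ) (γ ζ : Γ) :
    Quotient.mk (conjSetoid Γ g) (twistedConj hg γ ζ) = Quotient.mk (conjSetoid Γ g) γ := by
  refine (Quotient.sound (?_ : conjSetoid Γ g γ (twistedConj hg γ ζ))).symm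
  exact ⟨ζ⁻¹, by rw [twistedConj_mul]; simp⟩

theorem exists_twistedConj_eq {g : G} (hg : ∀ x, x ∈ Γ ↔ g * x * g⁻¹ ∈ Γ) {γ γ' : Γ}
    (h : Quotient.mk (conjSetoid Γ g) γ' = Quotient.mk (conjSetoid Γ g) γ) :
    ∃ ζ, twistedConj hg γ ζ = γ' := by
  obtain ⟨η, hη⟩ : conjSetoid Γ g γ γ' := (Quotient.exact h.symm)
  refine ⟨η⁻¹, Subtype.ext (mul_right_cancel (b := g) ?_)⟩
  rw [twistedConj_mul, hη]
  simp

end Centralizer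

section Orbital

variable {G : Type u} [Group G] [TopologicalSpace G] [IsTopologicalGroup G]
  [LocallyCompactSpace G] [T2Space G] [SecondCountableTopology G] [MeasurableSpace G]
  [BorelSpace G] {Γ : Subgroup G} [DiscreteTopology Γ] {μ : Measure G} [μ.IsHaarMeasure]
  {g : G}

/-- The `ζ` which conjugate `γ g` to `γ' g` form a coset `Γ_δ η` of the centralizer of `δ = γ g`, so
that the integrals over a fundamental domain of `Γ_δ\G_δ` add up to an integral of `w` over a coset
of `G_δ`. -/
theorem tsum_fiber_lintegral (hg : ∀ x, x ∈ Γ ↔ g * x * g⁻¹ ∈ Γ) (γ : Γ)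
    {ν : Measure (cent ((γ : G) * g))} [ν.IsHaarMeasure]
    [ν.IsInvInvariant] {w : G → ℝ≥0∞}
    (hw1 : ∀ x, ∫⁻ t : cent ((γ : G) * g), w (t * x) ∂ν = 1)
    [SecondCountableTopology (cent ((γ : G) * g))] (x : G) (γ' : Γ)
    (h : Quotient.mk (conjSetoid Γ g) γ' = Quotient.mk (conjSetoid Γ g) γ) :
    ∑' ζ : {ζ : Γ // twistedConj hg γ ζ = γ'},
      ∫⁻ t in fundDomain (Γ.subgroupOf (cent ((γ : G) * g))) ν,
        w ((t : G)⁻¹ * (ζ : Γ) * x) ∂ν = 1 := by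
  obtain ⟨η, hη⟩ := exists_twistedConj_eq hg h
  let e : Γ.subgroupOf (cent ((γ : G) * g)) ≃ {ζ : Γ // twistedConj hg γ ζ = γ'} :=
    { toFun := fun ρ => ⟨⟨((ρ : cent ((γ : G) * g)) : G) * η, Γ.mul_mem ρ.2 η.2⟩, by
        rw [← hη]
        refine Subtype.ext (mul_right_cancel (b := g) ?_)
        rw [twistedConj_mul, twistedConj_mul]
        have h1 := Subgroup.mem_centralizer_singleton_iff.1 (ρ : cent ((γ : G) * g)).2
        have h2 : (((ρ : cent ((γ : G) * g)) : G) * η)⁻¹ * (γ * g) * (((ρ : cent ((γ : G) * g)) : G) * η) =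
            (η : G)⁻¹ * (((ρ : cent ((γ : G) * g)) : G)⁻¹ * ((γ * g) * ((ρ : cent ((γ : G) * g)) : G))) * η := by group
        change (((ρ : cent ((γ : G) * g)) : G) * η)⁻¹ * (γ * g) * (((ρ : cent ((γ : G) * g)) : G) * η) = _
        rw [h2, ← h1]
        group⟩
      invFun := fun ζ => ⟨⟨(ζ : Γ) * (η : G)⁻¹, by
        rw [Subgroup.mem_centralizer_singleton_iff]
        have h1 : (twistedConj hg γ ζ : G) * g = twistedConj hg γ η * g := by rw [ζ.2, hη]
        rw [twistedConj_mul, twistedConj_mul] at h1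
        have h2 : ((ζ : Γ) : G) * ((((ζ : Γ) : G))⁻¹ * (γ * g) * (ζ : Γ)) * (η : G)⁻¹ =
          (ζ : Γ) * ((η : G)⁻¹ * (γ * g) * η) * (η : G)⁻¹ := by rw [h1]
        simp only [mul_assoc, mul_inv_cancel_left, mul_inv_cancel, mul_one] at h2 ⊢
        exact h2.symm⟩, Γ.mul_mem (ζ : Γ).2 (Γ.inv_mem η.2)⟩
      left_inv := fun ρ => by
        refine Subtype.ext (Subtype.ext ?_)
        simp
      right_inv := fun ζ => by
        refine Subtype.ext (Subtype.ext ?_)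
        simp }
  rw [← hw1 ((η : G) * x), ← lintegral_inv_eq_self,
    (isFundamentalDomain (Γ.subgroupOf (cent ((γ : G) * g))) ν).lintegral_eq_tsum', ← e.tsum_eq]
  refine tsum_congr fun ρ => lintegral_congr fun t => ?_
  congr 1
  change (t : G)⁻¹ * (((ρ : cent ((γ : G) * g)) : G) * η) * x =
    ((((ρ : cent ((γ : G) * g))⁻¹ * t : cent ((γ : G) * g))⁻¹ : cent ((γ : G) * g)) : G) * (η * x)
  push_cast
  group

variable [μ.IsMulRightInvariant] [μ.IsInvInvariant]

/-- Unfolding for the class of `δ = γ g`. The integral of `k(y⁻¹ δ y) w(y)` does not change if `w`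
is translated by `t ∈ G_δ`. Integrated over `t` in a fundamental domain of `Γ_δ\G_δ` it yields the
left side, and splitting `G` into translates of a fundamental domain of `Γ\G` yields the right
side. -/
theorem vol_mul_lintegral (hg : ∀ x, x ∈ Γ ↔ g * x * g⁻¹ ∈ Γ) (γ : Γ)
    {ν : Measure (cent ((γ : G) * g))} [ν.IsHaarMeasure]
    [ν.IsMulRightInvariant] [ν.IsInvInvariant] [SecondCountableTopology (cent ((γ : G) * g))]
    [SFinite ν] {w : G → ℝ≥0∞} (hw : Measurable w)
    (hw1 : ∀ x, ∫⁻ t : cent ((γ : G) * g), w (t * x) ∂ν = 1) {k : G → ℝ≥0∞}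
    (hk : Measurable k) :
    vol Γ ν * ∫⁻ y, k (y⁻¹ * (γ * g) * y) * w y ∂μ =
      ∑' γ' : {γ' // Quotient.mk (conjSetoid Γ g) γ' = Quotient.mk (conjSetoid Γ g) γ},
        ∫⁻ x in fundDomain Γ μ, k (x⁻¹ * (γ' : Γ) * g * x) ∂μ := by
  have hvol : vol Γ ν = ν (fundDomain (Γ.subgroupOf (cent ((γ : G) * g))) ν) := by
    rw [vol, covolume, dif_pos (hasFundamentalDomain (Γ.subgroupOf (cent ((γ : G) * g))) ν)]
    rfl
  have h1 : ∀ t : cent ((γ : G) * g), ∫⁻ y, k (y⁻¹ * (γ * g) * y) * w y ∂μ =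
      ∑' ζ : Γ, ∫⁻ x in fundDomain Γ μ,
        k (x⁻¹ * (twistedConj hg γ ζ) * g * x) * w ((t : G)⁻¹ * ζ * x) ∂μ := by
    intro t
    have h2 := Subgroup.mem_centralizer_singleton_iff.1 t.2
    rw [← lintegral_mul_left_eq_self _ (t : G)⁻¹]
    have h3 : ∀ y : G, ((t : G)⁻¹ * y)⁻¹ * (γ * g) * ((t : G)⁻¹ * y) = y⁻¹ * (γ * g) * y := by
      intro y
      have h4 : ((t : G)⁻¹ * y)⁻¹ * (γ * g) * ((t : G)⁻¹ * y) =
          y⁻¹ * ((t : G) * (γ * g)) * (t : G)⁻¹ * y := by group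
      rw [h4, h2]
      group
    simp only [h3]
    rw [(isFundamentalDomain Γ μ).lintegral_eq_tsum', ← (Equiv.inv Γ).tsum_eq]
    refine tsum_congr fun ζ => lintegral_congr fun x => ?_
    simp only [Equiv.inv_apply, inv_inv]
    have h5 : x⁻¹ * (twistedConj hg γ ζ) * g * x = x⁻¹ * ((ζ : G)⁻¹ * (γ * g) * ζ) * x := by
      rw [← twistedConj_mul hg]
      group
    rw [h5]
    change k (((ζ : G) * x)⁻¹ * (γ * g) * ((ζ : G) * x)) * w ((t : G)⁻¹ * ((ζ : G) * x)) = _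
    congr 2 <;> group
  have hm : ∀ ζ : Γ, Measurable fun q : cent ((γ : G) * g) × G =>
      k (q.2⁻¹ * (twistedConj hg γ ζ) * g * q.2) * w ((q.1 : G)⁻¹ * ζ * q.2) := fun ζ =>
    (hk.comp (((measurable_snd.inv.mul_const _).mul_const _).mul measurable_snd)).mul
      (hw.comp (((measurable_subtype_coe.comp measurable_fst).inv.mul_const _).mul measurable_snd))
  let τ : Γ → {γ' // Quotient.mk (conjSetoid Γ g) γ' = Quotient.mk (conjSetoid Γ g) γ} :=
    fun ζ => ⟨twistedConj hg γ ζ, mk_twistedConj hg γ ζ⟩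
  calc vol Γ ν * ∫⁻ y, k (y⁻¹ * (γ * g) * y) * w y ∂μ
      = ∫⁻ t in fundDomain (Γ.subgroupOf (cent ((γ : G) * g))) ν, ∑' ζ : Γ, (∫⁻ x in fundDomain Γ μ,
        k (x⁻¹ * (twistedConj hg γ ζ) * g * x) * w ((t : G)⁻¹ * ζ * x) ∂μ) ∂ν := by
        simp only [← h1]
        rw [setLIntegral_const, hvol, mul_comm]
    _ = ∑' ζ : Γ, ∫⁻ t in fundDomain (Γ.subgroupOf (cent ((γ : G) * g))) ν, (∫⁻ x in fundDomain Γ μ,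
        k (x⁻¹ * (twistedConj hg γ ζ) * g * x) * w ((t : G)⁻¹ * ζ * x) ∂μ) ∂ν :=
        lintegral_tsum fun ζ => (hm ζ).lintegral_prod_right'.aemeasurable
    _ = ∑' ζ : Γ, ∫⁻ x in fundDomain Γ μ, k (x⁻¹ * (τ ζ : Γ) * g * x) *
          (∫⁻ t in fundDomain (Γ.subgroupOf (cent ((γ : G) * g))) ν, w ((t : G)⁻¹ * ζ * x) ∂ν) ∂μ := by
        refine tsum_congr fun ζ => ?_
        rw [lintegral_lintegral_swap (hm ζ).aemeasurable]
        refine lintegral_congr fun x => ?_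
        have hm2 : Measurable fun t : cent ((γ : G) * g) => w ((t : G)⁻¹ * ζ * x) :=
          hw.comp ((measurable_subtype_coe.inv.mul_const _).mul_const _)
        rw [lintegral_const_mul _ hm2]
    _ = ∑' γ' : {γ' // Quotient.mk (conjSetoid Γ g) γ' = Quotient.mk (conjSetoid Γ g) γ},
        ∑' ζ : {ζ // τ ζ = γ'}, ∫⁻ x in fundDomain Γ μ, k (x⁻¹ * (γ' : Γ) * g * x) *
          (∫⁻ t in fundDomain (Γ.subgroupOf (cent ((γ : G) * g))) ν, w ((t : G)⁻¹ * (ζ : Γ) * x) ∂ν) ∂μ := by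
        rw [← (Equiv.sigmaFiberEquiv τ).tsum_eq, ENNReal.tsum_sigma']
        refine tsum_congr fun γ' => tsum_congr fun ζ => ?_
        have : τ ((Equiv.sigmaFiberEquiv τ) ⟨γ', ζ⟩) = γ' := ζ.2
        rw [this]
        rfl
    _ = _ := by
        refine tsum_congr fun γ' => ?_
        have hm3 : ∀ ζ : Γ, Measurable fun x : G => ∫⁻ t in fundDomain (Γ.subgroupOf (cent ((γ : G) * g))) ν, w ((t : G)⁻¹ * ζ * x) ∂ν := fun ζ =>
          Measurable.lintegral_prod_right' (f := fun q : G × cent ((γ : G) * g) => w ((q.2 : G)⁻¹ * ζ * q.1))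
            (hw.comp (((measurable_subtype_coe.comp measurable_snd).inv.mul_const _).mul
              measurable_fst))
        have hm4 : Measurable fun x : G => k (x⁻¹ * (γ' : Γ) * g * x) :=
          hk.comp (((measurable_inv.mul_const _).mul_const _).mul measurable_id)
        have hm5 : ∀ ζ : {ζ // τ ζ = γ'}, AEMeasurable (fun x : G => k (x⁻¹ * (γ' : Γ) * g * x) *
            ∫⁻ t in fundDomain (Γ.subgroupOf (cent ((γ : G) * g))) ν,
              w ((t : G)⁻¹ * (ζ : Γ) * x) ∂ν) (μ.restrict (fundDomain Γ μ)) :=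
          fun ζ => (hm4.mul (hm3 ζ)).aemeasurable
        rw [← lintegral_tsum hm5]
        refine lintegral_congr fun x => ?_
        rw [ENNReal.tsum_mul_left]
        have h6 := tsum_fiber_lintegral hg γ hw1 x γ' γ'.2
        have h7 : ∑' ζ : {ζ // τ ζ = γ'}, ∫⁻ t in fundDomain (Γ.subgroupOf (cent ((γ : G) * g))) ν, w ((t : G)⁻¹ * (ζ : Γ) * x) ∂ν = 1 := by
          rw [← h6]
          exact (Equiv.subtypeEquivRight fun ζ => Subtype.ext_iff :
            {ζ // τ ζ = γ'} ≃ {ζ : Γ // twistedConj hg γ ζ = γ'}).tsum_eq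
              (fun ζ => ∫⁻ t in fundDomain (Γ.subgroupOf (cent ((γ : G) * g))) ν, w ((t : G)⁻¹ * (ζ : Γ) * x) ∂ν)
        rw [h7, mul_one]

end Orbital

section OrbitalIntegral

variable {G : Type u} [Group G] [TopologicalSpace G] [IsTopologicalGroup G]
  [LocallyCompactSpace G] [T2Space G] [SecondCountableTopology G] [MeasurableSpace G]
  [BorelSpace G] {Γ : Subgroup G} [DiscreteTopology Γ] {μ : Measure G} [μ.IsHaarMeasure]
  [μ.IsMulRightInvariant] [μ.IsInvInvariant] {g : G}

theorem measurable_orbitalFun {f : G → ℂ} (hf : Measurable f) (δ : G) :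
    Measurable (orbitalFun f δ) :=
  measurable_from_quotient.2
    (hf.comp ((measurable_inv.mul_const δ).mul measurable_id) :
      Measurable fun x : G => f (x⁻¹ * δ * x))

/-- The contribution of one conjugacy class to the integral of the kernel over the diagonal is
the volume of `Γ_δ\G_δ` times the orbital integral. The measures which the maps
`x ↦ x⁻¹ γ' g x` transport from a fundamental domain, for `γ'` in the class, add up to a multiple of
the measure which `x ↦ x⁻¹ δ x` transports from `G_δ\G`; absolute convergence is then inherited. -/
theorem orbital_formula (hΓ : IsCocompact Γ) (hg : ∀ x, x ∈ Γ ↔ g * x * g⁻¹ ∈ Γ) (γ : Γ)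
    (ν : Measure (cent ((γ : G) * g))) [ν.IsHaarMeasure] {f : G → ℂ} (hf : Measurable f)
    {M : NNReal} (hM : ∀ x y : G, ∑' γ : Γ, ‖f (x⁻¹ * γ * y)‖ₑ ≤ M) :
    vol Γ ν < ⊤ ∧ IsQuotientMeasure μ ν (quotientMeasure μ ν) ∧
      Integrable (orbitalFun f ((γ : G) * g)) (quotientMeasure μ ν) ∧
      HasSum (fun γ' : {γ' // Quotient.mk (conjSetoid Γ g) γ' = Quotient.mk (conjSetoid Γ g) γ} =>
        ∫ x in fundDomain Γ μ, f (x⁻¹ * (γ' : Γ) * g * x) ∂μ)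
        ((vol Γ ν).toReal * orbitalIntegral μ ν f) := by
  have hH := isClosed_cent ((γ : G) * g)
  have hemb : Topology.IsClosedEmbedding ((↑) : cent ((γ : G) * g) → G) :=
    hH.isClosedEmbedding_subtypeVal
  have : LocallyCompactSpace (cent ((γ : G) * g)) := hemb.locallyCompactSpace
  have : SecondCountableTopology (cent ((γ : G) * g)) := hemb.isEmbedding.secondCountableTopology
  have hcc := isCocompact_cent hΓ hg γ
  have : ν.IsMulRightInvariant := isMulRightInvariant_of_isCocompact hcc
  have : ν.IsInvInvariant := isInvInvariant_of_isMulRightInvariant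
  obtain ⟨w, hw, hw1⟩ := exists_weight (ν := ν) hH
  have hvol : vol Γ ν = ν (fundDomain (Γ.subgroupOf (cent ((γ : G) * g))) ν) := by
    rw [vol, covolume, dif_pos (hasFundamentalDomain (Γ.subgroupOf (cent ((γ : G) * g))) ν)]
    rfl
  have hfin : vol Γ ν < ⊤ := hvol ▸ measure_fundDomain_lt_top hcc
  have hpos : vol Γ ν ≠ 0 := hvol ▸
    (isFundamentalDomain (Γ.subgroupOf (cent ((γ : G) * g))) ν).measure_ne_zero
      (NeZero.ne ν)
  obtain ⟨hq, hqm⟩ := quotientMeasure_eq_map (μ := μ) hw hw1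
  have hp : Measurable fun y : G => y⁻¹ * (γ * g) * y :=
    (measurable_inv.mul_const _).mul measurable_id
  have hp' : ∀ γ' : Γ, Measurable fun x : G => x⁻¹ * γ' * g * x := fun γ' =>
    ((measurable_inv.mul_const _).mul_const _).mul measurable_id
  -- the images of the measure on the fundamental domain under `x ↦ x⁻¹ γ' g x`
  let m : {γ' // Quotient.mk (conjSetoid Γ g) γ' = Quotient.mk (conjSetoid Γ g) γ} → Measure G :=
    fun γ' => (μ.restrict (fundDomain Γ μ)).map fun x => x⁻¹ * (γ' : Γ) * g * x
  have hsum : Measure.sum m = vol Γ ν • (μ.withDensity w).map fun y => y⁻¹ * (γ * g) * y := by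
    refine Measure.ext fun A hA => ?_
    have hk : Measurable (A.indicator fun _ => (1 : ℝ≥0∞)) := measurable_const.indicator hA
    have h1 := vol_mul_lintegral (μ := μ) hg γ hw hw1 hk
    rw [Measure.sum_apply _ hA, Measure.smul_apply, smul_eq_mul]
    have h2 : (μ.withDensity w).map (fun y => y⁻¹ * (γ * g) * y) A =
        ∫⁻ y, A.indicator (fun _ => 1) (y⁻¹ * (γ * g) * y) * w y ∂μ := by
      rw [← lintegral_indicator_one hA, lintegral_map (measurable_one.indicator hA) hp]
      refine (lintegral_withDensity_eq_lintegral_mul μ hw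
        ((measurable_one.indicator hA).comp hp)).trans ?_
      exact lintegral_congr fun y => mul_comm _ _
    rw [h2, h1]
    refine tsum_congr fun γ' => ?_
    rw [← lintegral_indicator_one hA, lintegral_map (measurable_one.indicator hA) (hp' γ')]
    rfl
  have hint := (setIntegral_fundDomain_integrableOn (μ := μ) (g := g) (hΓ := hΓ) hf hM).2
  have hfs : Integrable f (Measure.sum m) := by
    refine ⟨hf.aestronglyMeasurable, ?_⟩
    rw [HasFiniteIntegral, lintegral_sum_measure]
    refine lt_of_le_of_lt ?_ hint
    refine le_trans (le_of_eq (tsum_congr fun γ' => ?_))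
      (ENNReal.tsum_comp_le_tsum_of_injective Subtype.val_injective
        fun γ' : Γ => ∫⁻ x in fundDomain Γ μ, ‖f (x⁻¹ * γ' * g * x)‖ₑ ∂μ)
    exact lintegral_map hf.enorm (hp' γ')
  have hfs2 := hfs
  rw [hsum, integrable_smul_measure hpos hfin.ne,
    integrable_map_measure hf.aestronglyMeasurable hp.aemeasurable] at hfs2
  have hom := measurable_orbitalFun hf ((γ : G) * g)
  refine ⟨hfin, hq, ?_, ?_⟩
  · rw [hqm, integrable_map_measure hom.aestronglyMeasurable measurable_rightMk.aemeasurable]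
    exact hfs2
  · have h1 := hasSum_integral_measure hfs
    have h2 : ∫ y, f y ∂(Measure.sum m) = (vol Γ ν).toReal * orbitalIntegral μ ν f := by
      rw [hsum, integral_smul_measure, integral_map hp.aemeasurable hf.aestronglyMeasurable,
        orbitalIntegral, hqm,
        integral_map measurable_rightMk.aemeasurable hom.aestronglyMeasurable]
      exact Complex.real_smul
    rw [h2] at h1
    refine h1.congr_fun fun γ' => ?_
    exact (integral_map (hp' γ').aemeasurable hf.aestronglyMeasurable).symm

end OrbitalIntegral

section DualCharacter

variable {V : Type u} [NormedAddCommGroup V] [InnerProductSpace ℂ V] [FiniteDimensional ℂ V]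
  {G : Type u} [Group G] {Γ : Subgroup G}

/-- The Riesz isomorphism `V ≃ V*` is conjugate linear and intertwines `φ` with its dual. -/
theorem conjChar_dualRep (φ : Γ →* (V ≃ₗᵢ[ℂ] V)) (γ : Γ) :
    conjChar (dualRep φ) γ = LinearMap.trace ℂ V ((φ γ).toLinearEquiv : V →ₗ[ℂ] V) := by
  have := FiniteDimensional.complete ℂ V
  set b := stdOrthonormalBasis ℂ (StrongDual ℂ V)
  let R := InnerProductSpace.toDual ℂ V
  have hin : ∀ l m : StrongDual ℂ V, inner ℂ l m = inner ℂ (R.symm m) (R.symm l) := fun _ _ => rfl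
  have hon : Orthonormal ℂ fun j => R.symm (b j) := by
    rw [orthonormal_iff_ite]
    intro i j
    rw [← hin, orthonormal_iff_ite.1 b.orthonormal j i]
    simp only [eq_comm]
  have hspan : ⊤ ≤ Submodule.span ℂ (range fun j => R.symm (b j)) := by
    have hc : Fintype.card (Fin (Module.finrank ℂ (StrongDual ℂ V))) = Module.finrank ℂ V := by
      rw [Fintype.card_fin]
      exact (LinearMap.toContinuousLinearMap (𝕜 := ℂ) (E := V) (F' := ℂ)).finrank_eq.symm.trans
        Subspace.dual_finrank_eq
    exact (hon.linearIndependent.span_eq_top_of_card_eq_finrank' hc).ge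
  let b' := OrthonormalBasis.mk hon hspan
  rw [LinearMap.trace_eq_sum_inner _ b', conjChar]
  refine Finset.sum_congr rfl fun j _ => ?_
  rw [hin]
  have h1 : R.symm (dualRep φ γ (b j)) = φ γ (R.symm (b j)) := by
    apply R.injective
    rw [LinearIsometryEquiv.apply_symm_apply]
    ext v
    change b j (φ γ⁻¹ v) = inner ℂ (φ γ (R.symm (b j))) v
    have h2 : φ γ (φ γ⁻¹ v) = v := by
      have h : φ γ * φ γ⁻¹ = 1 := by rw [← map_mul, mul_inv_cancel, map_one]
      exact DFunLike.congr_fun h v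
    rw [← h2, LinearIsometryEquiv.inner_map_map, h2, ← InnerProductSpace.toDual_apply_apply (𝕜 := ℂ)]
    change _ = (R (R.symm (b j))) _
    rw [LinearIsometryEquiv.apply_symm_apply]
  rw [h1]
  simp only [b', OrthonormalBasis.coe_mk]
  rfl

/-- If `γ' g = η (γ g) η⁻¹`, then `γ' = η γ (g η⁻¹ g⁻¹)`, where `φ` takes the value `φ(η)⁻¹` on the
last factor. -/
theorem trace_conj_eq {φ : Γ →* (V ≃ₗᵢ[ℂ] V)} {g : G} (hg : ∀ x, x ∈ Γ ↔ g * x * g⁻¹ ∈ Γ)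
    (hφ : ∀ γ η : Γ, (η : G) = g * γ * g⁻¹ → φ η = φ γ) {γ γ' : Γ}
    (h : Quotient.mk (conjSetoid Γ g) γ' = Quotient.mk (conjSetoid Γ g) γ) :
    LinearMap.trace ℂ V ((φ γ').toLinearEquiv : V →ₗ[ℂ] V) =
      LinearMap.trace ℂ V ((φ γ).toLinearEquiv : V →ₗ[ℂ] V) := by
  obtain ⟨η, hη⟩ : conjSetoid Γ g γ γ' := Quotient.exact h.symm
  let θ : Γ := ⟨g * (η⁻¹ : Γ) * g⁻¹, (hg _).1 (η⁻¹).2⟩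
  have h1 : γ' = η * γ * θ := by
    refine Subtype.ext (mul_right_cancel (b := g) ?_)
    rw [hη]
    simp [θ, mul_assoc]
  have h2 : φ γ' = φ η * φ γ * φ η⁻¹ := by
    rw [h1, map_mul, map_mul, hφ η⁻¹ θ rfl]
  have h3 : (((φ γ').toLinearEquiv : V ≃ₗ[ℂ] V) : V →ₗ[ℂ] V) =
      (φ η).toLinearEquiv.conj ((φ γ).toLinearEquiv : V →ₗ[ℂ] V) := by
    rw [h2]
    ext v
    have h4 : φ η⁻¹ v = (φ η).symm v := by
      apply (φ η).injective
      rw [LinearIsometryEquiv.apply_symm_apply]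
      have h : φ η * φ η⁻¹ = 1 := by rw [← map_mul, mul_inv_cancel, map_one]
      exact DFunLike.congr_fun h v
    change φ η (φ γ (φ η⁻¹ v)) = φ η (φ γ ((φ η).symm v))
    rw [h4]
  rw [h3, LinearMap.trace_conj']

end DualCharacter

section GeometricSide

variable {G V : Type u} [Group G] [TopologicalSpace G] [IsTopologicalGroup G]
  [LocallyCompactSpace G] [T2Space G] [SecondCountableTopology G] [MeasurableSpace G]
  [BorelSpace G] {Γ : Subgroup G} [DiscreteTopology Γ] {μ : Measure G} [μ.IsHaarMeasure]
  [μ.IsMulRightInvariant] [μ.IsInvInvariant] {g : G}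
  [NormedAddCommGroup V] [InnerProductSpace ℂ V] [FiniteDimensional ℂ V]

/-- The geometric expansion: group the integral of the kernel over the diagonal by conjugacy
classes. -/
theorem hasSum_geometric (hΓ : IsCocompact Γ) (hg : ∀ x, x ∈ Γ ↔ g * x * g⁻¹ ∈ Γ)
    {φ : Γ →* (V ≃ₗᵢ[ℂ] V)} (hφ : ∀ γ η : Γ, (η : G) = g * γ * g⁻¹ → φ η = φ γ)
    (ν : ∀ δ : G, Measure (cent δ)) [∀ δ, (ν δ).IsHaarMeasure] {f : G → ℂ} (hf : Measurable f)
    {M : NNReal} (hM : ∀ x y : G, ∑' γ : Γ, ‖f (x⁻¹ * γ * y)‖ₑ ≤ M) :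
    HasSum (fun c : TwistedClass Γ g =>
          ((vol Γ (ν (c.out * g))).toReal : ℂ) *
            LinearMap.trace ℂ V ((φ c.out).toLinearEquiv : V →ₗ[ℂ] V) *
            orbitalIntegral μ (ν (c.out * g)) f)
      (∑' γ : Γ, conjChar (dualRep φ) γ * ∫ x in fundDomain Γ μ, f (x⁻¹ * γ * g * x) ∂μ) := by
  have hs := summable_setIntegral (μ := μ) (ψ := dualRep φ) (g := g) (hΓ := hΓ) hf ⟨M, hM⟩
  have h1 := (Equiv.sigmaFiberEquiv (Quotient.mk (conjSetoid Γ g))).hasSum_iff.2 hs.hasSum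
  refine h1.sigma fun c => ?_
  have hc : c = Quotient.mk (conjSetoid Γ g) (TwistedClass.out c) := (Quotient.out_eq c).symm
  have h2 := (orbital_formula (μ := μ) hΓ hg (TwistedClass.out c) (ν _) hf hM).2.2.2.mul_left
    (LinearMap.trace ℂ V ((φ (TwistedClass.out c)).toLinearEquiv : V →ₗ[ℂ] V))
  rw [← mul_assoc, mul_comm (LinearMap.trace ℂ V _) ((vol _ _).toReal : ℂ)] at h2
  rw [← (Equiv.subtypeEquivRight fun γ' => by rw [← hc] :
    {γ' // Quotient.mk (conjSetoid Γ g) γ' = Quotient.mk (conjSetoid Γ g) (TwistedClass.out c)} ≃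
      {γ' // Quotient.mk (conjSetoid Γ g) γ' = c}).hasSum_iff]
  refine h2.congr_fun fun γ' => ?_
  change conjChar (dualRep φ) (γ' : Γ) * _ = _
  rw [conjChar_dualRep, trace_conj_eq hg hφ γ'.2]
  rfl

end GeometricSide

/-! ### Decomposition of a unitary representation by compact operators -/

section Subrep

variable {G : Type u} [Group G] {H : Type u} [NormedAddCommGroup H] [InnerProductSpace ℂ H]
  {ρ : G →* (H ≃ₗᵢ[ℂ] H)}

theorem rep_inv_apply (x : G) (v : H) : ρ x⁻¹ (ρ x v) = v := by
  have h : ρ x⁻¹ * ρ x = 1 := by rw [← map_mul, inv_mul_cancel, map_one]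
  exact DFunLike.congr_fun h v

theorem rep_apply_inv (x : G) (v : H) : ρ x (ρ x⁻¹ v) = v := by
  have h : ρ x * ρ x⁻¹ = 1 := by rw [← map_mul, mul_inv_cancel, map_one]
  exact DFunLike.congr_fun h v

theorem inner_rep_right (x : G) (v w : H) : inner ℂ v (ρ x w) = inner ℂ (ρ x⁻¹ v) w := by
  rw [← (ρ x⁻¹).inner_map_map v (ρ x w), rep_inv_apply]

variable (ρ) in
/-- `W` is a closed invariant subspace of the representation `ρ`. -/
def IsSubrep (W : Submodule ℂ H) : Prop :=
  IsClosed (W : Set H) ∧ ∀ x, ∀ v ∈ W, ρ x v ∈ W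

theorem IsSubrep.orthogonal {W : Submodule ℂ H} (hW : IsSubrep ρ W) : IsSubrep ρ Wᗮ := by
  refine ⟨W.isClosed_orthogonal, fun x v hv => ?_⟩
  rw [Submodule.mem_orthogonal] at hv ⊢
  intro w hw
  rw [inner_rep_right]
  exact hv _ (hW.2 _ _ hw)

theorem IsSubrep.sInf {S : Set (Submodule ℂ H)} (hS : ∀ W ∈ S, IsSubrep ρ W) :
    IsSubrep ρ (sInf S) := by
  constructor
  · rw [Submodule.coe_sInf]
    exact isClosed_biInter fun W hW => (hS W hW).1
  · intro x v hv
    rw [Submodule.mem_sInf] at hv ⊢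
    exact fun W hW => (hS W hW).2 x v (hv W hW)

theorem isSubrep_top : IsSubrep ρ ⊤ := ⟨isClosed_univ, fun _ _ _ => trivial⟩

variable (ρ) in
/-- A minimal nonzero closed invariant subspace. -/
def IsMinSubrep (W : Submodule ℂ H) : Prop :=
  IsSubrep ρ W ∧ W ≠ ⊥ ∧ ∀ W' ≤ W, IsSubrep ρ W' → W' = ⊥ ∨ W' = W

/-- The representation on an invariant subspace. -/
def subRep {W : Submodule ℂ H} (hW : IsSubrep ρ W) : G →* (W ≃ₗᵢ[ℂ] W) where
  toFun x :=
    { toFun := fun v => ⟨ρ x v, hW.2 x v v.2⟩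
      invFun := fun v => ⟨ρ x⁻¹ v, hW.2 x⁻¹ v v.2⟩
      map_add' := fun v w => Subtype.ext (map_add (ρ x) _ _)
      map_smul' := fun c v => Subtype.ext (map_smul (ρ x) c _)
      left_inv := fun v => Subtype.ext (rep_inv_apply x _)
      right_inv := fun v => Subtype.ext (rep_apply_inv x _)
      norm_map' := fun v => (ρ x).norm_map v }
  map_one' := by
    ext v
    change ρ 1 v = v
    rw [map_one]; rfl
  map_mul' x y := by
    ext v
    change ρ (x * y) v = ρ x (ρ y v)
    rw [map_mul]; rfl

variable [CompleteSpace H]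

/-- A compact symmetric operator which does not vanish on an invariant closed subspace has an
eigenvector there with nonzero eigenvalue. -/
theorem exists_eigenvector {T : H →L[ℂ] H} (hT : IsCompactOperator T) (hT' : T.IsSymmetric)
    {W : Submodule ℂ H} (hW : IsClosed (W : Set H)) (hTW : ∀ v ∈ W, T v ∈ W) {v : H} (hv : v ∈ W)
    (hTv : T v ≠ 0) : ∃ c : ℂ, c ≠ 0 ∧ ∃ u ∈ W, u ≠ 0 ∧ T u = c • u := by
  have : CompleteSpace W := hW.completeSpace_coe
  let S : H →L[ℂ] H := T ∘L W.starProjection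
  have hS : IsCompactOperator S := hT.comp_clm W.starProjection
  have hPT : ∀ x, W.starProjection (T (W.starProjection x)) = T (W.starProjection x) := fun x =>
    Submodule.starProjection_eq_self_iff.2 (hTW _ (W.starProjection_apply_mem x))
  have hS' : S.IsSymmetric := by
    intro x y
    change inner ℂ (T (W.starProjection x)) y = inner ℂ x (T (W.starProjection y))
    calc inner ℂ (T (W.starProjection x)) y
        = inner ℂ (W.starProjection (T (W.starProjection x))) y := by rw [hPT]
      _ = inner ℂ (T (W.starProjection x)) (W.starProjection y) :=
        Submodule.inner_starProjection_left_eq_right _ _ _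
      _ = inner ℂ (W.starProjection x) (T (W.starProjection y)) := hT' _ _
      _ = inner ℂ x (W.starProjection (T (W.starProjection y))) :=
        Submodule.inner_starProjection_left_eq_right _ _ _
      _ = inner ℂ x (T (W.starProjection y)) := by rw [hPT]
  have hS0 : S ≠ 0 := by
    intro h
    apply hTv
    have h1 : S v = 0 := by rw [h]; rfl
    have h2 : W.starProjection v = v := Submodule.starProjection_eq_self_iff.2 hv
    change T (W.starProjection v) = 0 at h1
    rwa [h2] at h1
  have h := (not_congr (eq_zero_of_forall_hasEigenvalue_eq_zero hS hS')).2 hS0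
  push Not at h
  obtain ⟨c, hc, hc0⟩ := h
  obtain ⟨u, hu⟩ := hc.exists_hasEigenvector
  have hu1 : T (W.starProjection u) = c • u := hu.apply_eq_smul
  have huW : u ∈ W := by
    have h1 : c • u ∈ W := hu1 ▸ hTW _ (W.starProjection_apply_mem u)
    exact (W.smul_mem_iff hc0).1 h1
  refine ⟨c, hc0, u, huW, hu.2, ?_⟩
  rwa [Submodule.starProjection_eq_self_iff.2 huW] at hu1

variable [TopologicalSpace G] [IsTopologicalGroup G] [SecondCountableTopology G]
  [MeasurableSpace G] [BorelSpace G] {μ : Measure G}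

theorem IsSubrep.repInt_mem {W : Submodule ℂ H} (hW : IsSubrep ρ W)
    (hρ : ∀ v, Continuous fun x => ρ x v) {f : G → ℂ} (hf : Integrable f μ) {v : H} (hv : v ∈ W) :
    repInt hρ hf v ∈ W := by
  have : CompleteSpace W := hW.1.completeSpace_coe
  rw [← W.orthogonal_orthogonal, Submodule.mem_orthogonal]
  intro w hw
  rw [repInt_apply, ← integral_inner (integrable_smul_rep hρ hf v) w]
  refine integral_eq_zero_of_ae (Eventually.of_forall fun x => ?_)
  have h : inner ℂ w (ρ x⁻¹ v) = 0 :=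
    Submodule.inner_left_of_mem_orthogonal (hW.2 _ v hv) hw
  change inner ℂ w (f x • ρ x⁻¹ v) = 0
  rw [inner_smul_right, h, mul_zero]

variable (μ) in
/-- The characteristic functions of symmetric compact sets act by compact operators. -/
def HasCompactOps (hρ : ∀ v, Continuous fun x => ρ x v) : Prop :=
  ∀ U : Set G, IsCompact U → U⁻¹ = U → ∀ h : Integrable (U.indicator fun _ => (1 : ℂ)) μ,
    IsCompactOperator (repInt hρ h)

variable [LocallyCompactSpace G] [T2Space G] [μ.IsHaarMeasure]

theorem integrable_indicator_one {U : Set G} (hU : IsCompact U) :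
    Integrable (U.indicator fun _ => (1 : ℂ)) μ :=
  (integrable_indicator_iff hU.measurableSet).2 (integrableOn_const hU.measure_lt_top.ne)

variable [μ.IsInvInvariant]

theorem isSymmetric_repInt_indicator (hρ : ∀ v, Continuous fun x => ρ x v) {U : Set G}
    (hU : U⁻¹ = U) (h : Integrable (U.indicator fun _ => (1 : ℂ)) μ) :
    (repInt hρ h).IsSymmetric := by
  have h1 : adjoint (repInt hρ h) = repInt hρ h := by
    rw [repInt_adjoint]
    refine repInt_congr _ _ _ ?_
    funext x
    have h2 : x⁻¹ ∈ U ↔ x ∈ U := by rw [← Set.mem_inv, hU]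
    by_cases hx : x ∈ U
    · simp [adjFun, hx, h2]
    · simp [adjFun, hx, h2]
  intro v w
  change inner ℂ (repInt hρ h v) w = inner ℂ v (repInt hρ h w)
  rw [← adjoint_inner_left, h1]

/-- Some characteristic function of a small neighbourhood of `1` acts nontrivially on `W`. -/
theorem HasCompactOps.exists_eigenvector {hρ : ∀ v, Continuous fun x => ρ x v}
    (hc : HasCompactOps μ hρ) {W : Submodule ℂ H} (hW : IsSubrep ρ W) (hW0 : W ≠ ⊥) :
    ∃ (U : Set G) (h : Integrable (U.indicator fun _ => (1 : ℂ)) μ) (c : ℂ),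
      IsCompactOperator (repInt hρ h) ∧ c ≠ 0 ∧ ∃ u ∈ W, u ≠ 0 ∧ repInt hρ h u = c • u := by
  obtain ⟨v, hv, hv0⟩ := Submodule.exists_mem_ne_zero_of_ne_bot hW0
  obtain ⟨U, hU, hU', hne⟩ := exists_repInt_indicator_ne_zero (μ := μ) hρ hv0
  have hi := integrable_indicator_one (μ := μ) hU
  obtain ⟨c, hc0, u, hu⟩ := EquivTrace.exists_eigenvector (hc U hU hU' hi)
    (isSymmetric_repInt_indicator hρ hU' hi) hW.1 (fun v hv => hW.repInt_mem hρ hi hv) hv (hne hi)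
  exact ⟨U, hi, c, hc U hU hU' hi, hc0, u, hu⟩

/-- Among the closed invariant subspaces of `W` which meet a given eigenspace `E` of a compact
operator of the representation, choose `M` with `M ∩ E` of minimal dimension. Any nonzero vector of
`M ∩ E` generates a minimal closed invariant subspace. -/
theorem HasCompactOps.exists_isMinSubrep_le {hρ : ∀ v, Continuous fun x => ρ x v}
    (hc : HasCompactOps μ hρ) {W : Submodule ℂ H} (hW : IsSubrep ρ W) (hW0 : W ≠ ⊥) :
    ∃ W' ≤ W, IsMinSubrep ρ W' := by
  obtain ⟨U, hi, c, hcomp, hc0, u₀, hu₀, hu₀0, hTu₀⟩ := hc.exists_eigenvector hW hW0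
  set T := repInt hρ hi
  let E : Submodule ℂ H := Module.End.eigenspace T.toLinearMap c
  have hE : ∀ u, u ∈ E ↔ T u = c • u := fun u => Module.End.mem_eigenspace_iff
  have : FiniteDimensional ℂ E := finite_dimensional_eigenspace hcomp c hc0
  let P : ℕ → Prop := fun n => ∃ M ≤ W, IsSubrep ρ M ∧ M ⊓ E ≠ ⊥ ∧
    Module.finrank ℂ (M ⊓ E : Submodule ℂ H) = n
  have hP : ∃ n, P n := ⟨_, W, le_rfl, hW, fun h => hu₀0 ((Submodule.eq_bot_iff _).1 h _
    ⟨hu₀, (hE _).2 hTu₀⟩), rfl⟩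
  classical
  obtain ⟨M, hMW, hM, hM0, hMn⟩ := Nat.find_spec hP
  have hmin : ∀ N ≤ M, IsSubrep ρ N → N ⊓ E ≠ ⊥ → N ⊓ E = M ⊓ E := by
    intro N hN hN' hN0
    have : FiniteDimensional ℂ (M ⊓ E : Submodule ℂ H) :=
      Submodule.finiteDimensional_of_le inf_le_right
    refine Submodule.eq_of_le_of_finrank_le (inf_le_inf_right E hN) ?_
    rw [hMn]
    exact Nat.find_min' hP ⟨N, hN.trans hMW, hN', hN0, rfl⟩
  obtain ⟨u, huM, hu0⟩ := Submodule.exists_mem_ne_zero_of_ne_bot hM0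
  -- the closed invariant subspace generated by `u`
  let S : Set (Submodule ℂ H) := {N | IsSubrep ρ N ∧ u ∈ N}
  have hS : IsSubrep ρ (sInf S) := IsSubrep.sInf fun N hN => hN.1
  have huS : u ∈ sInf S := (Submodule.mem_sInf).2 fun N hN => hN.2
  have hle : ∀ N, IsSubrep ρ N → u ∈ N → sInf S ≤ N := fun N hN hu => sInf_le ⟨hN, hu⟩
  have hSM : sInf S ≤ M := hle M hM huM.1
  refine ⟨sInf S, hSM.trans hMW, hS, fun h => hu0 ((Submodule.eq_bot_iff _).1 h u huS), ?_⟩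
  intro N hNS hN
  have : CompleteSpace N := hN.1.completeSpace_coe
  set u₁ := N.starProjection u
  have hu₁ : u₁ ∈ N := N.starProjection_apply_mem u
  have hu₂ : u - u₁ ∈ Nᗮ := N.sub_starProjection_mem_orthogonal u
  -- both components of the eigenvector `u` in `N ⊕ Nᗮ` are eigenvectors, as `T` preserves `N` and
  -- `Nᗮ`
  have hTu₁ : T u₁ = c • u₁ := by
    have h1 : T u₁ - c • u₁ ∈ N := N.sub_mem (hN.repInt_mem hρ hi hu₁) (N.smul_mem c hu₁)
    have h2 : T (u - u₁) - c • (u - u₁) ∈ Nᗮ :=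
      Submodule.sub_mem _ (hN.orthogonal.repInt_mem hρ hi hu₂) (Submodule.smul_mem _ c hu₂)
    have h3 : T u₁ - c • u₁ = -(T (u - u₁) - c • (u - u₁)) := by
      have h4 : T u = c • u := (hE u).1 huM.2
      rw [map_sub, h4, smul_sub]
      abel
    have h5 : T u₁ - c • u₁ ∈ N ⊓ Nᗮ := ⟨h1, h3 ▸ Submodule.neg_mem _ h2⟩
    rw [Submodule.inf_orthogonal_eq_bot, Submodule.mem_bot] at h5
    exact sub_eq_zero.1 h5
  by_cases h0 : u₁ = 0
  · left
    rw [h0, sub_zero] at hu₂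
    have h1 : N ≤ Nᗮ := hNS.trans (hle _ hN.orthogonal hu₂)
    have h2 := N.inf_orthogonal_eq_bot
    rwa [inf_eq_left.2 h1] at h2
  · right
    have h1 : N ⊓ E = M ⊓ E := hmin N (hNS.trans hSM) hN fun h =>
      h0 ((Submodule.eq_bot_iff _).1 h u₁ ⟨hu₁, (hE _).2 hTu₁⟩)
    have h2 : u ∈ N ⊓ E := h1 ▸ huM
    exact le_antisymm hNS (hle N hN h2.1)

/-- The representation is the closed orthogonal sum of minimal closed invariant subspaces. -/
theorem HasCompactOps.exists_decomposition {hρ : ∀ v, Continuous fun x => ρ x v}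
    (hc : HasCompactOps μ hρ) :
    ∃ S : Set (Submodule ℂ H), (∀ W ∈ S, IsMinSubrep ρ W) ∧ S.Pairwise (fun W W' => W ⟂ W') ∧
      ∀ u, (∀ W ∈ S, u ∈ Wᗮ) → u = 0 := by
  let F : Set (Set (Submodule ℂ H)) :=
    {S | (∀ W ∈ S, IsMinSubrep ρ W) ∧ S.Pairwise (fun W W' => W ⟂ W')}
  obtain ⟨S, hS⟩ := zorn_subset F fun C hC hch => by
    refine ⟨⋃₀ C, ⟨?_, ?_⟩, fun s hs => subset_sUnion_of_mem hs⟩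
    · rintro W ⟨s, hs, hWs⟩
      exact (hC hs).1 W hWs
    · exact (pairwise_sUnion hch.directedOn).2 fun s hs => (hC hs).2
  refine ⟨S, hS.prop.1, hS.prop.2, ?_⟩
  by_contra! h
  obtain ⟨u, hu, hu0⟩ := h
  -- the orthogonal complement of the sum of `S`
  let W : Submodule ℂ H := sInf {N | ∃ M ∈ S, N = Mᗮ}
  have hW : IsSubrep ρ W := IsSubrep.sInf (by
    rintro N ⟨M, hM, rfl⟩
    exact (hS.prop.1 M hM).1.orthogonal)
  have huW : u ∈ W := Submodule.mem_sInf.2 (by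
    rintro N ⟨M, hM, rfl⟩
    exact hu M hM)
  obtain ⟨W', hW'W, hW'⟩ := hc.exists_isMinSubrep_le hW fun h =>
    hu0 ((Submodule.eq_bot_iff _).1 h u huW)
  have horth : ∀ M ∈ S, W' ⟂ M := fun M hM =>
    (hW'W.trans (sInf_le ⟨M, hM, rfl⟩))
  have hins : insert W' S ∈ F := by
    refine ⟨?_, ?_⟩
    · rintro M (rfl | hM)
      · exact hW'
      · exact hS.prop.1 M hM
    · refine hS.prop.2.insert fun M hM _ => ⟨horth M hM, (horth M hM).symm⟩
  have hmem : W' ∈ S := hS.le_of_ge hins (subset_insert _ _) (mem_insert _ _)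
  exact hW'.2.1 (Submodule.isOrtho_self.1 (horth W' hmem))

end Subrep

/-! ### Irreducible constituents and the spectral expansion -/

section Constituents

variable {G : Type u} [Group G] [TopologicalSpace G] {H : Type u} [NormedAddCommGroup H]
  [InnerProductSpace ℂ H] [CompleteSpace H] {ρ : G →* (H ≃ₗᵢ[ℂ] H)}

/-- A minimal closed invariant subspace as an irreducible unitary representation. -/
def IsMinSubrep.irrRep {W : Submodule ℂ H} (hW : IsMinSubrep ρ W)
    (hρ : ∀ v, Continuous fun x => ρ x v) : IrrUnitaryRep G where
  space := W
  instComplete := hW.1.1.completeSpace_coe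
  rep := subRep hW.1
  continuous_orbit v := (hρ v).subtype_mk _
  nontrivial := Submodule.nontrivial_iff_ne_bot.2 hW.2.1
  irreducible N hN hN' := by
    have h1 : IsSubrep ρ (N.map W.subtype) := by
      refine ⟨?_, ?_⟩
      · rw [Submodule.map_coe]
        exact hW.1.1.isClosedEmbedding_subtypeVal.isClosedMap _ hN
      · rintro x _ ⟨v, hv, rfl⟩
        exact ⟨_, hN' x v hv, rfl⟩
    rcases hW.2.2 _ (Submodule.map_subtype_le W N) h1 with h | h
    · left
      refine Submodule.map_injective_of_injective W.subtype_injective ?_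
      rw [h, Submodule.map_bot]
    · right
      refine Submodule.map_injective_of_injective W.subtype_injective ?_
      rw [h, Submodule.map_subtype_top]

variable (ρ) in
/-- A decomposition of `ρ` into irreducible representations: isometric intertwining operators from
the representatives of classes in the unitary dual, with orthogonal ranges whose closed sum is the
whole space. -/
structure RepDecomposition where
  ι : Type u
  cls : ι → UnitaryDual G
  incl : ∀ i, (cls i).out.space →ₗᵢ[ℂ] H
  incl_rep : ∀ i x v, incl i ((cls i).out.rep x v) = ρ x (incl i v)
  inner_incl : ∀ i j, i ≠ j → ∀ v w, inner ℂ (incl i v) (incl j w) = 0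
  eq_zero : ∀ u, (∀ i v, inner ℂ (incl i v) u = 0) → u = 0

theorem adjoint_apply_isometry {K : Type u} [NormedAddCommGroup K] [InnerProductSpace ℂ K]
    [CompleteSpace K] (J : K →ₗᵢ[ℂ] H) (v : K) : adjoint J.toContinuousLinearMap (J v) = v := by
  refine ext_inner_left ℂ fun w => ?_
  rw [adjoint_inner_right]
  exact J.inner_map_map w v

theorem adjoint_rep {K : Type u} [NormedAddCommGroup K] [InnerProductSpace ℂ K]
    [CompleteSpace K] {σ : G →* (K ≃ₗᵢ[ℂ] K)} {T : K →L[ℂ] H}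
    (hT : ∀ x v, T (σ x v) = ρ x (T v)) (x : G) (u : H) :
    adjoint T (ρ x u) = σ x (adjoint T u) := by
  refine ext_inner_left ℂ fun w => ?_
  rw [adjoint_inner_right, inner_rep_right, inner_rep_right, adjoint_inner_right, hT]

variable [IsTopologicalGroup G] [SecondCountableTopology G] [MeasurableSpace G] [BorelSpace G]
  [LocallyCompactSpace G] [T2Space G] {μ : Measure G} [μ.IsHaarMeasure] [μ.IsInvInvariant]

theorem HasCompactOps.nonempty_repDecomposition {hρ : ∀ v, Continuous fun x => ρ x v}
    (hc : HasCompactOps μ hρ) : Nonempty (RepDecomposition ρ) := by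
  obtain ⟨S, hS, hS', hS0⟩ := hc.exists_decomposition
  let σ : S → IrrUnitaryRep G := fun W => (hS W W.2).irrRep hρ
  let c : S → UnitaryDual G := fun W => Quotient.mk _ (σ W)
  have hU : ∀ W, ∃ U : (c W).out.space ≃ₗᵢ[ℂ] (σ W).space,
      ∀ x v, U ((c W).out.rep x v) = (σ W).rep x (U v) := fun W =>
    Quotient.mk_out (s := IrrUnitaryRep.setoid) (σ W)
  choose U hU using hU
  let J : ∀ W : S, (c W).out.space →ₗᵢ[ℂ] H := fun W =>
    (W : Submodule ℂ H).subtypeₗᵢ.comp (U W).toLinearIsometry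
  have hJ : ∀ (W : S) v, J W v ∈ (W : Submodule ℂ H) := fun W v =>
    Subtype.prop (p := fun x => x ∈ (W : Submodule ℂ H)) (U W v)
  refine ⟨⟨S, c, J, ?_, ?_, ?_⟩⟩
  · intro W x v
    exact congrArg (Subtype.val (p := fun x => x ∈ (W : Submodule ℂ H))) (hU W x v)
  · intro W W' h v w
    exact (Submodule.isOrtho_iff_inner_eq.1 (hS' W.2 W'.2 fun e => h (Subtype.ext e))) _ (hJ W v) _
      (hJ W' w)
  · intro u hu
    refine hS0 u fun W hW => ?_
    rw [Submodule.mem_orthogonal]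
    intro w hw
    have h1 := hu ⟨W, hW⟩ ((U ⟨W, hW⟩).symm ⟨w, hw⟩)
    have h2 : J ⟨W, hW⟩ ((U ⟨W, hW⟩).symm ⟨w, hw⟩) = w :=
      congrArg (Subtype.val (p := fun x => x ∈ W)) ((U ⟨W, hW⟩).apply_symm_apply ⟨w, hw⟩)
    rwa [h2] at h1

/-- `ρ(f)` restricts to `σ(f)` on an invariant subspace isomorphic to `σ`. -/
theorem adjoint_comp_repInt {K : Type u} [NormedAddCommGroup K] [InnerProductSpace ℂ K]
    [CompleteSpace K] {σ : G →* (K ≃ₗᵢ[ℂ] K)} (hρ : ∀ v, Continuous fun x => ρ x v)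
    (hσ : ∀ v, Continuous fun x => σ x v) {f : G → ℂ} (hf : Integrable f μ) (J : K →ₗᵢ[ℂ] H)
    (hJ : ∀ x v, J (σ x v) = ρ x (J v)) :
    (adjoint J.toContinuousLinearMap).comp ((repInt hρ hf).comp J.toContinuousLinearMap) =
      repInt hσ hf := by
  ext v
  have h1 := repInt_intertwine hσ hρ hf (T := J.toContinuousLinearMap) hJ v
  rw [comp_apply, comp_apply, ← h1]
  exact adjoint_apply_isometry J _

theorem HasCompactOps.of_isometry {K : Type u} [NormedAddCommGroup K] [InnerProductSpace ℂ K]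
    [CompleteSpace K] {σ : G →* (K ≃ₗᵢ[ℂ] K)} {hρ : ∀ v, Continuous fun x => ρ x v}
    (hc : HasCompactOps μ hρ) (hσ : ∀ v, Continuous fun x => σ x v) (J : K →ₗᵢ[ℂ] H)
    (hJ : ∀ x v, J (σ x v) = ρ x (J v)) : HasCompactOps μ hσ := by
  intro U hU hU' h
  rw [← adjoint_comp_repInt hρ hσ h J hJ]
  exact ((hc U hU hU' h).comp_clm J.toContinuousLinearMap).clm_comp
    (adjoint J.toContinuousLinearMap)

/-- Schur's lemma for a representation on which the group acts by compact operators: an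
intertwining operator preserves the finite dimensional eigenspaces of these, hence has an
eigenvalue. -/
theorem IrrUnitaryRep.exists_eq_smul (π : IrrUnitaryRep G)
    (hc : HasCompactOps μ π.continuous_orbit) {B : π.space →L[ℂ] π.space}
    (hB : ∀ x v, B (π.rep x v) = π.rep x (B v)) : ∃ c : ℂ, ∀ v, B v = c • v := by
  have := π.nontrivial
  obtain ⟨U, hi, c, hcomp, hc0, u, -, hu0, hu⟩ := hc.exists_eigenvector isSubrep_top
    (top_ne_bot : (⊤ : Submodule ℂ π.space) ≠ ⊥)
  set T := repInt π.continuous_orbit hi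
  let E : Submodule ℂ π.space := Module.End.eigenspace T.toLinearMap c
  have hE : ∀ u, u ∈ E ↔ T u = c • u := fun u => Module.End.mem_eigenspace_iff
  have : FiniteDimensional ℂ E := finite_dimensional_eigenspace hcomp c hc0
  have : Nontrivial E := ⟨⟨u, (hE u).2 hu⟩, 0, fun h => hu0 (congrArg Subtype.val h)⟩
  have hBE : ∀ v ∈ E, B.toLinearMap v ∈ E := by
    intro v hv
    rw [hE] at hv ⊢
    have h1 := repInt_intertwine π.continuous_orbit π.continuous_orbit hi (T := B) hB v
    change T (B v) = c • B v
    rw [← h1, ← map_smul, ← hv]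
  obtain ⟨b, hb⟩ := Module.End.exists_eigenvalue (B.toLinearMap.restrict hBE)
  obtain ⟨w, hw⟩ := hb.exists_hasEigenvector
  have hw1 : B w = b • (w : π.space) := congrArg Subtype.val hw.apply_eq_smul
  -- the eigenspace of `B` is closed, invariant and nonzero
  let N : Submodule ℂ π.space := (B - b • ContinuousLinearMap.id ℂ π.space).ker
  have hN : ∀ v, v ∈ N ↔ B v = b • v := fun v => by
    change B v - b • v = 0 ↔ _
    exact sub_eq_zero
  have hNc : IsClosed (N : Set π.space) := ContinuousLinearMap.isClosed_ker _
  rcases π.irreducible N hNc (fun x v hv => by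
    rw [hN] at hv ⊢
    rw [hB, hv, map_smul]) with h | h
  · exact absurd ((Submodule.eq_bot_iff _).1 h w ((hN w).2 hw1)) fun h0 => hw.2 (Subtype.ext h0)
  · exact ⟨b, fun v => (hN v).1 (h ▸ Submodule.mem_top)⟩

/-- There are no intertwining operators between inequivalent irreducible representations: for
`T ≠ 0` the scalar `T T†` is positive, so that `T†` is an isometry up to a constant. -/
theorem UnitaryDual.eq_of_intertwine {π σ : UnitaryDual G}
    (hc : HasCompactOps μ σ.out.continuous_orbit) {T : π.out.space →L[ℂ] σ.out.space}
    (hT : ∀ x v, T (π.out.rep x v) = σ.out.rep x (T v)) {v₀ : π.out.space} (hv₀ : T v₀ ≠ 0) :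
    σ = π := by
  have hT' := adjoint_rep hT
  obtain ⟨c, hcT⟩ := σ.out.exists_eq_smul hc (B := T.comp (adjoint T)) fun x v => by
    rw [comp_apply, comp_apply, hT', hT]
  have hn : ∀ v, ((‖adjoint T v‖ ^ 2 : ℝ) : ℂ) = c * ((‖v‖ ^ 2 : ℝ) : ℂ) := by
    intro v
    have h1 : inner ℂ v (T (adjoint T v)) = inner ℂ (adjoint T v) (adjoint T v) :=
      (adjoint_inner_left T _ _).symm
    have h2 : T (adjoint T v) = c • v := hcT v
    rw [h2, inner_smul_right, inner_self_eq_norm_sq_to_K, inner_self_eq_norm_sq_to_K] at h1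
    push_cast
    exact h1.symm
  have hn' : ∀ v, ‖adjoint T v‖ ^ 2 = c.re * ‖v‖ ^ 2 := by
    intro v
    have h := congrArg Complex.re (hn v)
    rwa [Complex.re_mul_ofReal, Complex.ofReal_re] at h
  have hne : adjoint T (T v₀) ≠ 0 := by
    intro h
    apply hv₀
    have h1 : inner ℂ (T v₀) (T v₀) = inner ℂ (adjoint T (T v₀)) v₀ :=
      (adjoint_inner_left T _ _).symm
    rw [h, inner_zero_left] at h1
    exact inner_self_eq_zero.1 h1
  have hc0 : 0 < c.re := by
    have h1 := hn' (T v₀)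
    have h2 : 0 < ‖adjoint T (T v₀)‖ ^ 2 := by positivity
    have h3 : 0 < ‖T v₀‖ ^ 2 := by positivity
    rw [h1] at h2
    exact (pos_iff_pos_of_mul_pos h2).2 h3
  -- `T†` multiplies norms by `√c`
  let r : ℝ := (Real.sqrt c.re)⁻¹
  have hr : 0 < r := inv_pos.2 (Real.sqrt_pos.2 hc0)
  let L : σ.out.space →ₗᵢ[ℂ] π.out.space :=
    { toLinearMap := ((r : ℂ) • adjoint T).toLinearMap
      norm_map' := fun v => by
        change ‖(r : ℂ) • adjoint T v‖ = ‖v‖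
        rw [norm_smul, Complex.norm_real, Real.norm_of_nonneg hr.le,
          ← Real.sqrt_sq (norm_nonneg (adjoint T v)), hn', Real.sqrt_mul hc0.le,
          Real.sqrt_sq (norm_nonneg v), ← mul_assoc,
          inv_mul_cancel₀ (Real.sqrt_pos.2 hc0).ne', one_mul] }
  have hL : ∀ x v, L (σ.out.rep x v) = π.out.rep x (L v) := fun x v => by
    change (r : ℂ) • adjoint T (σ.out.rep x v) = π.out.rep x ((r : ℂ) • adjoint T v)
    rw [hT', map_smul]
  have hcl : IsClosed ((LinearMap.range L.toLinearMap : Submodule ℂ π.out.space) :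
      Set π.out.space) := by
    have h := L.isometry.isClosedEmbedding.isClosed_range
    exact h
  have hsurj : Function.Surjective L := by
    rcases π.out.irreducible _ hcl (by
      rintro x _ ⟨v, rfl⟩
      exact ⟨σ.out.rep x v, hL x v⟩) with h | h
    · exfalso
      have h1 : L (T v₀) = 0 := (Submodule.eq_bot_iff _).1 h _ ⟨_, rfl⟩
      exact hv₀ ((map_eq_zero_iff L L.injective).1 h1)
    · exact LinearMap.range_eq_top.1 h
  exact Quotient.out_equiv_out.1 ⟨LinearIsometryEquiv.ofSurjective L hsurj, hL⟩

namespace RepDecomposition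

variable (D : RepDecomposition ρ) {hρ : ∀ v, Continuous fun x => ρ x v}

/-- The indices of the constituents of class `π`. -/
abbrev Fib (π : UnitaryDual G) : Type u := {i // D.cls i = π}

variable {D} in
/-- The inclusion of a constituent of class `π`. -/
def emb {π : UnitaryDual G} (i : D.Fib π) : π.out.space →ₗᵢ[ℂ] H := i.2 ▸ D.incl i

variable {D} {π : UnitaryDual G}

theorem emb_rep (i : D.Fib π) (x : G) (v : π.out.space) :
    emb i (π.out.rep x v) = ρ x (emb i v) := by
  obtain ⟨i, rfl⟩ := i
  exact D.incl_rep i x v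

theorem exists_incl_eq (i : D.Fib π) (v : π.out.space) : ∃ w, emb i v = D.incl i w := by
  obtain ⟨i, rfl⟩ := i
  exact ⟨v, rfl⟩

theorem inner_emb {i j : D.Fib π} (h : i ≠ j) (v w : π.out.space) :
    inner ℂ (emb i v) (emb j w) = 0 := by
  obtain ⟨v', hv⟩ := exists_incl_eq i v
  obtain ⟨w', hw⟩ := exists_incl_eq j w
  rw [hv, hw]
  exact D.inner_incl i j (fun e => h (Subtype.ext e)) _ _

theorem hasCompactOps (hc : HasCompactOps μ hρ) (i : D.ι) :
    HasCompactOps μ (D.cls i).out.continuous_orbit :=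
  hc.of_isometry _ (D.incl i) (D.incl_rep i)

/-- Each constituent of class `π` contributes to the same eigenspace of a compact operator. -/
theorem finite_fib (hc : HasCompactOps μ hρ) : Finite (D.Fib π) := by
  rcases isEmpty_or_nonempty (D.Fib π) with h | ⟨⟨i₀⟩⟩
  · infer_instance
  have := π.out.nontrivial
  have hπ : HasCompactOps μ π.out.continuous_orbit := hc.of_isometry _ (emb i₀) (emb_rep i₀)
  obtain ⟨v, hv⟩ := exists_ne (0 : π.out.space)
  obtain ⟨U, hU, hU', hne⟩ := exists_repInt_indicator_ne_zero (μ := μ) π.out.continuous_orbit hv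
  have hi := integrable_indicator_one (μ := μ) hU
  obtain ⟨c, hc0, u, -, hu0, hu⟩ := EquivTrace.exists_eigenvector (hπ U hU hU' hi)
    (isSymmetric_repInt_indicator π.out.continuous_orbit hU' hi) isClosed_univ
    (W := ⊤) (fun _ _ => trivial) (v := v) trivial (hne hi)
  set T := repInt hρ hi
  let E : Submodule ℂ H := Module.End.eigenspace T.toLinearMap c
  have : FiniteDimensional ℂ E := finite_dimensional_eigenspace (hc U hU hU' hi) c hc0
  have hE : ∀ i : D.Fib π, emb i u ∈ E := fun i => by
    refine Module.End.mem_eigenspace_iff.2 ?_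
    have h1 := repInt_intertwine π.out.continuous_orbit hρ hi
      (T := (emb i).toContinuousLinearMap) (emb_rep i) u
    rw [hu, map_smul] at h1
    exact h1.symm
  have hli : LinearIndependent ℂ fun i : D.Fib π => (⟨emb i u, hE i⟩ : E) :=
    linearIndependent_of_ne_zero_of_inner_eq_zero
      (fun i h => hu0 ((map_eq_zero_iff (emb i) (emb i).injective).1 (congrArg Subtype.val h)))
      fun i j hij => inner_emb hij u u
  exact hli.finite

/-- An intertwining operator is determined by its components in the constituents of class `π`. -/
theorem eq_zero_of_intertwine (hc : HasCompactOps μ hρ) {T : π.out.space →L[ℂ] H}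
    (hT : ∀ x v, T (π.out.rep x v) = ρ x (T v))
    (h0 : ∀ (i : D.Fib π) v w, inner ℂ (emb i w) (T v) = 0) : T = 0 := by
  ext v
  refine D.eq_zero _ fun i w => ?_
  by_cases h : D.cls i = π
  · subst h
    exact h0 ⟨i, rfl⟩ v w
  · have h1 := adjoint_rep (T := (D.incl i).toContinuousLinearMap) (D.incl_rep i)
    by_contra hne
    refine h (UnitaryDual.eq_of_intertwine (hasCompactOps hc i)
      (T := (adjoint (D.incl i).toContinuousLinearMap).comp T) (fun x v => ?_) (v₀ := v) ?_)
    · rw [comp_apply, comp_apply, hT, h1]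
    · intro h2
      apply hne
      have h3 : inner ℂ w (adjoint (D.incl i).toContinuousLinearMap (T v)) = 0 := by
        rw [← comp_apply, h2, inner_zero_right]
      rwa [adjoint_inner_right] at h3

/-- The operator which an intertwining operator of `ρ` and a constituent induce on the latter is a
scalar. -/
theorem exists_inner_emb_eq (hc : HasCompactOps μ hρ) (i : D.Fib π) {T : π.out.space →L[ℂ] H}
    (hT : ∀ x v, T (π.out.rep x v) = ρ x (T v)) :
    ∃ c : ℂ, ∀ v w, inner ℂ (emb i w) (T v) = c * inner ℂ w v := by
  have hπ : HasCompactOps μ π.out.continuous_orbit := hc.of_isometry _ (emb i) (emb_rep i)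
  have h1 := adjoint_rep (T := (emb i).toContinuousLinearMap) (emb_rep i)
  obtain ⟨c, hc⟩ := π.out.exists_eq_smul hπ
    (B := (adjoint (emb i).toContinuousLinearMap).comp T) fun x v => by
      rw [comp_apply, comp_apply, hT, h1]
  refine ⟨c, fun v w => ?_⟩
  rw [← inner_smul_right, ← hc, comp_apply, adjoint_inner_right]
  rfl

/-- The inclusions of the constituents of class `π` form a basis of the space of intertwining
operators from `π`, in which the trace of composition with `A` can be read off. -/
theorem trace_eq (hc : HasCompactOps μ hρ) {M : Submodule ℂ (π.out.space →L[ℂ] H)}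
    (hM : ∀ T, T ∈ M ↔ ∀ x v, T (π.out.rep x v) = ρ x (T v)) :
    FiniteDimensional ℂ M ∧ (M ≠ ⊥ → Nonempty (D.Fib π)) ∧
      ∀ [Fintype (D.Fib π)] (A : H →L[ℂ] H) (L : M →ₗ[ℂ] M)
        (_ : ∀ T, (L T : π.out.space →L[ℂ] H) = A.comp T.1) (c : D.Fib π → ℂ)
        (_ : ∀ i v w, inner ℂ (emb i w) (A (emb i v)) = c i * inner ℂ w v),
        LinearMap.trace ℂ M L = ∑ i, c i := by
  have := finite_fib (D := D) (π := π) hc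
  have := π.out.nontrivial
  obtain ⟨v₀, hv₀⟩ := exists_norm_eq π.out.space zero_le_one
  have hv₁ : inner ℂ v₀ v₀ = (1 : ℂ) := by
    rw [inner_self_eq_norm_sq_to_K, hv₀]; simp
  -- an intertwining operator has a scalar component in each constituent of class `π`
  let φ : M →ₗ[ℂ] (D.Fib π → ℂ) :=
    { toFun := fun T i => inner ℂ (emb i v₀) ((T : π.out.space →L[ℂ] H) v₀)
      map_add' := fun S T => by
        funext i
        exact inner_add_right _ _ _
      map_smul' := fun c T => by
        funext i
        exact inner_smul_right _ _ _ }
  have hφ : Function.Injective φ := by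
    rw [injective_iff_map_eq_zero]
    intro T hT
    refine Subtype.ext (eq_zero_of_intertwine (D := D) hc ((hM _).1 T.2) fun i v w => ?_)
    obtain ⟨c, hc⟩ := exists_inner_emb_eq hc i ((hM _).1 T.2)
    have h1 : inner ℂ (emb i v₀) ((T : π.out.space →L[ℂ] H) v₀) = 0 := congrFun hT i
    rw [hc, hv₁, mul_one] at h1
    rw [hc, h1, zero_mul]
  have hfin : FiniteDimensional ℂ M := FiniteDimensional.of_injective φ hφ
  refine ⟨hfin, fun h => ?_, ?_⟩
  · by_contra hne
    rw [not_nonempty_iff] at hne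
    refine h ((Submodule.eq_bot_iff _).2 fun T hT => ?_)
    exact congrArg Subtype.val (hφ (Subsingleton.elim (φ ⟨T, hT⟩) (φ 0)))
  · intro _ A L hL c hcA
    classical
    let e : D.Fib π → M := fun i => ⟨(emb i).toContinuousLinearMap, (hM _).2 (emb_rep i)⟩
    have he : ∀ i, φ (e i) = Pi.single i 1 := by
      intro i
      funext j
      change inner ℂ (emb j v₀) (emb i v₀) = _
      by_cases h : j = i
      · subst h
        rw [(emb j).inner_map_map, hv₁, Pi.single_eq_same]
      · rw [inner_emb h, Pi.single_eq_of_ne h]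
    have hsurj : Function.Surjective φ := by
      intro y
      refine ⟨∑ i, y i • e i, ?_⟩
      simp only [map_sum, map_smul, he]
      funext j
      simp [Finset.sum_apply, Pi.single_apply]
    let b : Module.Basis (D.Fib π) ℂ M := Module.Basis.ofEquivFun (LinearEquiv.ofBijective φ ⟨hφ, hsurj⟩)
    have hb : ∀ i, b i = e i := fun i => by
      apply hφ
      rw [he]
      have h1 : LinearEquiv.ofBijective φ ⟨hφ, hsurj⟩ (b i) = Pi.single i 1 := by
        simp [b]
      exact h1
    rw [LinearMap.trace_eq_matrix_trace ℂ b, Matrix.trace]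
    refine Finset.sum_congr rfl fun i _ => ?_
    rw [Matrix.diag_apply, LinearMap.toMatrix_apply, hb]
    change inner ℂ (emb i v₀) ((L (e i) : π.out.space →L[ℂ] H) v₀) = c i
    rw [hL]
    change inner ℂ (emb i v₀) (A (emb i v₀)) = c i
    rw [hcA, hv₁, mul_one]

/-- The Hilbert basis which Hilbert bases of the constituents form. -/
theorem exists_collected_hilbertBasis {κ : D.ι → Type u}
    (b : ∀ i, HilbertBasis (κ i) ℂ (D.cls i).out.space) :
    ∃ e : HilbertBasis (Σ i, κ i) ℂ H, ∀ i k, e ⟨i, k⟩ = D.incl i (b i k) := by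
  have hon : Orthonormal ℂ fun q : Σ i, κ i => D.incl q.1 (b q.1 q.2) := by
    constructor
    · rintro ⟨i, k⟩
      rw [LinearIsometry.norm_map]
      exact (b i).orthonormal.1 k
    · rintro ⟨i, k⟩ ⟨j, l⟩ hne
      by_cases h : i = j
      · subst h
        rw [LinearIsometry.inner_map_map]
        exact (b i).orthonormal.2 fun e => hne (congrArg (Sigma.mk i) e)
      · exact D.inner_incl i j h _ _
  refine ⟨HilbertBasis.mkOfOrthogonalEqBot hon ((Submodule.eq_bot_iff _).2 fun u hu => ?_),
    fun i k => by rw [HilbertBasis.coe_mkOfOrthogonalEqBot]⟩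
  rw [Submodule.mem_orthogonal] at hu
  refine D.eq_zero u fun i v => ?_
  have h1 : ∀ w, inner ℂ w (adjoint (D.incl i).toContinuousLinearMap u) = 0 := by
    have h2 : adjoint (D.incl i).toContinuousLinearMap u = 0 := by
      rw [← (b i).repr.map_eq_zero_iff]
      ext k
      rw [(b i).repr_apply_apply, adjoint_inner_right]
      exact hu _ (Submodule.subset_span ⟨⟨i, k⟩, rfl⟩)
    intro w
    rw [h2, inner_zero_right]
  have h3 := h1 v
  rwa [adjoint_inner_right] at h3

end RepDecomposition

/-- The spectral expansion of the trace of `A ρ(f)`, for an operator `A` commuting with a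
representation on which the group acts by compact operators. -/
theorem hasSum_spectral {hρ : ∀ v, Continuous fun x => ρ x v} (hc : HasCompactOps μ hρ)
    {A : H →L[ℂ] H} (hA : ∀ x v, A (ρ x v) = ρ x (A v)) {f : G → ℂ} (hf : Integrable f μ)
    (hfC : repInt hρ hf ∈ hsProducts H H) {t : ℂ} (ht : HasTrace (A.comp (repInt hρ hf)) t)
    {M : ∀ π : UnitaryDual G, Submodule ℂ (π.out.space →L[ℂ] H)}
    (hM : ∀ π T, T ∈ M π ↔ ∀ x v, T (π.out.rep x v) = ρ x (T v)) {L : ∀ π, M π →ₗ[ℂ] M π}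
    (hL : ∀ π T, (L π T : π.out.space →L[ℂ] H) = A.comp T.1) :
    (∀ π, FiniteDimensional ℂ (M π) ∧ (M π ≠ ⊥ → IsTraceClass (π.out.op μ f))) ∧
      HasSum (fun π => LinearMap.trace ℂ (M π) (L π) * opTrace (π.out.op μ f)) t := by
  obtain ⟨D⟩ := hc.nonempty_repDecomposition
  have htr : ∀ π : UnitaryDual G, Nonempty (D.Fib π) → ∃ t, HasTrace (π.out.op μ f) t := by
    rintro π ⟨i⟩
    rw [π.out.op_eq_repInt hf, ← adjoint_comp_repInt hρ π.out.continuous_orbit hf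
      (RepDecomposition.emb i) (RepDecomposition.emb_rep i)]
    exact exists_hasTrace_of_mem_hsProducts (conj_mem_hsProducts hfC _)
  have hbasis := fun π => RepDecomposition.trace_eq (D := D) hc (hM π)
  refine ⟨fun π => ⟨(hbasis π).1, fun h => ?_⟩, ?_⟩
  · obtain ⟨t, ht⟩ := htr π ((hbasis π).2.1 h)
    exact ht.1
  have hscal : ∀ i, ∃ c : ℂ, ∀ v w,
      inner ℂ (D.incl i w) (A (D.incl i v)) = c * inner ℂ w v := fun i =>
    RepDecomposition.exists_inner_emb_eq hc (⟨i, rfl⟩ : D.Fib (D.cls i))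
      (T := A.comp (D.incl i).toContinuousLinearMap) fun x v => by
        change A (D.incl i _) = ρ x (A (D.incl i v))
        rw [D.incl_rep, hA]
  choose c hcA using hscal
  have hb := fun i => exists_hilbertBasis ℂ (D.cls i).out.space
  choose κ b _ using hb
  obtain ⟨e, he⟩ := RepDecomposition.exists_collected_hilbertBasis b
  have h1 : HasSum (fun i => c i * opTrace ((D.cls i).out.op μ f)) t := by
    refine (ht.2 _ e).sigma fun i => ?_
    obtain ⟨s, hs⟩ := htr (D.cls i) ⟨⟨i, rfl⟩⟩
    rw [hs.opTrace_eq]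
    refine ((hs.2 _ (b i)).mul_left (c i)).congr_fun fun k => ?_
    have h2 := repInt_intertwine (D.cls i).out.continuous_orbit hρ hf
      (T := (D.incl i).toContinuousLinearMap) (D.incl_rep i) (b i k)
    rw [he, comp_apply]
    change D.incl i (repInt _ hf (b i k)) = repInt hρ hf (D.incl i (b i k)) at h2
    rw [← h2, (D.cls i).out.op_eq_repInt hf]
    exact hcA i _ _
  have h2 := (Equiv.sigmaFiberEquiv D.cls).hasSum_iff.2 h1
  refine h2.sigma fun π => ?_
  have := RepDecomposition.finite_fib (D := D) (π := π) hc
  have := Fintype.ofFinite (D.Fib π)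
  rw [(hbasis π).2.2 A (L π) (hL π) (fun i => c i) (fun i v w => by
    obtain ⟨i, rfl⟩ := i
    exact hcA i v w), Finset.sum_mul]
  convert hasSum_fintype _ using 2 with i
  obtain ⟨i, rfl⟩ := i
  rfl

end Constituents

/-! ### The spectral side for `L²(Γ\G, ψ)` -/

section RightTranslation

variable {G W : Type u} [Group G] [TopologicalSpace G] [IsTopologicalGroup G]
  [LocallyCompactSpace G] [T2Space G] [SecondCountableTopology G] [MeasurableSpace G]
  [BorelSpace G] {μ : Measure G} [μ.IsHaarMeasure] [μ.IsMulRightInvariant] [μ.IsInvInvariant]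
  {Γ : Subgroup G} [DiscreteTopology Γ]
  [NormedAddCommGroup W] [InnerProductSpace ℂ W] [FiniteDimensional ℂ W]
  {ψ : Γ →* (W ≃ₗᵢ[ℂ] W)}

/-- Convolution with the characteristic function of a compact set is Hilbert–Schmidt. -/
theorem hasCompactOps_right (hΓ : IsCocompact Γ) :
    HasCompactOps μ (L2.continuous_right (μ := μ) (ψ := ψ) hΓ) := by
  intro U hU _ h
  exact (L2.isHS_convOp (ψ := ψ) hΓ h
    ((isBddCompact_indicator hU).isSupBounded hΓ)).isCompactOperator

theorem pull_right {g : G} (hg : ∀ x, x ∈ Γ ↔ g * x * g⁻¹ ∈ Γ)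
    (hψ : ∀ γ η : Γ, (η : G) = g * γ * g⁻¹ → ψ η = ψ γ) (z : G) (s : L2 μ ψ) :
    L2.pull hg hψ (L2.right z s) = L2.right z (L2.pull hg hψ s) := by
  refine L2.ext ?_
  filter_upwards [L2.coe_pull hg hψ (L2.right z s), ae_mul_left g (L2.coe_right z s),
    L2.coe_right z (L2.pull hg hψ s), ae_mul_right z (L2.coe_pull hg hψ s)] with x h1 h2 h3 h4
  rw [h1, h2, h3, h4, mul_assoc]

/-- The spectral expansion for `L²(Γ\G, ψ)` and `A = g^*`. -/
theorem HasTraceFormula.hasSum_spectral {hΓ : IsCocompact Γ} {g : G}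
    {hg : ∀ x, x ∈ Γ ↔ g * x * g⁻¹ ∈ Γ} {hψ : ∀ γ η : Γ, (η : G) = g * γ * g⁻¹ → ψ η = ψ γ}
    {f : G → ℂ} (hf : HasTraceFormula μ hg hψ f hΓ) {t : ℂ}
    (ht : HasTrace ((L2.pull hg hψ).comp (L2.convOp ψ hΓ hf.integrable)) t) :
    (∀ π : UnitaryDual G, FiniteDimensional ℂ (homG μ ψ π.out) ∧
        (homG μ ψ π.out ≠ ⊥ → IsTraceClass (π.out.op μ f))) ∧
      HasSum (fun π : UnitaryDual G => LinearMap.trace ℂ _ (homAction μ hg hψ π.out) *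
        opTrace (π.out.op μ f)) t :=
  EquivTrace.hasSum_spectral (ρ := L2.right) (hasCompactOps_right (μ := μ) (ψ := ψ) hΓ)
    (A := L2.pull hg hψ) (fun x v => pull_right hg hψ x v) hf.integrable hf.mem_hsProducts ht
    (M := fun π => homG μ ψ π.out) (fun _ _ => mem_homG_iff)
    (L := fun π => homAction μ hg hψ π.out) (fun _ _ => rfl)

end RightTranslation

end EquivTrace

end

open MeasureTheory EquivTrace in
theorem proposition2p2 {d : ℕ} {G V : Type u}
    [Group G] [TopologicalSpace G] [ChartedSpace (EuclideanSpace ℝ (Fin d)) G]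
    [LieGroup (𝓡 d) ∞ G] [IsTopologicalGroup G] [LocallyCompactSpace G] [T2Space G]
    [SecondCountableTopology G] [ConnectedSpace G] [MeasurableSpace G] [BorelSpace G]
    (hG : LieAlgebra.IsSemisimple ℝ (GroupLieAlgebra (𝓡 d) G))
    (μ : Measure G) [μ.IsHaarMeasure]
    (Γ : Subgroup G) [DiscreteTopology Γ] [CompactSpace (RightQuot Γ)]
    [NormedAddCommGroup V] [InnerProductSpace ℂ V] [FiniteDimensional ℂ V]
    (φ : Γ →* (V ≃ₗᵢ[ℂ] V))
    (g : G) (hg : ∀ x, x ∈ Γ ↔ g * x * g⁻¹ ∈ Γ)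
    (hφ : ∀ γ η : Γ, (η : G) = g * γ * g⁻¹ → φ η = φ γ)
    (f : G → ℂ) (hf : IsSmoothL1 d μ f)
    (ν : ∀ δ : G, Measure (cent δ)) [∀ δ, (ν δ).IsHaarMeasure] :
    CompleteSpace (L2 μ (dualRep φ)) ∧
    ∃ C : L2 μ (dualRep φ) →L[ℂ] L2 μ (dualRep φ),
      -- `C` is the convolution operator `s ↦ s * f`
      (∀ s : L2 μ (dualRep φ), (∀ x, Integrable (fun y => f (y⁻¹ * x) • s y) μ) ∧
        ∀ᵐ x ∂μ, C s x = ∫ y, f (y⁻¹ * x) • s y ∂μ) ∧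
      IsTraceClass C ∧
      -- the terms of the spectral side
      (∀ π : UnitaryDual G, FiniteDimensional ℂ (homG μ (dualRep φ) π.out) ∧
        (homG μ (dualRep φ) π.out ≠ ⊥ → IsTraceClass (π.out.op μ f))) ∧
      -- the terms of the geometric side
      (∀ γ : Γ, vol Γ (ν (γ * g)) < ⊤ ∧
        IsQuotientMeasure μ (ν (γ * g)) (quotientMeasure μ (ν (γ * g))) ∧
        Integrable (orbitalFun f (γ * g)) (quotientMeasure μ (ν (γ * g)))) ∧
      -- the trace of `g^* (· * f)` and its two expansions
      ∃ t : ℂ, HasTrace ((L2.pull hg (dualRep_conj hφ)).comp C) t ∧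
        HasSum (fun π : UnitaryDual G =>
          LinearMap.trace ℂ _ (homAction μ hg (dualRep_conj hφ) π.out) *
            opTrace (π.out.op μ f)) t ∧
        HasSum (fun c : TwistedClass Γ g =>
          ((vol Γ (ν (c.out * g))).toReal : ℂ) *
            LinearMap.trace ℂ V ((φ c.out).toLinearEquiv : V →ₗ[ℂ] V) *
            orbitalIntegral μ (ν (c.out * g)) f) t 
 := by
  have hΓ : IsCocompact Γ := isCocompact_of_compactSpace Γ
  have : μ.IsMulRightInvariant := isMulRightInvariant_of_isCocompact hΓ
  have : μ.IsInvInvariant := isInvInvariant_of_isMulRightInvariant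
  have htf : HasTraceFormula μ hg (dualRep_conj hφ) f hΓ :=
    hasTraceFormula_of_mem_span hg (dualRep_conj hφ) hΓ (hf.mem_span hΓ)
  obtain ⟨M, hM⟩ := htf.bound
  have hspec := htf.hasSum_spectral htf.hasTrace
  refine ⟨inferInstance, L2.convOp (dualRep φ) hΓ htf.integrable, fun s => ⟨fun x =>
    htf.isSupBounded.integrable_smul x s, ?_⟩, ?_, hspec.1, fun γ => ?_, _, htf.hasTrace, hspec.2,
    hasSum_geometric hΓ hg hφ ν htf.measurable hM⟩
  · filter_upwards [L2.coe_convOp (ψ := dualRep φ) hΓ htf.integrable htf.isSupBounded s] with x hx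
    rw [hx, L2.eval_apply]
  · obtain ⟨t, ht⟩ := exists_hasTrace_of_mem_hsProducts htf.mem_hsProducts
    exact ht.1
  · have h := orbital_formula (μ := μ) hΓ hg γ (ν _) htf.measurable hM
    exact ⟨h.1, h.2.1, h.2.2.1⟩
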